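/- Let $k\ge 2$ be a fixed integer. For strings $X_1,\dots,X_k$ of common length $N\ge 1$ over an alphabet $\Sigma=\{0,\dots,|\Sigma|-1\}$, with indices taken modulo $N$, and offsets $\Delta_1,\dots,\Delta_{k-1}\in\{0,\dots,N-1\}$, the offset score is the number of positions $i\in\{0,\dots,N-1\}$ with $$X_1[i+\Delta_1]=X_2[i+\Delta_2]=\dots=X_{k-1}[i+\Delta_{k-1}]=X_k[i].$$ Let $k\text{-}SD(X_1,\dots,X_k)$ be the maximum of the offset score over all choices of offsets, and let the $k$-Shift Distance distance be $k\,(N-k\text{-}SD(X_1,\dots,X_k))$. The model of computation is the word RAM with words of $w$ bits, where $w\ge c\log_2(|\Sigma|N)$ for a sufficiently large constant $c$; each arithmetic, logical, memory or jump instruction on words takes one unit of time, and the strings are given explicitly, one character per word. The constant $c$, the program and the constants hidden in $O(\cdot)$ depend only on $k$ (and on $\ell$ in the second part), and $\log_2(|\Sigma|N)$ is read as $1$ if $|\Sigma|N=1$. 1. There is an algorithm that, given $X_1,\dots,X_k$, computes $k\text{-}SD(X_1,\dots,X_k)$ together with offsets $\Delta_1,\dots,\Delta_{k-1}$ attaining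 it, in time $O\left(|\Sigma|\,N^{k-1}\log(|\Sigma|N)\right)$. 2. For every integer $\ell\ge 2$ there is an algorithm that, given $X_1,\dots,X_k$, computes a number $D'$ with $D\le D'\le \ell D$, where $D=k\,(N-k\text{-}SD(X_1,\dots,X_k))$ is the $k$-Shift Distance distance, in time $O\left(|\Sigma|\,N^{\lceil (k-1)/\ell\rceil}\log(|\Sigma|N)\right)$. -/

import Mathlib

namespace WordRAM

/-- The binary word operations of the machine; all of them act on `w`-bit words. -/
inductive BinOp
  | add | sub | mul | div | mod | and | or | xor | shl | shr

/-- Unsigned arithmetic modulo `2 ^ w` (`div` and `mod` are quotient and remainder of the unsigned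
values), bitwise logic, and logical shifts by the value of the second operand. -/
def BinOp.eval {w : ℕ} : BinOp → BitVec w → BitVec w → BitVec w
  | .add, x, y => x + y
  | .sub, x, y => x - y
  | .mul, x, y => x * y
  | .div, x, y => x / y
  | .mod, x, y => x % y
  | .and, x, y => x &&& y
  | .or, x, y => x ||| y
  | .xor, x, y => x ^^^ y
  | .shl, x, y => x <<< y.toNat
  | .shr, x, y => x >>> y.toNat

/-- The instructions. The arguments `dst`, `src`, `addr`, `a`, `b` are names of registers,
`target` is a position in the program. -/
inductive Instr
  /-- `dst := n` -/
  | const (dst n : ℕ)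
  /-- `dst := a op b` -/
  | bin (op : BinOp) (dst a b : ℕ)
  /-- `dst := memory[addr]` -/
  | load (dst addr : ℕ)
  /-- `memory[addr] := src` -/
  | store (addr src : ℕ)
  /-- `goto target` -/
  | jump (target : ℕ)
  /-- `if a < b then goto target` (unsigned comparison) -/
  | jumpLt (a b target : ℕ)
  /-- `if a = b then goto target` -/
  | jumpEq (a b target : ℕ)

/-- A program is a finite list of instructions (so it uses finitely many registers and constants).
It does not depend on the word size. -/
abbrev Program := List Instr

/-- A state of the machine with words of `w` bits: the program counter, the registers, and
the random access memory, whose `2 ^ w` cells are addressed by words. -/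
structure State (w : ℕ) where
  pc : ℕ
  reg : ℕ → BitVec w
  mem : BitVec w → BitVec w

variable {w : ℕ}

/-- Write a register and go to the next instruction. -/
def State.setReg (s : State w) (r : ℕ) (v : BitVec w) : State w :=
  { s with pc := s.pc + 1, reg := Function.update s.reg r v }

/-- The effect of a single instruction. -/
def Instr.exec (s : State w) : Instr → State w
  | .const dst n => s.setReg dst (BitVec.ofNat w n)
  | .bin op dst a b => s.setReg dst (op.eval (s.reg a) (s.reg b))
  | .load dst addr => s.setReg dst (s.mem (s.reg addr))
  | .store addr src =>
      { s with pc := s.pc + 1, mem := Function.update s.mem (s.reg addr) (s.reg src) }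
  | .jump target => { s with pc := target }
  | .jumpLt a b target =>
      { s with pc := if (s.reg a).toNat < (s.reg b).toNat then target else s.pc + 1 }
  | .jumpEq a b target => { s with pc := if s.reg a = s.reg b then target else s.pc + 1 }

/-- The machine has halted when the program counter has left the program. -/
def Halted (p : Program) (s : State w) : Prop := p.length ≤ s.pc

/-- One time step: one instruction is executed (and nothing happens after halting). -/
def step (p : Program) (s : State w) : State w :=
  match p[s.pc]? with
  | none => s
  | some i => i.exec s

/-- The state after `t` time steps. -/
def run (p : Program) (t : ℕ) (s : State w) : State w := (step p)^[t] s

end WordRAM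

namespace ShiftDistance

/-- The `i`-th character of the string `x` after a cyclic shift by `d`, that is `x[i + d]`, where
indices wrap around modulo the length. -/
def shifted {α : Type*} {N : ℕ} (x : Fin N → α) (d : ℕ) (i : Fin N) : α :=
  x ⟨(i.val + d) % N, Nat.mod_lt _ i.pos⟩

/-- The shift of the `j`-th of `k` strings: the offset `Δ j` for the first `k - 1` strings, and
`0` for the last one. -/
def shiftOf {k N : ℕ} (Δ : Fin (k - 1) → Fin N) (j : Fin k) : ℕ :=
  if h : j.val < k - 1 then (Δ ⟨j.val, h⟩).val else 0

/-- The offset score: the number of positions at which all `k` shifted strings agree. -/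
def offsetScore {α : Type*} [DecidableEq α] {k N : ℕ} (X : Fin k → Fin N → α)
    (Δ : Fin (k - 1) → Fin N) : ℕ :=
  (Finset.univ.filter fun i : Fin N =>
    ∀ a b : Fin k, shifted (X a) (shiftOf Δ a) i = shifted (X b) (shiftOf Δ b) i).card

/-- The value `k-SD(X₁, …, X_k)`: the maximum of the offset scores over all choices of offsets. -/
def kSD {α : Type*} [DecidableEq α] {k N : ℕ} (X : Fin k → Fin N → α) : ℕ :=
  Finset.univ.sup (offsetScore X)

/-- The `k-SD` distance, the total number of unmatched characters in a best alignment. -/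
def kSDDistance {α : Type*} [DecidableEq α] {k N : ℕ} (X : Fin k → Fin N → α) : ℕ :=
  k * (N - kSD X)

/-- The initial state on input `X`, a family of `k` strings of length `N` over the alphabet
`{0, …, σ - 1}`: registers `0` and `1` hold `N` and `σ`, the memory cell `j * N + i` holds
the `i`-th character of the `j`-th string, everything else is `0`. -/
def input (w : ℕ) {k N σ : ℕ} (X : Fin k → Fin N → Fin σ) : WordRAM.State w where
  pc := 0
  reg r := if r = 0 then BitVec.ofNat w N else if r = 1 then BitVec.ofNat w σ else 0
  mem a :=
    if h : a.toNat / N < k ∧ 0 < N then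
      BitVec.ofNat w (X ⟨a.toNat / N, h.1⟩ ⟨a.toNat % N, Nat.mod_lt _ h.2⟩).val
    else 0

/-- The binary logarithm of `σ * N`, replaced by `1` in the degenerate case `σ * N = 1`. -/
noncomputable def lg (σ N : ℕ) : ℝ := Real.logb 2 (max 2 ((σ : ℝ) * N))

/-- There is an algorithm which on every family `X` of `k` strings of a common length `N ≥ 1` over
an alphabet of size `σ` produces an output `out` (the final contents of the registers) with
`Good N σ X out`, and which runs in time `O(T N σ)` on a word RAM with words of
`Ω(log (σ N))` bits. -/
def SolvableInTime (k : ℕ)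
    (Good : (N σ : ℕ) → (Fin k → Fin N → Fin σ) → (ℕ → ℕ) → Prop) (T : ℕ → ℕ → ℝ) : Prop :=
  ∃ (p : WordRAM.Program) (C c : ℝ), ∀ N σ w : ℕ, 1 ≤ N → c * lg σ N ≤ (w : ℝ) →
    ∀ X : Fin k → Fin N → Fin σ, ∃ t : ℕ, (t : ℝ) ≤ C * T N σ ∧
      WordRAM.Halted p (WordRAM.run p t (input w X)) ∧
      Good N σ X fun r => ((WordRAM.run p t (input w X)).reg r).toNat

/-- A correct output for `k`-Shift Distance: the optimal value in register `0`, and an optimal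
alignment, the offsets of the first `k - 1` strings, in the registers `1, …, k - 1`. -/
def IsSolution (k N σ : ℕ) (X : Fin k → Fin N → Fin σ) (out : ℕ → ℕ) : Prop :=
  out 0 = kSD X ∧
    ∃ Δ : Fin (k - 1) → Fin N, offsetScore X Δ = kSD X ∧ ∀ j, out (j.val + 1) = (Δ j).val

/-- Register `0` holds an `ℓ`-approximation of the `k-SD` distance. -/
def IsApproximation (ℓ k N σ : ℕ) (X : Fin k → Fin N → Fin σ) (out : ℕ → ℕ) : Prop :=
  kSDDistance X ≤ out 0 ∧ out 0 ≤ ℓ * kSDDistance X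

end ShiftDistance

/-! Exact algorithm. Fix the offsets of all strings but one, and let `Y` be the string of characters
on which the last string and the shifted strings with fixed offsets agree, with a symbol outside the
alphabet where they disagree. For the remaining string `X`, the scores of all its `N` offsets are
the numbers of `i` with `Y i = X (i + d)`. Code the character `c` at position `i` by the integer `i
+ 2 * N * c`, and write `X` twice into each block of length `2 * N`. Then a shift by `d < N` never
leaves a block, and all `N` scores are entries of one correlation of 0-1 sequences of length `n = 2
^ m`, of the order of `N * σ`. One fast convolution costs `O(n * m)`, and there are `N ^ (k - 2)`
choices of the fixed offsets.

Approximation. Split the first `k - 1` strings into `ℓ` groups of size at most `g = ⌈(k - 1) / ℓ⌉`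
and solve each group exactly against the last string. A group matches at least as well as the whole
family, so each of the `ℓ` numbers of mismatches is at most `N - kSD`. Conversely all groups are
aligned to the same unshifted last string, so their best offsets combine to offsets of the whole
family. The mismatches of that alignment lie in the union of the mismatches of the groups. Hence the
sum of the group mismatches lies between `N - kSD` and `ℓ * (N - kSD)`.

Convolution on a word RAM. The transform is complex, in fixed point arithmetic with scale `S = n ^
20`; words of `c * lg σ N` bits hold `n ^ 50` for a suitable `c`. The root of unity comes from
nested square roots, its powers from repeated multiplication (`norm_toC_powFix_sub_le_inv`). For 0-1
sequences `a` and `b`, the transform of `a + i b` is squared and transformed again; the imaginary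
part is `2 * n` times the correlation (`dft_sq_dft_im`). The accumulated error stays below `1`
(`level_bounds`), so rounding is exact (`level₂_last`), and `sum_indicator_eq_card` reads it as a
number of matches.

Running time. The programs are written in a small structured language whose variables hold integers.
`Exec.run_code` shows that compiled code simulates it with the same number of steps, provided that
comparisons, divisions and addresses only see numbers in `[0, 2 ^ w)`. Total correctness with time
bounds is then proved in a Hoare calculus (`Spec`), and `solvableInTime_of_spec` carries the result
to the machine. -/

namespace WordRAM

/-! ### A structured language, its compiler, and a Hoare calculus with time bounds. -/

/-- `z` is the value of a word of `w` bits. -/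
def InWord (w : ℕ) (z : ℤ) : Prop := 0 ≤ z ∧ z < 2 ^ w

/-- A state of the machine without program counter, in which registers and memory cells hold
integers, to be read modulo `2 ^ w`. -/
structure Core where
  reg : ℕ → ℤ
  mem : ℤ → ℤ

namespace Core

def set (s : Core) (d : ℕ) (v : ℤ) : Core := { s with reg := Function.update s.reg d v }

def write (s : Core) (a v : ℤ) : Core := { s with mem := Function.update s.mem a v }

@[simp] theorem set_reg (s : Core) (d : ℕ) (v : ℤ) (r : ℕ) :
    (s.set d v).reg r = if r = d then v else s.reg r := by
  simp [set, Function.update_apply]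

@[simp] theorem set_mem (s : Core) (d : ℕ) (v : ℤ) : (s.set d v).mem = s.mem := rfl

@[simp] theorem write_reg (s : Core) (a v : ℤ) : (s.write a v).reg = s.reg := rfl

theorem write_mem (s : Core) (a v b : ℤ) :
    (s.write a v).mem b = if b = a then v else s.mem b := by
  simp [write, Function.update_apply]

end Core

/-- The integer counterpart of a binary operation, for the operations used by `Expr`. -/
def BinOp.zeval : BinOp → ℤ → ℤ → ℤ
  | .add, x, y => x + y
  | .sub, x, y => x - y
  | .mul, x, y => x * y
  | .div, x, y => x / y
  | .mod, x, y => x % y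
  | _, _, _ => 0

/-- A condition under which the integer operation is computed by the word operation. -/
def BinOp.Safe (w : ℕ) : BinOp → ℤ → ℤ → Prop
  | .add, _, _ => True
  | .sub, _, _ => True
  | .mul, _, _ => True
  | .div, x, y => InWord w x ∧ InWord w y
  | .mod, x, y => InWord w x ∧ InWord w y
  | _, _, _ => False

/-- Expressions over variables and memory. -/
inductive Expr
  | lit (n : ℕ)
  | var (r : ℕ)
  | bin (op : BinOp) (a b : Expr)
  | load (a : Expr)

namespace Expr

instance : Add Expr := ⟨.bin .add⟩
instance : Sub Expr := ⟨.bin .sub⟩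
instance : Mul Expr := ⟨.bin .mul⟩
instance : Div Expr := ⟨.bin .div⟩
instance : Mod Expr := ⟨.bin .mod⟩
instance (n : ℕ) : OfNat Expr n := ⟨.lit n⟩

def eval (s : Core) : Expr → ℤ
  | lit n => n
  | var r => s.reg r
  | bin op a b => op.zeval (a.eval s) (b.eval s)
  | load a => s.mem (a.eval s)

def Safe (w : ℕ) (s : Core) : Expr → Prop
  | lit _ => True
  | var _ => True
  | bin op a b => a.Safe w s ∧ b.Safe w s ∧ op.Safe w (a.eval s) (b.eval s)
  | load a => a.Safe w s ∧ InWord w (a.eval s)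

/-- A bound on the variables of an expression. -/
def bound : Expr → ℕ
  | lit _ => 0
  | var r => r + 1
  | bin _ a b => max a.bound b.bound
  | load a => a.bound

/-- The instructions which compute an expression in register `T`, using registers from `T` on. -/
def code : Expr → ℕ → List Instr
  | lit n, T => [.const T n]
  -- The machine has no move instruction; `or` of a register with itself copies it.
  | var r, T => [.bin .or T r r]
  | bin op a b, T => a.code T ++ (b.code (T + 1) ++ [.bin op T T (T + 1)])
  | load a, T => a.code T ++ [.load T T]

/-- The number of instructions of the code of an expression. -/
def size : Expr → ℕ
  | lit _ => 1
  | var _ => 1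
  | bin _ a b => a.size + (b.size + 1)
  | load a => a.size + 1

@[simp] theorem length_code (e : Expr) (T : ℕ) : (e.code T).length = e.size := by
  induction e generalizing T <;> simp_all [code, size]

section
variable (s : Core) (w : ℕ) (a b : Expr) (n : ℕ)
@[simp] theorem eval_add : (a + b).eval s = a.eval s + b.eval s := rfl
@[simp] theorem eval_sub : (a - b).eval s = a.eval s - b.eval s := rfl
@[simp] theorem eval_mul : (a * b).eval s = a.eval s * b.eval s := rfl
@[simp] theorem eval_div : (a / b).eval s = a.eval s / b.eval s := rfl
@[simp] theorem eval_mod : (a % b).eval s = a.eval s % b.eval s := rfl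
@[simp] theorem eval_lit : (lit n).eval s = n := rfl
@[simp] theorem eval_zero : (0 : Expr).eval s = 0 := rfl
@[simp] theorem eval_one : (1 : Expr).eval s = 1 := rfl
@[simp] theorem eval_two : (2 : Expr).eval s = 2 := rfl
@[simp] theorem eval_four : (4 : Expr).eval s = 4 := rfl
@[simp] theorem eval_sixteen : (16 : Expr).eval s = 16 := rfl
@[simp] theorem eval_var : (var n).eval s = s.reg n := rfl
@[simp] theorem eval_load : (load a).eval s = s.mem (a.eval s) := rfl
@[simp] theorem safe_add : (a + b).Safe w s ↔ a.Safe w s ∧ b.Safe w s := by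
  change _ ∧ _ ∧ True ↔ _; tauto
@[simp] theorem safe_sub : (a - b).Safe w s ↔ a.Safe w s ∧ b.Safe w s := by
  change _ ∧ _ ∧ True ↔ _; tauto
@[simp] theorem safe_mul : (a * b).Safe w s ↔ a.Safe w s ∧ b.Safe w s := by
  change _ ∧ _ ∧ True ↔ _; tauto
@[simp] theorem safe_div : (a / b).Safe w s ↔
    a.Safe w s ∧ b.Safe w s ∧ InWord w (a.eval s) ∧ InWord w (b.eval s) := Iff.rfl
@[simp] theorem safe_mod : (a % b).Safe w s ↔
    a.Safe w s ∧ b.Safe w s ∧ InWord w (a.eval s) ∧ InWord w (b.eval s) := Iff.rfl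
@[simp] theorem safe_lit : (lit n).Safe w s ↔ True := Iff.rfl
@[simp] theorem safe_zero : (0 : Expr).Safe w s ↔ True := Iff.rfl
@[simp] theorem safe_one : (1 : Expr).Safe w s ↔ True := Iff.rfl
@[simp] theorem safe_two : (2 : Expr).Safe w s ↔ True := Iff.rfl
@[simp] theorem safe_four : (4 : Expr).Safe w s ↔ True := Iff.rfl
@[simp] theorem safe_sixteen : (16 : Expr).Safe w s ↔ True := Iff.rfl
@[simp] theorem safe_var : (var n).Safe w s ↔ True := Iff.rfl
@[simp] theorem safe_load : (load a).Safe w s ↔ a.Safe w s ∧ InWord w (a.eval s) := Iff.rfl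
end

end Expr

/-- The comparisons that control branching. -/
inductive Test
  | lt | eq

def Test.instr : Test → ℕ → ℕ → ℕ → Instr
  | lt => .jumpLt
  | eq => .jumpEq

def Test.Holds : Test → ℤ → ℤ → Prop
  | lt, x, y => x < y
  | eq, x, y => x = y

@[simp] theorem Test.holds_lt (x y : ℤ) : Test.lt.Holds x y ↔ x < y := Iff.rfl
@[simp] theorem Test.holds_eq (x y : ℤ) : Test.eq.Holds x y ↔ x = y := Iff.rfl

/-- Structured programs. -/
inductive Cmd
  | skip
  | assign (d : ℕ) (e : Expr)
  | store (a v : Expr)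
  | seq (c d : Cmd)
  | ite (t : Test) (a b : Expr) (c d : Cmd)
  | while (t : Test) (a b : Expr) (c : Cmd)

namespace Cmd

/-- A bound on the variables of a program. -/
def bound : Cmd → ℕ
  | skip => 0
  | assign d e => max (d + 1) e.bound
  | store a v => max a.bound v.bound
  | seq c d => max c.bound d.bound
  | ite _ a b c d => max (max a.bound b.bound) (max c.bound d.bound)
  | .while _ a b c => max (max a.bound b.bound) c.bound

/-- The number of instructions of the code of a program. -/
def size : Cmd → ℕ
  | skip => 0
  | assign _ e => e.size + 1
  | store a v => a.size + (v.size + 1)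
  | seq c d => c.size + d.size
  | ite _ a b c d => a.size + (b.size + (1 + (d.size + (1 + c.size))))
  | .while _ a b c => a.size + (b.size + (1 + (1 + (c.size + 1))))

/-- Compilation. The code starts at position `off`, the variables are the registers below `R`. -/
def code (R : ℕ) : Cmd → ℕ → List Instr
  | skip, _ => []
  | assign d e, _ => e.code R ++ [.bin .or d R R]
  | store a v, _ => a.code R ++ (v.code (R + 1) ++ [.store R (R + 1)])
  | seq c d, off => c.code R off ++ d.code R (off + c.size)
  -- The code of `d` comes first and is reached when the test fails; a successful test jumps past it
  -- to `c`. Hence the failing branch pays one extra jump.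
  | ite t a b c d, off =>
      a.code R ++ (b.code (R + 1) ++
        ([t.instr R (R + 1) (off + a.size + b.size + 1 + d.size + 1)] ++
          (d.code R (off + a.size + b.size + 1) ++
            ([.jump (off + a.size + b.size + 1 + d.size + 1 + c.size)] ++
              c.code R (off + a.size + b.size + 1 + d.size + 1)))))
  | .while t a b c, off =>
      a.code R ++ (b.code (R + 1) ++
        ([t.instr R (R + 1) (off + a.size + b.size + 2)] ++
          ([.jump (off + a.size + b.size + 2 + c.size + 1)] ++
            (c.code R (off + a.size + b.size + 2) ++ [.jump off]))))

@[simp] theorem length_code (R : ℕ) (c : Cmd) (off : ℕ) : (c.code R off).length = c.size := by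
  induction c generalizing off <;> simp_all [code, size] <;> omega

end Cmd

/-- The admissible operands of a branch. -/
def TestSafe (w : ℕ) (s : Core) (a b : Expr) : Prop :=
  a.Safe w s ∧ b.Safe w s ∧ InWord w (a.eval s) ∧ InWord w (b.eval s)

/-- Running `c` from `s` ends in `s'` after `t` instructions. -/
inductive Exec (w : ℕ) : Cmd → Core → Core → ℕ → Prop
  | skip (s) : Exec w .skip s s 0
  | assign {s d e} (h : e.Safe w s) :
      Exec w (.assign d e) s (s.set d (e.eval s)) (e.size + 1)
  | store {s a v} (ha : a.Safe w s) (hv : v.Safe w s) (h : InWord w (a.eval s)) :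
      Exec w (.store a v) s (s.write (a.eval s) (v.eval s)) (a.size + (v.size + 1))
  | seq {c d s s' s'' t t'} (h : Exec w c s s' t) (h' : Exec w d s' s'' t') :
      Exec w (.seq c d) s s'' (t + t')
  | ite_pos {T a b c d s s' t} (h : TestSafe w s a b) (hT : T.Holds (a.eval s) (b.eval s))
      (hc : Exec w c s s' t) : Exec w (.ite T a b c d) s s' (a.size + (b.size + (1 + t)))
  | ite_neg {T a b c d s s' t} (h : TestSafe w s a b) (hT : ¬ T.Holds (a.eval s) (b.eval s))
      (hd : Exec w d s s' t) : Exec w (.ite T a b c d) s s' (a.size + (b.size + (1 + (t + 1))))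
  | while_neg {T a b c s} (h : TestSafe w s a b) (hT : ¬ T.Holds (a.eval s) (b.eval s)) :
      Exec w (.while T a b c) s s (a.size + (b.size + (1 + 1)))
  | while_pos {T a b c s s' s'' t t'} (h : TestSafe w s a b) (hT : T.Holds (a.eval s) (b.eval s))
      (hc : Exec w c s s' t) (h' : Exec w (.while T a b c) s' s'' t') :
      Exec w (.while T a b c) s s'' (a.size + (b.size + (1 + (t + (1 + t')))))

/-- The words of the machine state represent the integers of `s`, as far as the registers below
`R` and the memory are concerned. -/
structure Rep (R w : ℕ) (s : Core) (st : State w) : Prop where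
  reg : ∀ r < R, st.reg r = BitVec.ofInt w (s.reg r)
  mem : ∀ a, InWord w a → st.mem (BitVec.ofInt w a) = BitVec.ofInt w (s.mem a)

theorem InWord.toNat_ofInt {w : ℕ} {z : ℤ} (h : InWord w z) :
    (BitVec.ofInt w z).toNat = z.toNat := by
  have h2 : ((2 ^ w : ℕ) : ℤ) = 2 ^ w := by push_cast; rfl
  rw [BitVec.toNat_ofInt, h2, Int.emod_eq_of_lt h.1 h.2]

theorem InWord.ofInt_inj {w : ℕ} {x y : ℤ} (hx : InWord w x) (hy : InWord w y) :
    BitVec.ofInt w x = BitVec.ofInt w y ↔ x = y := by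
  refine ⟨fun h => ?_, fun h => by rw [h]⟩
  have := congrArg BitVec.toNat h
  rw [hx.toNat_ofInt, hy.toNat_ofInt] at this
  have h1 := hx.1
  have h2 := hy.1
  omega

/-- Reduction modulo `2 ^ w` is a ring homomorphism, so sums, differences and products need no
bound, and intermediate values may be negative or too large. Quotients and remainders depend on the
representative, so there both operands must be words. A zero divisor is harmless: both sides use the
same convention. -/
theorem BinOp.eval_ofInt {w : ℕ} (op : BinOp) (x y : ℤ) (h : op.Safe w x y) :
    op.eval (BitVec.ofInt w x) (BitVec.ofInt w y) = BitVec.ofInt w (op.zeval x y) := by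
  cases op with
  | add => exact (BitVec.ofInt_add x y).symm
  | sub =>
    change BitVec.ofInt w x - BitVec.ofInt w y = BitVec.ofInt w (x - y)
    have : BitVec.ofInt w (x - y + y) = BitVec.ofInt w (x - y) + BitVec.ofInt w y :=
      BitVec.ofInt_add _ _
    rw [sub_add_cancel] at this
    rw [this, BitVec.add_sub_cancel]
  | mul => exact (BitVec.ofInt_mul x y).symm
  | div =>
    obtain ⟨hx, hy⟩ := h
    obtain ⟨a, rfl⟩ := Int.eq_ofNat_of_zero_le hx.1
    obtain ⟨b, rfl⟩ := Int.eq_ofNat_of_zero_le hy.1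
    have hab : InWord w ((a : ℤ) / b) := by
      refine ⟨Int.ediv_nonneg hx.1 hy.1, lt_of_le_of_lt ?_ hx.2⟩
      exact Int.ediv_le_self _ hx.1
    apply BitVec.eq_of_toNat_eq
    change (BitVec.ofInt w a / BitVec.ofInt w b).toNat = (BitVec.ofInt w ((a : ℤ) / b)).toNat
    rw [BitVec.toNat_udiv, hx.toNat_ofInt, hy.toNat_ofInt, hab.toNat_ofInt]
    rw [← Int.natCast_div, Int.toNat_natCast, Int.toNat_natCast, Int.toNat_natCast]
  | mod =>
    obtain ⟨hx, hy⟩ := h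
    obtain ⟨a, rfl⟩ := Int.eq_ofNat_of_zero_le hx.1
    obtain ⟨b, rfl⟩ := Int.eq_ofNat_of_zero_le hy.1
    have hab : InWord w ((a : ℤ) % b) := by
      have h1 : ((a : ℤ) % b) = ((a % b : ℕ) : ℤ) := by push_cast; rfl
      rw [h1]
      refine ⟨by positivity, lt_of_le_of_lt ?_ hx.2⟩
      exact_mod_cast Nat.mod_le a b
    apply BitVec.eq_of_toNat_eq
    change (BitVec.ofInt w a % BitVec.ofInt w b).toNat = (BitVec.ofInt w ((a : ℤ) % b)).toNat
    rw [BitVec.toNat_umod, hx.toNat_ofInt, hy.toNat_ofInt, hab.toNat_ofInt]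
    rw [← Int.natCast_mod, Int.toNat_natCast, Int.toNat_natCast, Int.toNat_natCast]
  | and => exact h.elim
  | or => exact h.elim
  | xor => exact h.elim
  | shl => exact h.elim
  | shr => exact h.elim

/-- The program `p` contains the instructions `l` from position `off` on. -/
def CodeAt (p : Program) (off : ℕ) (l : List Instr) : Prop :=
  ∀ i < l.length, p[off + i]? = l[i]?

theorem CodeAt.append {p : Program} {off : ℕ} {l l' : List Instr} :
    CodeAt p off (l ++ l') ↔ CodeAt p off l ∧ CodeAt p (off + l.length) l' := by
  constructor
  · intro h
    refine ⟨fun i hi => ?_, fun i hi => ?_⟩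
    · rw [h i (by simp; omega), List.getElem?_append_left hi]
    · rw [add_assoc, h (l.length + i) (by simp; omega), List.getElem?_append_right (by omega)]
      simp
  · rintro ⟨h, h'⟩ i hi
    rcases lt_or_ge i l.length with hl | hl
    · rw [h i hl, List.getElem?_append_left hl]
    · rw [List.getElem?_append_right hl, ← h' (i - l.length) (by simp at hi; omega)]
      congr 1; omega

theorem CodeAt.cons {p : Program} {off : ℕ} {i : Instr} (h : CodeAt p off [i]) :
    p[off]? = some i := by
  simpa using h 0 (by simp)

theorem run_add (p : Program) (t t' : ℕ) {w : ℕ} (s : State w) :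
    run p (t + t') s = run p t' (run p t s) := by
  rw [run, run, run, add_comm, Function.iterate_add_apply]

theorem run_one {p : Program} {w : ℕ} {s : State w} {i : Instr} (h : CodeAt p s.pc [i]) :
    run p 1 s = i.exec s := by
  simp [run, step, h.cons]

/-- Evaluation into `T` leaves everything below `T` alone. So the value of a left operand in `T`
survives the evaluation of the right operand into `T + 1`, and the variables, which lie below `R ≤
T`, are never disturbed. -/
theorem Expr.run_code {p : Program} {w R : ℕ} {s : Core} (e : Expr) (he : e.Safe w s)
    (hR : e.bound ≤ R) {T : ℕ} (hT : R ≤ T) {st : State w} (hst : Rep R w s st)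
    (hp : CodeAt p st.pc (e.code T)) :
    (run p e.size st).pc = st.pc + e.size ∧
      (run p e.size st).reg T = BitVec.ofInt w (e.eval s) ∧
      (∀ r < T, (run p e.size st).reg r = st.reg r) ∧ (run p e.size st).mem = st.mem := by
  induction e generalizing T st with
  | lit n =>
    rw [size, run_one hp]
    refine ⟨rfl, by simp [Instr.exec, State.setReg, Expr.eval], fun r hr => ?_, rfl⟩
    simp [Instr.exec, State.setReg, hr.ne]
  | var n =>
    rw [size, run_one hp]
    refine ⟨rfl, ?_, fun r hr => ?_, rfl⟩
    · simp [Instr.exec, State.setReg, Expr.eval, BinOp.eval, hst.reg n hR]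
    · simp [Instr.exec, State.setReg, hr.ne]
  | bin op a b iha ihb =>
    obtain ⟨ha, hb, hop⟩ := he
    simp only [bound, max_le_iff] at hR
    rw [code, CodeAt.append, CodeAt.append, length_code, length_code] at hp
    obtain ⟨h1, h2, h3⟩ := hp
    obtain ⟨p1, r1, f1, m1⟩ := iha ha hR.1 hT hst h1
    set st1 := run p a.size st with hst1
    have hst1' : Rep R w s st1 :=
      ⟨fun r hr => by rw [f1 r (by omega), hst.reg r hr], by rw [m1]; exact hst.mem⟩
    rw [← p1] at h2 h3
    obtain ⟨p2, r2, f2, m2⟩ := ihb hb hR.2 (T := T + 1) (by omega) hst1' h2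
    set st2 := run p b.size st1 with hst2
    rw [← p2] at h3
    rw [size, run_add, run_add, ← hst1, ← hst2, run_one h3]
    refine ⟨?_, ?_, fun r hr => ?_, ?_⟩
    · simp [Instr.exec, State.setReg, p2, p1]; omega
    · simp [Instr.exec, State.setReg, f2 T (by omega), r1, r2, Expr.eval, BinOp.eval_ofInt _ _ _ hop]
    · simp [Instr.exec, State.setReg, hr.ne, f2 r (by omega), f1 r hr]
    · simp [Instr.exec, State.setReg, m2, m1]
  | load a iha =>
    obtain ⟨ha, hw⟩ := he
    rw [code, CodeAt.append, length_code] at hp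
    obtain ⟨h1, h3⟩ := hp
    obtain ⟨p1, r1, f1, m1⟩ := iha ha hR hT hst h1
    set st1 := run p a.size st with hst1
    rw [← p1] at h3
    rw [size, run_add, ← hst1, run_one h3]
    refine ⟨?_, ?_, fun r hr => ?_, ?_⟩
    · simp [Instr.exec, State.setReg, p1]; omega
    · simp [Instr.exec, State.setReg, r1, m1, Expr.eval, hst.mem _ hw]
    · simp [Instr.exec, State.setReg, hr.ne, f1 r hr]
    · simp [Instr.exec, State.setReg, m1]

theorem Test.exec_instr {w : ℕ} (T : Test) {st : State w} {a b tgt : ℕ} {x y : ℤ}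
    (hx : InWord w x) (hy : InWord w y) (ha : st.reg a = BitVec.ofInt w x)
    (hb : st.reg b = BitVec.ofInt w y) :
    (T.Holds x y → (T.instr a b tgt).exec st = { st with pc := tgt }) ∧
      (¬ T.Holds x y → (T.instr a b tgt).exec st = { st with pc := st.pc + 1 }) := by
  have h1 := hx.1
  have h2 := hy.1
  cases T with
  | lt =>
    simp only [instr, Instr.exec, ha, hb, hx.toNat_ofInt, hy.toNat_ofInt, holds_lt]
    refine ⟨fun h => ?_, fun h => ?_⟩
    · rw [if_pos (by omega)]
    · rw [if_neg (by omega)]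
  | eq =>
    simp only [instr, Instr.exec, ha, hb, hx.ofInt_inj hy, holds_eq]
    refine ⟨fun h => ?_, fun h => ?_⟩
    · rw [if_pos h]
    · rw [if_neg h]

/-- The state after the two operands of a comparison or a store have been computed. -/
theorem run_operands {p : Program} {w R : ℕ} {s : Core} {a b : Expr} (ha : a.Safe w s)
    (hb : b.Safe w s) (hRa : a.bound ≤ R) (hRb : b.bound ≤ R) {st : State w} (hst : Rep R w s st)
    (h1 : CodeAt p st.pc (a.code R)) (h2 : CodeAt p (st.pc + a.size) (b.code (R + 1))) :
    ∃ st', run p (a.size + b.size) st = st' ∧ st'.pc = st.pc + a.size + b.size ∧ Rep R w s st' ∧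
      st'.reg R = BitVec.ofInt w (a.eval s) ∧ st'.reg (R + 1) = BitVec.ofInt w (b.eval s) := by
  obtain ⟨p1, r1, f1, m1⟩ := a.run_code ha hRa le_rfl hst h1
  set st1 := run p a.size st with hst1
  have hst1' : Rep R w s st1 :=
    ⟨fun r hr => by rw [f1 r (by omega), hst.reg r hr], by rw [m1]; exact hst.mem⟩
  rw [← p1] at h2
  obtain ⟨p2, r2, f2, m2⟩ := b.run_code hb hRb (T := R + 1) (by omega) hst1' h2
  refine ⟨_, rfl, ?_, ?_, ?_, ?_⟩
  · rw [run_add, ← hst1, p2, p1]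
  · rw [run_add, ← hst1]
    exact ⟨fun r hr => by rw [f2 r (by omega), hst1'.reg r hr], by rw [m2]; exact hst1'.mem⟩
  · rw [run_add, ← hst1, f2 R (by omega), r1]
  · rw [run_add, ← hst1, r2]

theorem Rep.with_pc {R w : ℕ} {s : Core} {st : State w} (h : Rep R w s st) (n : ℕ) :
    Rep R w s { st with pc := n } := ⟨h.reg, h.mem⟩

/-- Correctness of the compiler, with equality of running times. The induction is on the execution
rather than on the program, so a loop is unrolled once and its remainder is covered by the induction
hypothesis at the same code position. -/
theorem Exec.run_code {p : Program} {w R : ℕ} {c : Cmd} {s s' : Core} {t : ℕ}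
    (h : Exec w c s s' t) (hR : c.bound ≤ R) {off : ℕ} {st : State w} (hoff : st.pc = off)
    (hst : Rep R w s st) (hp : CodeAt p off (c.code R off)) :
    Rep R w s' (run p t st) ∧ (run p t st).pc = off + c.size := by
  induction h generalizing off st with
  | skip s => exact ⟨hst, hoff⟩
  | @assign s d e h =>
    simp only [Cmd.bound, max_le_iff] at hR
    rw [Cmd.code, CodeAt.append, Expr.length_code] at hp
    subst hoff
    obtain ⟨p1, r1, f1, m1⟩ := e.run_code h hR.2 le_rfl hst hp.1
    have h3 := hp.2
    rw [← p1] at h3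
    rw [run_add, run_one h3]
    refine ⟨⟨fun r hr => ?_, ?_⟩, ?_⟩
    · by_cases hrd : r = d
      · simp [Instr.exec, State.setReg, hrd, BinOp.eval, r1]
      · simp [Instr.exec, State.setReg, hrd, f1 r hr, hst.reg r hr]
    · simpa [Instr.exec, State.setReg, m1] using hst.mem
    · simp [Instr.exec, State.setReg, p1, Cmd.size]; omega
  | @store s a v ha hv h =>
    simp only [Cmd.bound, max_le_iff] at hR
    simp only [Cmd.code, CodeAt.append, Expr.length_code] at hp
    subst hoff
    obtain ⟨st1, hst1, p1, hr, r1, r2⟩ := run_operands ha hv hR.1 hR.2 hst hp.1 hp.2.1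
    have h3 := hp.2.2
    rw [← p1] at h3
    rw [← add_assoc, run_add, hst1, run_one h3]
    refine ⟨⟨fun r hr' => hr.reg r hr', fun b hb => ?_⟩, ?_⟩
    · simp only [Instr.exec, r1, r2, Function.update_apply, hb.ofInt_inj h, Core.write_mem]
      split_ifs
      · rfl
      · exact hr.mem b hb
    · simp [Instr.exec, p1, Cmd.size]; omega
  | @seq c d s s' s'' t t' h h' ih ih' =>
    simp only [Cmd.bound, max_le_iff] at hR
    simp only [Cmd.code, CodeAt.append, Cmd.length_code] at hp
    obtain ⟨r1, p1⟩ := ih hR.1 hoff hst hp.1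
    obtain ⟨r2, p2⟩ := ih' hR.2 p1 r1 hp.2
    rw [run_add]
    exact ⟨r2, by rw [p2, Cmd.size]; omega⟩
  | @ite_pos T a b c d s s' t h hT hc ih =>
    simp only [Cmd.bound, max_le_iff] at hR
    simp only [Cmd.code, CodeAt.append, Expr.length_code, Cmd.length_code,
      List.length_singleton] at hp
    subst hoff
    obtain ⟨st1, hst1, p1, hr, r1, r2⟩ :=
      run_operands h.1 h.2.1 hR.1.1 hR.1.2 hst hp.1 hp.2.1
    obtain ⟨-, -, h3, h4, h5, h6⟩ := hp
    rw [← add_assoc, run_add, hst1, run_add, run_one (i := T.instr R (R + 1) _) (by rw [p1]; exact h3),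
      (T.exec_instr h.2.2.1 h.2.2.2 r1 r2).1 hT]
    obtain ⟨r3, p3⟩ := ih hR.2.1 rfl (hr.with_pc _) h6
    refine ⟨r3, ?_⟩
    rw [p3, Cmd.size]
    change st.pc + a.size + b.size + 1 + d.size + 1 + c.size = _
    omega
  | @ite_neg T a b c d s s' t h hT hc ih =>
    simp only [Cmd.bound, max_le_iff] at hR
    simp only [Cmd.code, CodeAt.append, Expr.length_code, Cmd.length_code,
      List.length_singleton] at hp
    subst hoff
    obtain ⟨st1, hst1, p1, hr, r1, r2⟩ :=
      run_operands h.1 h.2.1 hR.1.1 hR.1.2 hst hp.1 hp.2.1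
    obtain ⟨-, -, h3, h4, h5, h6⟩ := hp
    rw [← add_assoc, run_add, hst1, run_add, run_one (i := T.instr R (R + 1) _) (by rw [p1]; exact h3),
      (T.exec_instr h.2.2.1 h.2.2.2 r1 r2).2 hT]
    obtain ⟨r3, p3⟩ := ih (off := st.pc + a.size + b.size + 1) hR.2.2 (st := { st1 with pc := st1.pc + 1 })
      (by simp [p1]) (hr.with_pc _) h4
    rw [← p3] at h5
    rw [run_add, run_one h5]
    exact ⟨r3.with_pc _, by simp [Instr.exec, Cmd.size]; omega⟩
  | @while_neg T a b c s h hT =>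
    simp only [Cmd.bound, max_le_iff] at hR
    simp only [Cmd.code, CodeAt.append, Expr.length_code, Cmd.length_code,
      List.length_singleton] at hp
    subst hoff
    obtain ⟨st1, hst1, p1, hr, r1, r2⟩ :=
      run_operands h.1 h.2.1 hR.1.1 hR.1.2 hst hp.1 hp.2.1
    obtain ⟨-, -, h3, h4, h5, h6⟩ := hp
    rw [← p1] at h3 h4
    rw [← add_assoc, run_add, hst1, run_add, run_one h3,
      (T.exec_instr h.2.2.1 h.2.2.2 r1 r2).2 hT, run_one h4]
    exact ⟨(hr.with_pc _).with_pc _, by simp [Instr.exec, Cmd.size]; omega⟩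
  | @while_pos T a b c s s' s'' t t' h hT hc hw ih ih' =>
    have hR' := hR
    have hp' := hp
    simp only [Cmd.bound, max_le_iff] at hR
    simp only [Cmd.code, CodeAt.append, Expr.length_code, Cmd.length_code,
      List.length_singleton] at hp
    subst hoff
    obtain ⟨st1, hst1, p1, hr, r1, r2⟩ :=
      run_operands h.1 h.2.1 hR.1.1 hR.1.2 hst hp.1 hp.2.1
    obtain ⟨-, -, h3, h4, h5, h6⟩ := hp
    rw [← add_assoc, run_add, hst1, run_add, run_one (i := T.instr R (R + 1) _) (by rw [p1]; exact h3),
      (T.exec_instr h.2.2.1 h.2.2.2 r1 r2).1 hT, run_add]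
    obtain ⟨r3, p3⟩ := ih (off := st.pc + a.size + b.size + 2) hR.2 rfl (hr.with_pc _) h5
    have h6' : CodeAt p (run p t { st1 with pc := st.pc + a.size + b.size + 2 }).pc
        [Instr.jump st.pc] := by
      rw [p3]; convert h6 using 1
    rw [run_add, run_one h6']
    exact ih' hR' rfl (r3.with_pc _) hp'

/-- Total correctness with a time bound: from `s`, the program `c` ends within time `T` in a state
with `P`. -/
def Spec (w : ℕ) (c : Cmd) (s : Core) (T : ℕ) (P : Core → Prop) : Prop :=
  ∃ s' t, Exec w c s s' t ∧ t ≤ T ∧ P s'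

namespace Spec
variable {w : ℕ} {c d : Cmd} {s : Core} {T T' : ℕ} {P Q : Core → Prop}

theorem mono (h : Spec w c s T P) (hT : T ≤ T') (hP : ∀ s', P s' → Q s') : Spec w c s T' Q := by
  obtain ⟨s', t, h1, h2, h3⟩ := h
  exact ⟨s', t, h1, h2.trans hT, hP _ h3⟩

theorem skip (h : P s) : Spec w .skip s 0 P := ⟨s, 0, .skip s, le_rfl, h⟩

theorem assign {r : ℕ} {e : Expr} (he : e.Safe w s) (h : P (s.set r (e.eval s))) :
    Spec w (.assign r e) s (Cmd.assign r e).size P :=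
  ⟨_, _, .assign he, le_rfl, h⟩

theorem store {a v : Expr} (ha : a.Safe w s) (hv : v.Safe w s) (hw : InWord w (a.eval s))
    (h : P (s.write (a.eval s) (v.eval s))) :
    Spec w (.store a v) s (Cmd.store a v).size P :=
  ⟨_, _, .store ha hv hw, le_rfl, h⟩

theorem seq (h : Spec w c s T Q) (h' : ∀ s', Q s' → Spec w d s' T' P) :
    Spec w (.seq c d) s (T + T') P := by
  obtain ⟨s', t, h1, h2, h3⟩ := h
  obtain ⟨s'', t', h1', h2', h3'⟩ := h' s' h3
  exact ⟨s'', t + t', .seq h1 h1', by omega, h3'⟩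

theorem seq_assign {r : ℕ} {e : Expr} (he : e.Safe w s)
    (h : Spec w d (s.set r (e.eval s)) T P) :
    Spec w (.seq (.assign r e) d) s ((Cmd.assign r e).size + T) P :=
  seq (Q := fun s' => s' = s.set r (e.eval s)) (assign he rfl) (by rintro _ rfl; exact h)

theorem seq_store {a v : Expr} (ha : a.Safe w s) (hv : v.Safe w s) (hw : InWord w (a.eval s))
    (h : Spec w d (s.write (a.eval s) (v.eval s)) T P) :
    Spec w (.seq (.store a v) d) s ((Cmd.store a v).size + T) P :=
  seq (Q := fun s' => s' = s.write (a.eval s) (v.eval s)) (store ha hv hw rfl)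
    (by rintro _ rfl; exact h)

theorem ite {t : Test} {a b : Expr} (hs : TestSafe w s a b)
    (hc : t.Holds (a.eval s) (b.eval s) → Spec w c s T P)
    (hd : ¬ t.Holds (a.eval s) (b.eval s) → Spec w d s T' P) :
    Spec w (.ite t a b c d) s (a.size + (b.size + (1 + (T' + (1 + T))))) P := by
  by_cases ht : t.Holds (a.eval s) (b.eval s)
  · obtain ⟨s', t, h1, h2, h3⟩ := hc ht
    exact ⟨s', _, .ite_pos hs ht h1, by omega, h3⟩
  · obtain ⟨s', t, h1, h2, h3⟩ := hd ht
    exact ⟨s', _, .ite_neg hs ht h1, by omega, h3⟩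

/-- A loop that runs exactly `M` times. -/
theorem while_count {t : Test} {a b : Expr} (Inv : ℕ → Core → Prop) (M : ℕ) (h0 : Inv 0 s)
    (hs : ∀ j ≤ M, ∀ s, Inv j s → TestSafe w s a b)
    (ht : ∀ j ≤ M, ∀ s, Inv j s → (t.Holds (a.eval s) (b.eval s) ↔ j < M))
    (hc : ∀ j < M, ∀ s, Inv j s → Spec w c s T (Inv (j + 1))) :
    Spec w (.while t a b c) s ((M + 1) * (a.size + b.size + T + 2)) (Inv M) := by
  -- Induction on the number `k` of remaining iterations. The summand `1` in `k + 1` pays for the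
  -- final failing test.
  suffices h : ∀ k j s, j + k = M → Inv j s →
      Spec w (.while t a b c) s ((k + 1) * (a.size + b.size + T + 2)) (Inv M) from
    h M 0 s (by omega) h0
  intro k
  induction k with
  | zero =>
    rintro j s rfl hj
    refine ⟨s, _, .while_neg (hs _ le_rfl _ hj) ?_, ?_, hj⟩
    · rw [ht _ le_rfl _ hj]; omega
    · omega
  | succ k ih =>
    rintro j s rfl hj
    obtain ⟨s', t', h1, h2, h3⟩ := hc j (by omega) s hj
    obtain ⟨s'', t'', h1', h2', h3'⟩ := ih (j + 1) s' (by omega) h3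
    refine ⟨s'', _, .while_pos (hs _ (by omega) _ hj) ?_ h1 h1', ?_, h3'⟩
    · rw [ht _ (by omega) _ hj]; omega
    · rw [add_mul (k + 1) 1]; omega

end Spec

end WordRAM

/-! ### The fast Fourier transform and its error in fixed point arithmetic. -/

namespace FixedFFT

/-- One step of the Stockham Fourier transform of length `n`, with multiplication `mul` and powers
`W` of a root of unity. The step merges the transforms of the residue classes modulo `2 * h` into
those of the classes modulo `h`. -/
def fftStep {R : Type*} [Add R] (mul : R → R → R) (W : ℕ → R) (n h : ℕ) (A : ℕ → R) (p : ℕ) : R :=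
  A (2 * (p - p % h) % n + p % h) + mul (W (p - p % h)) (A (2 * (p - p % h) % n + p % h + h))

/-- The first `t` steps of the Stockham Fourier transform. -/
def fftLevel {R : Type*} [Add R] (mul : R → R → R) (W : ℕ → R) (n : ℕ) (A : ℕ → R) : ℕ → ℕ → R
  | 0 => A
  | t + 1 => fftStep mul W n (n / 2 ^ (t + 1)) (fftLevel mul W n A t)

theorem sum_range_two_mul {M : Type*} [AddCommMonoid M] (f : ℕ → M) (K : ℕ) :
    ∑ j ∈ Finset.range (2 * K), f j = ∑ j ∈ Finset.range K, (f (2 * j) + f (2 * j + 1)) := by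
  induction K with
  | zero => simp
  | succ K ih =>
    rw [mul_add, mul_one, Finset.sum_range_succ, Finset.sum_range_succ, Finset.sum_range_succ, ih,
      add_assoc]

/-- The positions read by a step. -/
theorem step_index {K h p : ℕ} (hh : 0 < h) (hK : 0 < K) :
    2 * (p - p % h) % (K * (2 * h)) + p % h + h < K * (2 * h) ∧
      (2 * (p - p % h) % (K * (2 * h)) + p % h) % (2 * h) = p % h ∧
      (2 * (p - p % h) % (K * (2 * h)) + p % h + h) % (2 * h) = p % h + h := by
  have h1 : p - p % h = h * (p / h) := by have := Nat.div_add_mod p h; omega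
  have h2 : 2 * (p - p % h) % (K * (2 * h)) = (2 * h) * (p / h % K) := by
    rw [h1, show 2 * (h * (p / h)) = (2 * h) * (p / h) by ring, mul_comm K, Nat.mul_mod_mul_left]
  have h3 : p % h < h := Nat.mod_lt _ hh
  have h4 : p / h % K + 1 ≤ K := Nat.mod_lt _ hK
  rw [h2]
  refine ⟨?_, ?_, ?_⟩
  · have := Nat.mul_le_mul_left (2 * h) h4
    rw [mul_comm K]
    nlinarith
  · rw [Nat.mul_add_mod, Nat.mod_eq_of_lt (by omega)]
  · rw [add_assoc, Nat.mul_add_mod, Nat.mod_eq_of_lt (by omega)]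

/-- With `h = 2 ^ (m - t)`, level `t` holds the transforms of length `2 ^ t` of the subsequences `j
↦ A (j * h + r)`, `r < h`. Position `p` belongs to `r = p % h` and frequency `p / h`; the root for
such a subsequence is `ω ^ h`, and `h * (p / h) = p - p % h`. A step splits the sum into even and
odd `j`, that is, into two classes modulo `2 * h`. -/
theorem fftLevel_eq {ω : ℂ} {m : ℕ} (hω : ω ^ 2 ^ m = 1) (A : ℕ → ℂ) {t : ℕ} (ht : t ≤ m) :
    ∀ p < 2 ^ m, fftLevel (· * ·) (fun k => ω ^ k) (2 ^ m) A t p =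
      ∑ j ∈ Finset.range (2 ^ t), A (j * 2 ^ (m - t) + p % 2 ^ (m - t)) *
        ω ^ ((p - p % 2 ^ (m - t)) * j) := by
  induction t with
  | zero =>
    intro p hp
    simp [fftLevel, Nat.mod_eq_of_lt hp]
  | succ t ih =>
    intro p hp
    have ih := ih (by omega)
    set h := 2 ^ (m - (t + 1)) with hh
    have h1 : 2 ^ (m - t) = 2 * h := by
      rw [hh, ← pow_succ', show m - (t + 1) + 1 = m - t by omega]
    have h2 : 2 ^ m = 2 ^ t * (2 * h) := by
      rw [← h1, ← pow_add, show t + (m - t) = m by omega]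
    have h3 : 2 ^ m / 2 ^ (t + 1) = h := by
      rw [hh, Nat.pow_div ht (by norm_num)]
    have hpos : 0 < h := by positivity
    obtain ⟨i1, i2, i3⟩ := step_index (p := p) hpos (show 0 < 2 ^ t by positivity)
    rw [← h2] at i1 i2 i3
    -- The position read is reduced modulo `2 ^ m`; this does not change the exponent of `ω`, which
    -- has order dividing `2 ^ m`.
    have hpw : ∀ q j, ω ^ ((2 * q % 2 ^ m) * j) = ω ^ (2 * q * j) := by
      intro q j
      conv_rhs => rw [← Nat.div_add_mod (2 * q) (2 ^ m)]
      rw [add_mul, pow_add, mul_assoc, pow_mul ω (2 ^ m), hω, one_pow, one_mul]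
    rw [fftLevel, fftStep, h3, ih _ (by omega), ih _ i1, h1, i2, i3, pow_succ',
      sum_range_two_mul, Finset.mul_sum, ← Finset.sum_add_distrib]
    refine Finset.sum_congr rfl fun j _ => ?_
    rw [Nat.add_sub_cancel,
      show 2 * (p - p % h) % 2 ^ m + p % h + h - (p % h + h) = 2 * (p - p % h) % 2 ^ m by omega,
      hpw]
    rw [show j * (2 * h) + p % h = 2 * j * h + p % h by ring,
      show j * (2 * h) + (p % h + h) = (2 * j + 1) * h + p % h by ring,
      show 2 * (p - p % h) * j = (p - p % h) * (2 * j) by ring,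
      show (p - p % h) * (2 * j + 1) = (p - p % h) * (2 * j) + (p - p % h) by ring, pow_add]
    ring

/-- The discrete Fourier transform of length `n` with respect to `ω`. -/
noncomputable def dft (ω : ℂ) (n : ℕ) (A : ℕ → ℂ) (p : ℕ) : ℂ :=
  ∑ j ∈ Finset.range n, A j * ω ^ (p * j)

theorem fftLevel_last {ω : ℂ} {m : ℕ} (hω : ω ^ 2 ^ m = 1) (A : ℕ → ℂ) {p : ℕ} (hp : p < 2 ^ m) :
    fftLevel (· * ·) (fun k => ω ^ k) (2 ^ m) A m p = dft ω (2 ^ m) A p := by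
  rw [fftLevel_eq hω A le_rfl p hp, dft]
  simp [Nat.mod_one]

/-- Every intermediate entry is a sum of at most `2 ^ m` inputs with unimodular coefficients. -/
theorem norm_fftLevel_le {ω : ℂ} {m : ℕ} (hω : ω ^ 2 ^ m = 1) (A : ℕ → ℂ) {M : ℝ}
    (hA : ∀ p < 2 ^ m, ‖A p‖ ≤ M) {t : ℕ} (ht : t ≤ m) {p : ℕ} (hp : p < 2 ^ m) :
    ‖fftLevel (· * ·) (fun k => ω ^ k) (2 ^ m) A t p‖ ≤ 2 ^ m * M := by
  have hn : ‖ω‖ = 1 := Complex.norm_eq_one_of_pow_eq_one hω (by positivity)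
  have hM : 0 ≤ M := (norm_nonneg _).trans (hA 0 (by positivity))
  rw [fftLevel_eq hω A ht p hp]
  refine (norm_sum_le _ _).trans ?_
  refine (Finset.sum_le_card_nsmul _ _ M fun j hj => ?_).trans ?_
  · rw [norm_mul, norm_pow, hn, one_pow, mul_one]
    apply hA
    have h1 : p % 2 ^ (m - t) < 2 ^ (m - t) := Nat.mod_lt _ (by positivity)
    have h2 : j + 1 ≤ 2 ^ t := Finset.mem_range.mp hj
    calc j * 2 ^ (m - t) + p % 2 ^ (m - t) < (j + 1) * 2 ^ (m - t) := by linarith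
      _ ≤ 2 ^ t * 2 ^ (m - t) := Nat.mul_le_mul_right _ h2
      _ = 2 ^ m := by rw [← pow_add, show t + (m - t) = m by omega]
  · rw [Finset.card_range, nsmul_eq_mul]
    push_cast
    gcongr
    · norm_num

/-- Orthogonality of characters. The same transform is used twice, not followed by its inverse, so
the index comes out reflected: the condition is `n ∣ j + l + d` instead of `j + l ≡ d`. -/
theorem dft_sq_dft {ω : ℂ} {n : ℕ} (hω : IsPrimitiveRoot ω n) (z : ℕ → ℂ) (d : ℕ) :
    dft ω n (fun b => dft ω n z b ^ 2) d =
      n * ∑ j ∈ Finset.range n, ∑ l ∈ Finset.range n,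
        if n ∣ j + l + d then z j * z l else 0 := by
  have key : ∀ e, ∑ b ∈ Finset.range n, ω ^ (e * b) = if n ∣ e then (n : ℂ) else 0 := by
    intro e
    have hpow : (ω ^ e) ^ n = 1 := by rw [← pow_mul, mul_comm, pow_mul, hω.pow_eq_one, one_pow]
    simp_rw [pow_mul]
    split_ifs with h
    · simp [(hω.pow_eq_one_iff_dvd e).mpr h]
    · have h1 : ω ^ e ≠ 1 := fun h1 => h ((hω.pow_eq_one_iff_dvd e).mp h1)
      have := mul_geom_sum (ω ^ e) n
      rw [hpow, sub_self] at this
      exact (mul_eq_zero.mp this).resolve_left (sub_ne_zero.mpr h1)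
  calc dft ω n (fun b => dft ω n z b ^ 2) d
      = ∑ b ∈ Finset.range n, ∑ j ∈ Finset.range n, ∑ l ∈ Finset.range n,
          z j * z l * ω ^ ((j + l + d) * b) := by
        refine Finset.sum_congr rfl fun b _ => ?_
        simp only [dft]
        rw [sq, Finset.sum_mul_sum, Finset.sum_mul]
        refine Finset.sum_congr rfl fun j _ => ?_
        rw [Finset.sum_mul]
        refine Finset.sum_congr rfl fun l _ => ?_
        rw [show (j + l + d) * b = b * j + b * l + d * b by ring, pow_add, pow_add]
        ring
    _ = ∑ j ∈ Finset.range n, ∑ l ∈ Finset.range n, ∑ b ∈ Finset.range n,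
          z j * z l * ω ^ ((j + l + d) * b) := by
        rw [Finset.sum_comm]
        refine Finset.sum_congr rfl fun j _ => ?_
        rw [Finset.sum_comm]
    _ = _ := by
        rw [Finset.mul_sum]
        refine Finset.sum_congr rfl fun j _ => ?_
        rw [Finset.mul_sum]
        refine Finset.sum_congr rfl fun l _ => ?_
        rw [← Finset.mul_sum, key]
        split_ifs <;> ring

theorem sum_dvd_add {M : Type*} [AddCommMonoid M] {n : ℕ} (hn : 0 < n) (b : ℕ → M) (e : ℕ) :
    (∑ l ∈ Finset.range n, if n ∣ e + l then b l else 0) = b ((n - e % n) % n) := by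
  have h1 : ∀ l ∈ Finset.range n, (if n ∣ e + l then b l else 0) =
      if l = (n - e % n) % n then b l else 0 := by
    intro l hl
    have hl := Finset.mem_range.mp hl
    have he : e % n < n := Nat.mod_lt _ hn
    congr 1
    rw [Nat.dvd_iff_mod_eq_zero, Nat.add_mod, Nat.mod_eq_of_lt hl, eq_iff_iff]
    rcases Nat.eq_zero_or_pos (e % n) with h0 | h0
    · rw [h0]; simp [Nat.mod_eq_of_lt hl]
    · rw [Nat.mod_eq_of_lt (show n - e % n < n by omega)]
      constructor
      · intro h
        have h2 : n ∣ e % n + l := Nat.dvd_of_mod_eq_zero h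
        obtain ⟨c, hc⟩ := h2
        have : c = 1 := by
          have h3 : c < 2 := by
            by_contra h4
            have := Nat.mul_le_mul_left n (show 2 ≤ c by omega)
            omega
          interval_cases c
          · omega
          · rfl
        subst this; omega
      · intro h
        rw [show e % n + l = n by omega, Nat.mod_self]
  rw [Finset.sum_congr rfl h1, Finset.sum_ite_eq', if_pos]
  exact Finset.mem_range.mpr (Nat.mod_lt _ hn)

/-- The imaginary part of the transform of the squared transform of `a + i b`, for real `a`
and `b`. -/
theorem dft_sq_dft_im {ω : ℂ} {n : ℕ} (hn : 0 < n) (hω : IsPrimitiveRoot ω n) (a b : ℕ → ℝ)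
    (d : ℕ) :
    (dft ω n (fun p => dft ω n (fun x => ⟨a x, b x⟩) p ^ 2) d).im =
      2 * n * ∑ j ∈ Finset.range n, a j * b ((n - (j + d) % n) % n) := by
  rw [dft_sq_dft hω, ← nsmul_eq_mul, Complex.smul_im, nsmul_eq_mul, Complex.im_sum]
  have h1 : ∀ j ∈ Finset.range n, (∑ l ∈ Finset.range n,
      if n ∣ j + l + d then (⟨a j, b j⟩ * ⟨a l, b l⟩ : ℂ) else 0).im =
      (∑ l ∈ Finset.range n, if n ∣ j + l + d then a j * b l else 0) +
        ∑ l ∈ Finset.range n, if n ∣ l + j + d then a l * b j else 0 := by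
    intro j _
    rw [Complex.im_sum, ← Finset.sum_add_distrib]
    refine Finset.sum_congr rfl fun l _ => ?_
    rw [add_comm l j]
    split_ifs
    · simp; ring
    · simp
  rw [Finset.sum_congr rfl h1, Finset.sum_add_distrib]
  -- The imaginary part of `(a j + i b j) * (a l + i b l)` is `a j * b l + a l * b j`. The two
  -- double sums agree after exchanging `j` and `l`, which gives the factor `2`.
  rw [Finset.sum_comm (f := fun j l => if n ∣ l + j + d then a l * b j else 0)]
  have h2 : ∀ j ∈ Finset.range n, (∑ l ∈ Finset.range n, if n ∣ j + l + d then a j * b l else 0) =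
      a j * b ((n - (j + d) % n) % n) := by
    intro j _
    rw [← sum_dvd_add hn b (j + d), Finset.mul_sum]
    refine Finset.sum_congr rfl fun l _ => ?_
    rw [add_right_comm]; split_ifs <;> simp
  rw [Finset.sum_congr rfl h2]
  ring

/-- The fixed point representation of complex numbers, with scale `S`. -/
noncomputable def toC (S : ℤ) (a : ℤ × ℤ) : ℂ := ⟨a.1 / S, a.2 / S⟩

/-- The rounded product of fixed point numbers. -/
def cmul (S : ℤ) (a b : ℤ × ℤ) : ℤ × ℤ :=
  ((a.1 * b.1 - a.2 * b.2) / S, (a.1 * b.2 + a.2 * b.1) / S)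

theorem toC_add (S : ℤ) (a b : ℤ × ℤ) : toC S (a + b) = toC S a + toC S b := by
  apply Complex.ext <;> simp [toC] <;> ring

theorem abs_floor_div {S : ℤ} (hS : 0 < S) (u : ℤ) :
    |((u / S : ℤ) : ℝ) / S - u / S / S| ≤ 1 / S := by
  have hS' : (0 : ℝ) < S := by exact_mod_cast hS
  rw [← sub_div, abs_div, abs_of_pos hS']
  gcongr
  have h1 : ((u / S : ℤ) : ℝ) * S + (u % S : ℤ) = u := by
    exact_mod_cast Int.ediv_mul_add_emod u S
  have h2 : (0 : ℝ) ≤ (u % S : ℤ) := by exact_mod_cast Int.emod_nonneg u hS.ne'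
  have h3 : ((u % S : ℤ) : ℝ) ≤ S := by exact_mod_cast (Int.emod_lt_of_pos u hS).le
  have h4 : (u : ℝ) / S = (u / S : ℤ) + (u % S : ℤ) / S := by
    rw [← h1]; field_simp
  rw [h4, sub_add_cancel_left, abs_neg, abs_of_nonneg (by positivity)]
  rwa [div_le_one hS']

/-- Rounding down costs at most one unit, `1 / S`, in each coordinate. -/
theorem norm_toC_cmul_sub {S : ℤ} (hS : 0 < S) (a b : ℤ × ℤ) :
    ‖toC S (cmul S a b) - toC S a * toC S b‖ ≤ 2 / S := by
  have hS' : (S : ℝ) ≠ 0 := by exact_mod_cast hS.ne'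
  refine (Complex.norm_le_abs_re_add_abs_im _).trans ?_
  have h1 := abs_floor_div hS (a.1 * b.1 - a.2 * b.2)
  have h2 := abs_floor_div hS (a.1 * b.2 + a.2 * b.1)
  rw [show (2 : ℝ) / S = 1 / S + 1 / S by ring]
  refine add_le_add (le_of_eq_of_le ?_ h1) (le_of_eq_of_le ?_ h2)
  · congr 1
    simp only [toC, cmul, Complex.sub_re, Complex.mul_re]
    push_cast; field_simp
  · congr 1
    simp only [toC, cmul, Complex.sub_im, Complex.mul_im]
    push_cast; field_simp

/-- The decomposition `x * (y - b) + (x - a) * b` is mixed on purpose: it needs bounds only for one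
approximate factor and one exact factor. -/
theorem norm_mul_sub_mul_le {a b x y : ℂ} {e f A B : ℝ} (ha : ‖x - a‖ ≤ e) (hb : ‖y - b‖ ≤ f)
    (hx : ‖x‖ ≤ A) (hB : ‖b‖ ≤ B) : ‖x * y - a * b‖ ≤ A * f + e * B := by
  have h : x * y - a * b = x * (y - b) + (x - a) * b := by ring
  rw [h]
  refine (norm_add_le _ _).trans ?_
  rw [norm_mul, norm_mul]
  have := (norm_nonneg _).trans ha
  have := (norm_nonneg _).trans hx
  gcongr

/-- The error of the Fourier transform in fixed point arithmetic. -/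
theorem norm_toC_fftLevel_sub_le {ω : ℂ} {m : ℕ} (hω : ω ^ 2 ^ m = 1) {S : ℤ} (hS : 0 < S)
    {W : ℕ → ℤ × ℤ} {η : ℝ} (hη : η ≤ 1) (hW : ∀ k < 2 ^ m, ‖toC S (W k) - ω ^ k‖ ≤ η)
    {A : ℕ → ℤ × ℤ} {a : ℕ → ℂ} {E M : ℝ} (hA : ∀ p < 2 ^ m, ‖toC S (A p) - a p‖ ≤ E)
    (ha : ∀ p < 2 ^ m, ‖a p‖ ≤ M) {t : ℕ} (ht : t ≤ m) :
    ∀ p < 2 ^ m, ‖toC S (fftLevel (cmul S) W (2 ^ m) A t p) -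
      fftLevel (· * ·) (fun k => ω ^ k) (2 ^ m) a t p‖ + (η * (2 ^ m * M) + 2 / S) ≤
      3 ^ t * (E + (η * (2 ^ m * M) + 2 / S)) := by
  have hn : ‖ω‖ = 1 := Complex.norm_eq_one_of_pow_eq_one hω (by positivity)
  have hM : 0 ≤ M := (norm_nonneg _).trans (ha 0 (by positivity))
  have hη0 : 0 ≤ η := (norm_nonneg _).trans (hW 0 (by positivity))
  have hS' : (0 : ℝ) < S := by exact_mod_cast hS
  induction t with
  | zero => intro p hp; simpa [fftLevel] using hA p hp
  | succ t ih =>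
    intro p hp
    have ih := ih (by omega)
    have h2 : 2 ^ m = 2 ^ t * (2 * 2 ^ (m - (t + 1))) := by
      rw [← pow_succ', ← pow_add, show t + (m - (t + 1) + 1) = m by omega]
    have h3 : 2 ^ m / 2 ^ (t + 1) = 2 ^ (m - (t + 1)) := by
      rw [Nat.pow_div ht (by norm_num)]
    obtain ⟨i1, -, -⟩ := step_index (h := 2 ^ (m - (t + 1))) (p := p) (by positivity)
      (show 0 < 2 ^ t by positivity)
    rw [← h2] at i1
    set q := p - p % 2 ^ (m - (t + 1)) with hq
    set x := 2 * q % 2 ^ m + p % 2 ^ (m - (t + 1)) with hx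
    have hqn : q < 2 ^ m := by omega
    rw [fftLevel, fftLevel, fftStep, fftStep, h3, ← hq, ← hx, toC_add]
    have e1 := ih x (by omega)
    have e2 := ih (x + 2 ^ (m - (t + 1))) i1
    have e3 := norm_fftLevel_le hω a ha (show t ≤ m by omega) i1
    set A1 := fftLevel (cmul S) W (2 ^ m) A t
    set a1 := fftLevel (· * ·) (fun k => ω ^ k) (2 ^ m) a t
    set ρ := η * (2 ^ m * M) + 2 / S with hρ
    -- As approximate roots have norm at most `2`, an error `e` becomes at most `e + 2 * e + ρ`.
    -- Adding `ρ` to the error on the left of the claim turns this recursion into multiplication by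
    -- `3`.
    have hWn : ‖toC S (W q)‖ ≤ 2 := by
      have := norm_le_insert' (toC S (W q)) (ω ^ q)
      rw [norm_pow, hn, one_pow] at this
      linarith [hW q hqn]
    have e4 := norm_mul_sub_mul_le (hW q hqn)
      (show ‖toC S (A1 (x + 2 ^ (m - (t + 1)))) - a1 (x + 2 ^ (m - (t + 1)))‖ ≤
        3 ^ t * (E + ρ) - ρ by linarith) hWn e3
    have e5 := norm_toC_cmul_sub hS (W q) (A1 (x + 2 ^ (m - (t + 1))))
    have e6 : toC S (A1 x) + toC S (cmul S (W q) (A1 (x + 2 ^ (m - (t + 1))))) -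
        (a1 x + ω ^ q * a1 (x + 2 ^ (m - (t + 1)))) = (toC S (A1 x) - a1 x) +
        ((toC S (cmul S (W q) (A1 (x + 2 ^ (m - (t + 1))))) -
          toC S (W q) * toC S (A1 (x + 2 ^ (m - (t + 1))))) +
        (toC S (W q) * toC S (A1 (x + 2 ^ (m - (t + 1)))) -
          ω ^ q * a1 (x + 2 ^ (m - (t + 1))))) := by ring
    rw [e6]
    have e7 := norm_add_le (toC S (A1 x) - a1 x)
        ((toC S (cmul S (W q) (A1 (x + 2 ^ (m - (t + 1))))) -
          toC S (W q) * toC S (A1 (x + 2 ^ (m - (t + 1))))) +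
        (toC S (W q) * toC S (A1 (x + 2 ^ (m - (t + 1)))) -
          ω ^ q * a1 (x + 2 ^ (m - (t + 1)))))
    have e8 := norm_add_le (toC S (cmul S (W q) (A1 (x + 2 ^ (m - (t + 1))))) -
          toC S (W q) * toC S (A1 (x + 2 ^ (m - (t + 1)))))
        (toC S (W q) * toC S (A1 (x + 2 ^ (m - (t + 1)))) -
          ω ^ q * a1 (x + 2 ^ (m - (t + 1))))
    have e9 : 0 ≤ ρ := by positivity
    rw [pow_succ]
    linarith

open Real

/-- Both roots are at least `1`, so `√(2 + ·)` halves distances. This contraction keeps the errors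
of the iterated half-angle formula from accumulating. -/
theorem abs_sqrt_two_add_sub_le {a b : ℝ} (ha : 0 ≤ a) (hb : 0 ≤ b) :
    |√(2 + a) - √(2 + b)| ≤ |a - b| / 2 := by
  have h1 : 1 ≤ √(2 + a) := by rw [Real.one_le_sqrt]; linarith
  have h2 : 1 ≤ √(2 + b) := by rw [Real.one_le_sqrt]; linarith
  have h3 : (√(2 + a) - √(2 + b)) * (√(2 + a) + √(2 + b)) = a - b := by
    have := Real.mul_self_sqrt (show 0 ≤ 2 + a by linarith)
    have := Real.mul_self_sqrt (show 0 ≤ 2 + b by linarith)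
    linarith
  rw [← h3, abs_mul, abs_of_pos (show 0 < √(2 + a) + √(2 + b) by linarith), le_div_iff₀ (by norm_num)]
  gcongr
  linarith

/-- Used for the sine, where the argument of the root can be close to `0` and no Lipschitz bound is
available. The Hölder bound costs half of the digits, which the large scale compensates. -/
theorem abs_sqrt_sub_sqrt_le {a b : ℝ} (ha : 0 ≤ a) (hb : 0 ≤ b) : |√a - √b| ≤ √|a - b| := by
  apply Real.le_sqrt_of_sq_le
  rw [sq_abs]
  have h1 := Real.mul_self_sqrt ha
  have h2 := Real.mul_self_sqrt hb
  have h3 := Real.sqrt_nonneg a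
  have h4 := Real.sqrt_nonneg b
  rcases le_total (√a) (√b) with h | h
  · rw [abs_sub_comm]
    refine le_trans ?_ (le_abs_self _)
    nlinarith
  · refine le_trans ?_ (le_abs_self _)
    nlinarith

theorem abs_intSqrt_div_sub_le {S v : ℤ} (hS : 0 < S) (hv : 0 ≤ v) :
    |(Int.sqrt v : ℝ) / S - √(v / S / S)| ≤ 1 / S := by
  have hS' : (0 : ℝ) < S := by exact_mod_cast hS
  obtain ⟨k, rfl⟩ := Int.eq_ofNat_of_zero_le hv
  have h1 : Int.sqrt (k : ℤ) = (Nat.sqrt k : ℤ) := by simp [Int.sqrt]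
  have h2 : √(((k : ℤ) : ℝ) / S / S) = √k / S := by
    rw [div_div, Real.sqrt_div (by positivity), Real.sqrt_mul_self hS'.le, Int.cast_natCast]
  rw [h1, h2, ← sub_div, abs_div, abs_of_pos hS']
  gcongr
  have h3 : ((Nat.sqrt k : ℤ) : ℝ) ≤ √k := by
    simpa using Real.nat_sqrt_le_real_sqrt (a := k)
  have h4 : √k ≤ ((Nat.sqrt k : ℤ) : ℝ) + 1 := by
    simpa using Real.real_sqrt_le_nat_sqrt_succ (a := k)
  rw [abs_le]; constructor <;> linarith

/-- Fixed point approximations of `2 * cos (π / 2 ^ (j + 1))`. -/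
def cosFix (S : ℤ) : ℕ → ℤ
  | 0 => 0
  | j + 1 => Int.sqrt (S * (2 * S + cosFix S j))

theorem cosFix_nonneg (S : ℤ) (j : ℕ) : 0 ≤ cosFix S j := by
  cases j with
  | zero => exact le_rfl
  | succ j => exact Int.sqrt_nonneg _

theorem cosFix_le {S : ℤ} (hS : 0 < S) (j : ℕ) : cosFix S j ≤ 2 * S := by
  induction j with
  | zero => simp [cosFix]; omega
  | succ j ih =>
    have h0 := cosFix_nonneg S j
    obtain ⟨k, hk⟩ := Int.eq_ofNat_of_zero_le (show 0 ≤ S * (2 * S + cosFix S j) by positivity)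
    rw [cosFix, hk]
    have h1 : Int.sqrt (k : ℤ) = (Nat.sqrt k : ℤ) := by simp [Int.sqrt]
    have h2 : ((Nat.sqrt k : ℤ) * (Nat.sqrt k : ℤ)) ≤ k := by exact_mod_cast Nat.sqrt_le k
    rw [h1]
    rw [← hk] at h2
    nlinarith

/-- The bound is a fixed point of the error recursion: `2 / S = 1 / S + (2 / S) / 2`, one rounding
plus the halved previous error. It is therefore uniform in `j`. -/
theorem abs_cosFix_sub_le {S : ℤ} (hS : 0 < S) (j : ℕ) :
    |(cosFix S j : ℝ) / S - sqrtTwoAddSeries 0 j| ≤ 2 / S := by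
  have hS' : (0 : ℝ) < S := by exact_mod_cast hS
  induction j with
  | zero => simp [cosFix]; positivity
  | succ j ih =>
    have h0 := cosFix_nonneg S j
    have h0' : (0 : ℝ) ≤ cosFix S j := by exact_mod_cast h0
    have h1 := abs_intSqrt_div_sub_le hS (show 0 ≤ S * (2 * S + cosFix S j) by positivity)
    have h2 : ((S * (2 * S + cosFix S j) : ℤ) : ℝ) / S / S = 2 + cosFix S j / S := by
      push_cast; field_simp
    rw [h2] at h1
    have h3 := abs_sqrt_two_add_sub_le (show 0 ≤ (cosFix S j : ℝ) / S by positivity)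
      (sqrtTwoAddSeries_zero_nonneg j)
    have h4 := abs_sub_le ((Int.sqrt (S * (2 * S + cosFix S j)) : ℝ) / S)
      √(2 + cosFix S j / S) √(2 + sqrtTwoAddSeries 0 j)
    have h5 : (2 : ℝ) / S = 1 / S + 2 / S / 2 := by ring
    rw [cosFix, show sqrtTwoAddSeries 0 (j + 1) = √(2 + sqrtTwoAddSeries 0 j) from rfl, h5]
    linarith

/-- The fixed point approximation of the primitive root of unity of order `2 ^ m`, for `3 ≤ m`. -/
def rootFix (S : ℤ) (m : ℕ) : ℤ × ℤ :=
  (cosFix S (m - 2) / 2, Int.sqrt (S * (2 * S - cosFix S (m - 3))) / 2)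

/-- A primitive root of unity of order `2 ^ m`. -/
noncomputable def root (m : ℕ) : ℂ := Complex.exp (2 * π * Complex.I / (2 ^ m : ℕ))

theorem root_primitive (m : ℕ) : IsPrimitiveRoot (root m) (2 ^ m) :=
  Complex.isPrimitiveRoot_exp _ (by positivity)

/-- The angle is `π / 2 ^ (m + 2)`. The half-angle formula for the sine starts from the cosine of
the doubled angle, so its index is one lower than that of the cosine. -/
theorem root_eq (m : ℕ) : root (m + 3) =
    ⟨sqrtTwoAddSeries 0 (m + 1) / 2, √(2 - sqrtTwoAddSeries 0 m) / 2⟩ := by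
  have h : root (m + 3) = Complex.exp ((π / 2 ^ (m + 2) : ℝ) * Complex.I) := by
    rw [root]; congr 1; push_cast; rw [pow_succ (2 : ℂ) (m + 2)]; field_simp
  rw [h]
  apply Complex.ext
  · rw [Complex.exp_ofReal_mul_I_re, cos_pi_over_two_pow]
  · rw [Complex.exp_ofReal_mul_I_im, sin_pi_over_two_pow_succ]

theorem abs_half_sub_le {S : ℤ} (hS : 0 < S) {z : ℤ} {x e : ℝ} (h : |(z : ℝ) / S - x| ≤ e) :
    |((z / 2 : ℤ) : ℝ) / S - x / 2| ≤ e / 2 + 1 / S := by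
  have hS' : (0 : ℝ) < S := by exact_mod_cast hS
  have h1 : |((z / 2 : ℤ) : ℝ) - z / 2| ≤ 1 := by
    have h2 : z = 2 * (z / 2) ∨ z = 2 * (z / 2) + 1 := by omega
    rcases h2 with h2 | h2
    · have : (z : ℝ) = 2 * ((z / 2 : ℤ) : ℝ) := by exact_mod_cast h2
      rw [this]; norm_num
    · have : (z : ℝ) = 2 * ((z / 2 : ℤ) : ℝ) + 1 := by exact_mod_cast h2
      rw [this, abs_le]; constructor <;> linarith
  have h3 : |((z / 2 : ℤ) : ℝ) / S - z / 2 / S| ≤ 1 / S := by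
    rw [← sub_div, abs_div, abs_of_pos hS']; gcongr
  have h4 : |(z : ℝ) / 2 / S - x / 2| ≤ e / 2 := by
    rw [div_right_comm, ← sub_div, abs_div, abs_of_pos (zero_lt_two' ℝ)]; gcongr
  linarith [abs_sub_le (((z / 2 : ℤ) : ℝ) / S) ((z : ℝ) / 2 / S) (x / 2)]

/-- The cosine contributes `2 / S`, the sine `√(2 / S) / 2 + 3 / 2 / S`; each includes `1 / S` for
the rounded division by `2`. -/
theorem norm_toC_rootFix_sub_le {S : ℤ} (hS : 0 < S) {m : ℕ} (hm : 3 ≤ m) :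
    ‖toC S (rootFix S m) - root m‖ ≤ √(2 / S) / 2 + 7 / 2 / S := by
  obtain ⟨m, rfl⟩ := Nat.exists_eq_add_of_le' hm
  have hS' : (0 : ℝ) < S := by exact_mod_cast hS
  refine (Complex.norm_le_abs_re_add_abs_im _).trans ?_
  rw [root_eq, Complex.sub_re, Complex.sub_im]
  simp only [toC, rootFix, Nat.add_sub_cancel, show m + 3 - 2 = m + 1 by omega]
  have h1 := abs_half_sub_le hS (abs_cosFix_sub_le hS (m + 1))
  have h0 := cosFix_nonneg S m
  have h0' := cosFix_le hS m
  have h0'' : (cosFix S m : ℝ) ≤ 2 * S := by exact_mod_cast h0'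
  have h2 := abs_intSqrt_div_sub_le hS
    (show 0 ≤ S * (2 * S - cosFix S m) from mul_nonneg hS.le (by omega))
  have h3 : ((S * (2 * S - cosFix S m) : ℤ) : ℝ) / S / S = 2 - cosFix S m / S := by
    push_cast; field_simp
  rw [h3] at h2
  have h4 := abs_sqrt_sub_sqrt_le (a := 2 - cosFix S m / S) (b := 2 - sqrtTwoAddSeries 0 m)
    (by rw [sub_nonneg, div_le_iff₀ hS']; exact h0'')
    (by linarith [sqrtTwoAddSeries_lt_two m])
  have h5 : √|2 - (cosFix S m : ℝ) / S - (2 - sqrtTwoAddSeries 0 m)| ≤ √(2 / S) := by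
    apply Real.sqrt_le_sqrt
    rw [sub_sub_sub_cancel_left, abs_sub_comm]
    exact abs_cosFix_sub_le hS m
  have h6 := abs_half_sub_le hS ((abs_sub_le _ _ _).trans (add_le_add h2 (h4.trans h5)))
  calc _ ≤ _ := add_le_add h1 h6
    _ = _ := by ring

/-- The fixed point approximations of the powers of the root of unity. -/
def powFix (S : ℤ) (m : ℕ) : ℕ → ℤ × ℤ
  | 0 => (S, 0)
  | k + 1 => cmul S (powFix S m k) (rootFix S m)

/-- Errors of repeated multiplication grow linearly, as long as the approximate powers keep norm at
most `2`; `hn` ensures this by keeping the accumulated error below `1`. -/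
theorem norm_toC_powFix_sub_le {S : ℤ} (hS : 0 < S) {m : ℕ} {δ : ℝ}
    (hδ : ‖toC S (rootFix S m) - root m‖ ≤ δ) {n : ℕ} (hn : n * (2 * (δ + 2 / S)) ≤ 1) :
    ∀ k ≤ n, ‖toC S (powFix S m k) - root m ^ k‖ ≤ k * (2 * (δ + 2 / S)) := by
  have hS' : (0 : ℝ) < S := by exact_mod_cast hS
  have hδ0 : 0 ≤ δ := (norm_nonneg _).trans hδ
  have hr : ‖root m‖ = 1 :=
    Complex.norm_eq_one_of_pow_eq_one (root_primitive m).pow_eq_one (by positivity)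
  have hS0 : 0 ≤ 2 / (S : ℝ) := by positivity
  intro k
  induction k with
  | zero =>
    intro _
    have : toC S (S, 0) = 1 := by apply Complex.ext <;> simp [toC, hS'.ne']
    simp [powFix, this]
  | succ k ih =>
    intro hk
    have ih := ih (by omega)
    have h1 : (k : ℝ) * (2 * (δ + 2 / S)) ≤ 1 := by
      refine le_trans ?_ hn
      gcongr; omega
    have h2 : ‖toC S (powFix S m k)‖ ≤ 2 := by
      have := norm_le_insert' (toC S (powFix S m k)) (root m ^ k)
      rw [norm_pow, hr, one_pow] at this
      linarith
    have h3 := norm_mul_sub_mul_le ih hδ h2 hr.le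
    have h4 := norm_toC_cmul_sub hS (powFix S m k) (rootFix S m)
    have h5 := norm_sub_le_norm_sub_add_norm_sub (toC S (cmul S (powFix S m k) (rootFix S m)))
      (toC S (powFix S m k) * toC S (rootFix S m)) (root m ^ k * root m)
    rw [powFix, pow_succ]
    push_cast
    linarith

theorem abs_le_of_norm_toC_le {S : ℤ} (hS : 0 < S) {a : ℤ × ℤ} {B : ℤ} (h : ‖toC S a‖ ≤ B) :
    |a.1| ≤ S * B ∧ |a.2| ≤ S * B := by
  have hS' : (0 : ℝ) < S := by exact_mod_cast hS
  have h1 := (Complex.abs_re_le_norm _).trans h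
  have h2 := (Complex.abs_im_le_norm _).trans h
  simp only [toC, abs_div, abs_of_pos hS', div_le_iff₀ hS'] at h1 h2
  rw [mul_comm]
  exact ⟨by exact_mod_cast h1, by exact_mod_cast h2⟩

/-- Write `n = 2 ^ m` and `S = n ^ 20`. The root has error at most `2 / n ^ 10` because of the
square root of `2 / S`. Then `n` multiplications give at most `5 / n ^ 9`, and `5 ≤ n` absorbs the
constant. -/
theorem norm_toC_powFix_sub_le_inv {m : ℕ} (hm : 4 ≤ m) {k : ℕ} (hk : k ≤ 2 ^ m) :
    ‖toC ((2 ^ m) ^ 20) (powFix ((2 ^ m) ^ 20) m k) - root m ^ k‖ ≤ (1 / 2 ^ m) ^ 8 := by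
  have hS : (0 : ℤ) < (2 ^ m) ^ 20 := by positivity
  set ν : ℝ := 1 / 2 ^ m with hν
  have hν0 : 0 < ν := by positivity
  have hn : (2 : ℝ) ^ m * ν = 1 := by rw [hν]; field_simp
  have hν1 : ν ≤ 1 / 16 := by
    rw [hν]; gcongr
    calc (16 : ℝ) = 2 ^ 4 := by norm_num
      _ ≤ 2 ^ m := by gcongr; norm_num
  have hSν : (1 : ℝ) / (((2 ^ m) ^ 20 : ℤ) : ℝ) = ν ^ 20 := by
    rw [hν]; push_cast; rw [one_div_pow]
  have h2S : (2 : ℝ) / (((2 ^ m) ^ 20 : ℤ) : ℝ) = 2 * ν ^ 20 := by rw [← hSν]; ring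
  have h10 : ν ^ 20 ≤ ν ^ 10 / 16 := by
    have : ν ^ 10 ≤ 1 / 16 := (pow_le_of_le_one hν0.le (by linarith) (by norm_num)).trans hν1
    calc ν ^ 20 = ν ^ 10 * ν ^ 10 := by ring
      _ ≤ ν ^ 10 * (1 / 16) := by gcongr
      _ = _ := by ring
  have hsq : √(2 / (((2 ^ m) ^ 20 : ℤ) : ℝ)) ≤ 2 * ν ^ 10 := by
    apply Real.sqrt_le_iff.mpr ⟨by positivity, ?_⟩
    rw [h2S]
    have : 0 < ν ^ 20 := by positivity
    nlinarith
  have hδ := norm_toC_rootFix_sub_le hS (show 3 ≤ m by omega)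
  have h7 : (7 : ℝ) / 2 / (((2 ^ m) ^ 20 : ℤ) : ℝ) = 7 / 2 * ν ^ 20 := by rw [← hSν]; ring
  rw [h7] at hδ
  have hδ' : ‖toC ((2 ^ m) ^ 20) (rootFix ((2 ^ m) ^ 20) m) - root m‖ ≤ 2 * ν ^ 10 := by
    have : 0 < ν ^ 10 := by positivity
    linarith
  have hη : 2 * (2 * ν ^ 10 + 2 / (((2 ^ m) ^ 20 : ℤ) : ℝ)) ≤ 5 * ν ^ 10 := by
    rw [h2S]; have : 0 < ν ^ 10 := by positivity
    linarith
  have hfin : (2 : ℝ) ^ m * (5 * ν ^ 10) ≤ ν ^ 8 := by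
    calc (2 : ℝ) ^ m * (5 * ν ^ 10) = (2 ^ m * ν) * (5 * ν) * ν ^ 8 := by ring
      _ = (5 * ν) * ν ^ 8 := by rw [hn, one_mul]
      _ ≤ 1 * ν ^ 8 := by gcongr; linarith
      _ = ν ^ 8 := one_mul _
  have hν8 : ν ^ 8 ≤ 1 := pow_le_one₀ hν0.le (by linarith)
  have h0 : 0 ≤ 2 * (2 * ν ^ 10 + 2 / (((2 ^ m) ^ 20 : ℤ) : ℝ)) := by rw [h2S]; positivity
  refine (norm_toC_powFix_sub_le hS hδ' (n := 2 ^ m) ?_ k hk).trans ?_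
  · push_cast at hη ⊢
    exact ((mul_le_mul_of_nonneg_left hη (by positivity)).trans hfin).trans hν8
  · refine le_trans ?_ hfin
    have : (k : ℝ) ≤ 2 ^ m := by exact_mod_cast hk
    exact mul_le_mul this hη h0 (by positivity)

/-- The input of the transform: the fixed point representation of `a + i b`. -/
def toFix (S : ℤ) (a b : ℕ → ℤ) (x : ℕ) : ℤ × ℤ := (S * a x, S * b x)

/-- The levels of the first transform. -/
def level₁ (m : ℕ) (a b : ℕ → ℤ) : ℕ → ℕ → ℤ × ℤ :=
  fftLevel (cmul ((2 ^ m) ^ 20)) (powFix ((2 ^ m) ^ 20) m) (2 ^ m) (toFix ((2 ^ m) ^ 20) a b)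

/-- The levels of the second transform, applied to the square of the first one. -/
def level₂ (m : ℕ) (a b : ℕ → ℤ) : ℕ → ℕ → ℤ × ℤ :=
  fftLevel (cmul ((2 ^ m) ^ 20)) (powFix ((2 ^ m) ^ 20) m) (2 ^ m)
    (fun p => cmul ((2 ^ m) ^ 20) (level₁ m a b m p) (level₁ m a b m p))

section
variable {m : ℕ} {a b : ℕ → ℤ}

theorem norm_toFix_le (ha : ∀ x, a x = 0 ∨ a x = 1) (hb : ∀ x, b x = 0 ∨ b x = 1) (p : ℕ) :
    ‖(⟨(a p : ℝ), (b p : ℝ)⟩ : ℂ)‖ ≤ 2 := by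
  refine (Complex.norm_le_abs_re_add_abs_im _).trans ?_
  rcases ha p with h | h <;> rcases hb p with h' | h' <;> simp [h, h'] <;> norm_num

/-- The error budget, with `n = 2 ^ m`. A transform amplifies errors by at most `3 ^ m ≤ 4 ^ m = n ^
2`. In the first one each step adds at most `3 / n ^ 7`, in total `3 / n ^ 5`. The transform has
norm at most `2 * n`, so squaring raises the error to at most `16 / n ^ 4`. In the second one the
inputs are at most `4 * n ^ 2`, each step adds at most `5 / n ^ 5`, and the total `n ^ 2 * (16 / n ^
4 + 5 / n ^ 5)` is below `1`. -/
theorem level_bounds (hm : 4 ≤ m) (ha : ∀ x, a x = 0 ∨ a x = 1) (hb : ∀ x, b x = 0 ∨ b x = 1) :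
    (∀ t ≤ m, ∀ p < 2 ^ m, ‖toC ((2 ^ m) ^ 20) (level₁ m a b t p) -
      fftLevel (· * ·) (fun k => root m ^ k) (2 ^ m) (fun x => ⟨a x, b x⟩) t p‖ ≤
        3 * (1 / 2 ^ m) ^ 5) ∧
    (∀ t ≤ m, ∀ p < 2 ^ m, ‖toC ((2 ^ m) ^ 20) (level₂ m a b t p) -
      fftLevel (· * ·) (fun k => root m ^ k) (2 ^ m)
        (fun q => dft (root m) (2 ^ m) (fun x => ⟨a x, b x⟩) q ^ 2) t p‖ < 1) ∧
    (∀ p < 2 ^ m, ‖dft (root m) (2 ^ m) (fun x => ⟨a x, b x⟩) p ^ 2‖ ≤ 4 * (2 ^ m) ^ 2) := by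
  have hS : (0 : ℤ) < (2 ^ m) ^ 20 := by positivity
  have hω := (root_primitive m).pow_eq_one
  have hW : ∀ k < 2 ^ m, _ := fun k hk => norm_toC_powFix_sub_le_inv hm (k := k) hk.le
  set ν : ℝ := 1 / 2 ^ m with hν
  have hν0 : 0 < ν := by positivity
  have hn : (2 : ℝ) ^ m * ν = 1 := by rw [hν]; field_simp
  have hn16 : (16 : ℝ) ≤ 2 ^ m := by
    calc (16 : ℝ) = 2 ^ 4 := by norm_num
      _ ≤ 2 ^ m := by gcongr; norm_num
  have hν1 : ν ≤ 1 / 16 := by rw [hν]; gcongr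
  have hν8 : ν ^ 8 ≤ 1 := pow_le_one₀ hν0.le (by linarith)
  have h2S : (2 : ℝ) / (((2 ^ m) ^ 20 : ℤ) : ℝ) = 2 * ν ^ 20 := by
    rw [hν]; push_cast; rw [one_div_pow]; ring
  have h3 : ∀ t ≤ m, (3 : ℝ) ^ t ≤ (2 ^ m) ^ 2 := by
    intro t ht
    calc (3 : ℝ) ^ t ≤ 4 ^ t := by gcongr; norm_num
      _ ≤ 4 ^ m := by gcongr; norm_num
      _ = (2 ^ m) ^ 2 := by rw [← pow_mul, mul_comm, pow_mul]; norm_num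
  have hz : ∀ p < 2 ^ m, ‖(⟨(a p : ℝ), (b p : ℝ)⟩ : ℂ)‖ ≤ 2 := fun p _ => norm_toFix_le ha hb p
  have hz0 : ∀ p < 2 ^ m, ‖toC ((2 ^ m) ^ 20) (toFix ((2 ^ m) ^ 20) a b p) - ⟨a p, b p⟩‖ ≤ 0 := by
    intro p _
    rw [norm_le_zero_iff, sub_eq_zero]
    apply Complex.ext <;> simp [toC, toFix]
  have hd : ∀ q < 2 ^ m, ‖dft (root m) (2 ^ m) (fun x => ⟨a x, b x⟩) q‖ ≤ 2 ^ m * 2 := by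
    intro q hq
    rw [← fftLevel_last hω _ hq]
    exact norm_fftLevel_le hω _ hz le_rfl hq
  have hd2 : ∀ p < 2 ^ m, ‖dft (root m) (2 ^ m) (fun x => ⟨a x, b x⟩) p ^ 2‖ ≤ 4 * (2 ^ m) ^ 2 := by
    intro p hp
    rw [norm_pow]
    calc _ ≤ (2 ^ m * 2 : ℝ) ^ 2 := by gcongr; exact hd p hp
      _ = _ := by ring
  have n20 : ν ^ 20 ≤ ν ^ 5 / 16 := by
    calc ν ^ 20 = ν ^ 5 * ν ^ 15 := by ring
      _ ≤ ν ^ 5 * (1 / 16) := by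
        gcongr; exact (pow_le_of_le_one hν0.le (by linarith) (by norm_num)).trans hν1
      _ = _ := by ring
  have n20' : ν ^ 20 ≤ ν ^ 7 / 16 := by
    calc ν ^ 20 = ν ^ 7 * ν ^ 13 := by ring
      _ ≤ ν ^ 7 * (1 / 16) := by
        gcongr; exact (pow_le_of_le_one hν0.le (by linarith) (by norm_num)).trans hν1
      _ = _ := by ring
  have h1 : ∀ t ≤ m, ∀ p < 2 ^ m, ‖toC ((2 ^ m) ^ 20) (level₁ m a b t p) -
      fftLevel (· * ·) (fun k => root m ^ k) (2 ^ m) (fun x => ⟨a x, b x⟩) t p‖ ≤ 3 * ν ^ 5 := by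
    intro t ht p hp
    have key := norm_toC_fftLevel_sub_le hω hS hν8 hW hz0 hz ht p hp
    have hρ : ν ^ 8 * (2 ^ m * 2) + 2 / (((2 ^ m) ^ 20 : ℤ) : ℝ) ≤ 3 * ν ^ 7 := by
      rw [h2S, show ν ^ 8 * (2 ^ m * 2) = 2 * (2 ^ m * ν) * ν ^ 7 by ring, hn]
      have : 0 < ν ^ 7 := by positivity
      linarith
    have hρ0 : 0 ≤ ν ^ 8 * (2 ^ m * 2) + 2 / (((2 ^ m) ^ 20 : ℤ) : ℝ) := by
      rw [h2S]; positivity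
    calc _ ≤ 3 ^ t * (0 + (ν ^ 8 * (2 ^ m * 2) + 2 / (((2 ^ m) ^ 20 : ℤ) : ℝ))) := by
          refine le_trans ?_ key
          exact le_add_of_nonneg_right hρ0
      _ ≤ (2 ^ m) ^ 2 * (0 + 3 * ν ^ 7) := by
          gcongr
          exact h3 t ht
      _ = 3 * (2 ^ m * ν) ^ 2 * ν ^ 5 := by ring
      _ = 3 * ν ^ 5 := by rw [hn]; ring
  refine ⟨h1, fun t ht p hp => ?_, hd2⟩
  have hν5 : 3 * ν ^ 5 ≤ 1 := by
    have : ν ^ 5 ≤ 1 / 16 := (pow_le_of_le_one hν0.le (by linarith) (by norm_num)).trans hν1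
    linarith
  have hsq : ∀ p < 2 ^ m, ‖toC ((2 ^ m) ^ 20)
      (cmul ((2 ^ m) ^ 20) (level₁ m a b m p) (level₁ m a b m p)) -
      dft (root m) (2 ^ m) (fun x => ⟨a x, b x⟩) p ^ 2‖ ≤ 16 * ν ^ 4 := by
    intro p hp
    have e1 := h1 m le_rfl p hp
    rw [fftLevel_last hω _ hp] at e1
    have e2 := hd p hp
    have e3 : ‖toC ((2 ^ m) ^ 20) (level₁ m a b m p)‖ ≤ 2 ^ m * 3 := by
      have := norm_le_insert' (toC ((2 ^ m) ^ 20) (level₁ m a b m p))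
        (dft (root m) (2 ^ m) (fun x => ⟨a x, b x⟩) p)
      linarith
    have e4 := norm_mul_sub_mul_le e1 e1 e3 e2
    have e5 := norm_toC_cmul_sub hS (level₁ m a b m p) (level₁ m a b m p)
    rw [h2S] at e5
    rw [sq]
    refine (norm_sub_le_norm_sub_add_norm_sub _ _ _).trans ((add_le_add e5 e4).trans ?_)
    have e6 : 2 ^ m * 3 * (3 * ν ^ 5) + 3 * ν ^ 5 * (2 ^ m * 2) = 15 * (2 ^ m * ν) * ν ^ 4 := by
      ring
    rw [e6, hn]
    have e7 : ν ^ 20 ≤ ν ^ 4 / 16 := by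
      calc ν ^ 20 = ν ^ 4 * ν ^ 16 := by ring
        _ ≤ ν ^ 4 * (1 / 16) := by
          gcongr; exact (pow_le_of_le_one hν0.le (by linarith) (by norm_num)).trans hν1
        _ = _ := by ring
    have : 0 < ν ^ 4 := by positivity
    linarith
  have key := norm_toC_fftLevel_sub_le hω hS hν8 hW hsq hd2 ht p hp
  have hρ : ν ^ 8 * (2 ^ m * (4 * (2 ^ m) ^ 2)) + 2 / (((2 ^ m) ^ 20 : ℤ) : ℝ) ≤ 5 * ν ^ 5 := by
    rw [h2S, show ν ^ 8 * (2 ^ m * (4 * (2 ^ m) ^ 2)) = 4 * (2 ^ m * ν) ^ 3 * ν ^ 5 by ring, hn]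
    have : 0 < ν ^ 5 := by positivity
    linarith
  have hρ0 : 0 ≤ ν ^ 8 * (2 ^ m * (4 * (2 ^ m) ^ 2)) + 2 / (((2 ^ m) ^ 20 : ℤ) : ℝ) := by
    rw [h2S]; positivity
  calc _ ≤ 3 ^ t * (16 * ν ^ 4 +
        (ν ^ 8 * (2 ^ m * (4 * (2 ^ m) ^ 2)) + 2 / (((2 ^ m) ^ 20 : ℤ) : ℝ))) := by
        refine le_trans ?_ key
        exact le_add_of_nonneg_right hρ0
    _ ≤ (2 ^ m) ^ 2 * (16 * ν ^ 4 + 5 * ν ^ 5) := by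
        gcongr
        exact h3 t ht
    _ = 16 * (2 ^ m * ν) ^ 2 * ν ^ 2 + 5 * (2 ^ m * ν) ^ 2 * ν ^ 3 := by ring
    _ = (16 * ν) * ν + (5 * ν) * ν ^ 2 := by rw [hn]; ring
    _ ≤ 1 * ν + 1 * ν ^ 2 := by gcongr <;> linarith
    _ < 1 := by nlinarith

/-- This bound and the next two keep the machine products from wrapping around: every fixed point
number met is at most `S * n ^ 4` in absolute value. -/
theorem abs_powFix_le (hm : 4 ≤ m) {k : ℕ} (hk : k ≤ 2 ^ m) :
    |(powFix ((2 ^ m) ^ 20) m k).1| ≤ (2 ^ m) ^ 20 * (2 ^ m) ^ 4 ∧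
      |(powFix ((2 ^ m) ^ 20) m k).2| ≤ (2 ^ m) ^ 20 * (2 ^ m) ^ 4 := by
  apply abs_le_of_norm_toC_le (by positivity)
  have h1 := norm_toC_powFix_sub_le_inv hm hk
  have hr : ‖root m ^ k‖ = 1 := by
    rw [norm_pow, Complex.norm_eq_one_of_pow_eq_one (root_primitive m).pow_eq_one (by positivity),
      one_pow]
  have h2 : ((1 : ℝ) / 2 ^ m) ^ 8 ≤ 1 := by
    apply pow_le_one₀ (by positivity)
    rw [div_le_one (by positivity)]
    exact one_le_pow₀ (by norm_num)
  have h3 : (2 : ℝ) ≤ (2 ^ m) ^ 4 := by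
    rw [← pow_mul]
    exact le_self_pow₀ (by norm_num) (by omega)
  have := norm_le_insert' (toC ((2 ^ m) ^ 20) (powFix ((2 ^ m) ^ 20) m k)) (root m ^ k)
  push_cast
  linarith

theorem abs_level₁_le (hm : 4 ≤ m) (ha : ∀ x, a x = 0 ∨ a x = 1) (hb : ∀ x, b x = 0 ∨ b x = 1)
    {t : ℕ} (ht : t ≤ m) {p : ℕ} (hp : p < 2 ^ m) :
    |(level₁ m a b t p).1| ≤ (2 ^ m) ^ 20 * (2 ^ m) ^ 4 ∧
      |(level₁ m a b t p).2| ≤ (2 ^ m) ^ 20 * (2 ^ m) ^ 4 := by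
  apply abs_le_of_norm_toC_le (by positivity)
  have hn16 : (16 : ℝ) ≤ 2 ^ m := by
    calc (16 : ℝ) = 2 ^ 4 := by norm_num
      _ ≤ 2 ^ m := by gcongr; norm_num
  have h1 := (level_bounds hm ha hb).1 t ht p hp
  have h2 := norm_fftLevel_le (root_primitive m).pow_eq_one _
    (fun p _ => norm_toFix_le ha hb p) ht hp
  have h3 : ((1 : ℝ) / 2 ^ m) ^ 5 ≤ 1 := by
    apply pow_le_one₀ (by positivity)
    rw [div_le_one (by positivity)]
    linarith
  have h4 := norm_le_norm_add_norm_sub' (toC ((2 ^ m) ^ 20) (level₁ m a b t p))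
    (fftLevel (· * ·) (fun k => root m ^ k) (2 ^ m) (fun x => ⟨a x, b x⟩) t p)
  push_cast
  have h5 : (2 : ℝ) ^ m * 2 + 3 ≤ (2 ^ m) ^ 4 := by
    have : (16 : ℝ) ^ 3 * 2 ^ m ≤ (2 ^ m) ^ 3 * 2 ^ m := by gcongr
    nlinarith
  linarith

theorem abs_level₂_le (hm : 4 ≤ m) (ha : ∀ x, a x = 0 ∨ a x = 1) (hb : ∀ x, b x = 0 ∨ b x = 1)
    {t : ℕ} (ht : t ≤ m) {p : ℕ} (hp : p < 2 ^ m) :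
    |(level₂ m a b t p).1| ≤ (2 ^ m) ^ 20 * (2 ^ m) ^ 4 ∧
      |(level₂ m a b t p).2| ≤ (2 ^ m) ^ 20 * (2 ^ m) ^ 4 := by
  apply abs_le_of_norm_toC_le (by positivity)
  have hn16 : (16 : ℝ) ≤ 2 ^ m := by
    calc (16 : ℝ) = 2 ^ 4 := by norm_num
      _ ≤ 2 ^ m := by gcongr; norm_num
  obtain ⟨-, h1, h0⟩ := level_bounds hm ha hb
  have h1 := h1 t ht p hp
  have h2 := norm_fftLevel_le (root_primitive m).pow_eq_one _ h0 ht hp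
  have h4 := norm_le_norm_add_norm_sub' (toC ((2 ^ m) ^ 20) (level₂ m a b t p))
    (fftLevel (· * ·) (fun k => root m ^ k) (2 ^ m)
        (fun q => dft (root m) (2 ^ m) (fun x => ⟨a x, b x⟩) q ^ 2) t p)
  push_cast
  have h5 : (2 : ℝ) ^ m * (4 * (2 ^ m) ^ 2) + 1 ≤ (2 ^ m) ^ 4 := by
    have : (16 : ℝ) * (2 ^ m) ^ 3 ≤ 2 ^ m * (2 ^ m) ^ 3 := by gcongr
    have : (1 : ℝ) ≤ (2 ^ m) ^ 3 := one_le_pow₀ (by linarith)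
    nlinarith
  linarith

/-- The correlation, read off the second transform. -/
theorem level₂_last (hm : 4 ≤ m) (ha : ∀ x, a x = 0 ∨ a x = 1) (hb : ∀ x, b x = 0 ∨ b x = 1)
    {d : ℕ} (hd : d < 2 ^ m) :
    0 ≤ (level₂ m a b m d).2 + 2 ^ m * (2 ^ m) ^ 20 ∧
    ((level₂ m a b m d).2 + 2 ^ m * (2 ^ m) ^ 20) / (2 * 2 ^ m * (2 ^ m) ^ 20) =
      ∑ j ∈ Finset.range (2 ^ m), a j * b ((2 ^ m - (j + d) % 2 ^ m) % 2 ^ m) := by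
  have h1 := (level_bounds hm ha hb).2.1 m le_rfl d hd
  rw [fftLevel_last (root_primitive m).pow_eq_one _ hd] at h1
  have h2 := (Complex.abs_im_le_norm _).trans_lt h1
  rw [Complex.sub_im, dft_sq_dft_im (by positivity) (root_primitive m)] at h2
  have h3 : (∑ j ∈ Finset.range (2 ^ m), (a j : ℝ) * b ((2 ^ m - (j + d) % 2 ^ m) % 2 ^ m)) =
      ((∑ j ∈ Finset.range (2 ^ m), a j * b ((2 ^ m - (j + d) % 2 ^ m) % 2 ^ m) : ℤ) : ℝ) := by
    push_cast; rfl
  rw [h3] at h2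
  have hs0 : 0 ≤ ∑ j ∈ Finset.range (2 ^ m), a j * b ((2 ^ m - (j + d) % 2 ^ m) % 2 ^ m) := by
    refine Finset.sum_nonneg fun j _ => mul_nonneg ?_ ?_
    · rcases ha j with h | h <;> simp [h]
    · rcases hb ((2 ^ m - (j + d) % 2 ^ m) % 2 ^ m) with h | h <;> simp [h]
  set s := ∑ j ∈ Finset.range (2 ^ m), a j * b ((2 ^ m - (j + d) % 2 ^ m) % 2 ^ m)
  set v := (level₂ m a b m d).2 with hv
  have hS : (0 : ℝ) < (2 ^ m) ^ 20 := by positivity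
  rw [toC, ← hv] at h2
  push_cast at h2
  have h4 : |(v : ℝ) - 2 * 2 ^ m * s * (2 ^ m) ^ 20| < (2 ^ m) ^ 20 := by
    have : (v : ℝ) - 2 * 2 ^ m * s * (2 ^ m) ^ 20 = (v / (2 ^ m) ^ 20 - 2 * 2 ^ m * s) * (2 ^ m) ^ 20 := by
      field_simp
    rw [this, abs_mul, abs_of_pos hS]
    exact mul_lt_of_lt_one_left hS h2
  have h5 : |v - 2 * 2 ^ m * s * (2 ^ m) ^ 20| < (2 ^ m) ^ 20 := by exact_mod_cast h4
  obtain ⟨h6, h7⟩ := abs_lt.mp h5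
  have hSz : (0 : ℤ) < (2 ^ m) ^ 20 := by positivity
  have hnz : (2 : ℤ) ≤ 2 ^ m := le_self_pow₀ (by norm_num) (by omega)
  have h8 : 2 * (2 ^ m) ^ 20 ≤ (2 : ℤ) ^ m * (2 ^ m) ^ 20 := by gcongr
  have h9 : 0 ≤ 2 * 2 ^ m * s * (2 ^ m) ^ 20 := by positivity
  refine ⟨by linarith, ?_⟩
  -- The value `v` is within `S` of `2 * n * s * S`, and `S ≤ n * S`. Adding `n * S`, half of the
  -- divisor, before the division rounds to the nearest integer `s`.
  rw [Int.ediv_eq_iff_of_pos (by positivity)]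
  constructor <;> linarith

/-- The transforms count the matches between a string `Y` of length `N` and the shifts of a
string `X` of length `N` over the alphabet `{0, …, σ - 1}`. -/
theorem sum_indicator_eq_card {n N σ : ℕ} (hN : 0 < N) (hn : 2 * N * σ ≤ n) {d : ℕ} (hd : d < N)
    (Y X : ℕ → ℕ) (hX : ∀ i < N, X i < σ) (hY : ∀ i, N ≤ i → n ≤ Y i)
    (hY' : ∀ i, Y i < σ ∨ n ≤ Y i) :
    (∑ j ∈ Finset.range n, (if Y (j % (2 * N)) = j / (2 * N) then (1 : ℤ) else 0) *
      if X ((n - (n - (j + d) % n) % n) % n % (2 * N) % N) =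
        (n - (n - (j + d) % n) % n) % n / (2 * N) then 1 else 0) =
      ((Finset.range N).filter fun i => Y i = X ((i + d) % N)).card := by
  -- The index reflected by the double transform meets the reflection built into the second
  -- sequence, and the two cancel.
  have hback : ∀ e < n, (n - (n - e % n) % n) % n = e := by
    intro e he
    rw [Nat.mod_eq_of_lt he]
    rcases Nat.eq_zero_or_pos e with rfl | h
    · simp
    · rw [Nat.mod_eq_of_lt (show n - e < n by omega), show n - (n - e) = e by omega,
        Nat.mod_eq_of_lt he]
  -- Shifting the code of a character by `d` does not reach `n`, so the cyclic correlation does not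
  -- wrap around.
  have hcode : ∀ i c, i < N → c < σ → i + 2 * N * c + d < n := by
    intro i c hi hc
    have : 2 * N * (c + 1) ≤ 2 * N * σ := Nat.mul_le_mul_left _ hc
    rw [mul_add] at this; omega
  have hmod : ∀ i c, i + d < 2 * N → (i + 2 * N * c + d) % (2 * N) = i + d := by
    intro i c h
    rw [add_right_comm, Nat.add_mul_mod_self_left, Nat.mod_eq_of_lt h]
  have hdiv : ∀ i c, i + d < 2 * N → (i + 2 * N * c + d) / (2 * N) = c := by
    intro i c h
    rw [add_right_comm, Nat.add_mul_div_left _ _ (by omega), Nat.div_eq_of_lt h, zero_add]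
  have hterm : ∀ j ∈ Finset.range n, (if Y (j % (2 * N)) = j / (2 * N) then (1 : ℤ) else 0) *
      (if X ((n - (n - (j + d) % n) % n) % n % (2 * N) % N) =
        (n - (n - (j + d) % n) % n) % n / (2 * N) then 1 else 0) =
      if Y (j % (2 * N)) = j / (2 * N) ∧ X ((n - (n - (j + d) % n) % n) % n % (2 * N) % N) =
        (n - (n - (j + d) % n) % n) % n / (2 * N) then 1 else 0 := by
    intro j _
    split_ifs <;> simp_all
  rw [Finset.sum_congr rfl hterm, Finset.sum_boole]
  congr 1
  symm
  -- A match at `i` corresponds to the index `i + 2 * N * Y i`. The upper half of each block of `Y`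
  -- is empty by `hY`, while `X` fills both halves, so the shifted position `i + d < 2 * N` stays in
  -- the block of the same character.
  refine Finset.card_bij' (fun i _ => i + 2 * N * Y i) (fun j _ => j % (2 * N)) ?_ ?_ ?_ ?_
  · intro i hi
    simp only [Finset.mem_filter, Finset.mem_range] at hi ⊢
    obtain ⟨hi, hYi⟩ := hi
    have hc : Y i < σ := hYi ▸ hX _ (Nat.mod_lt _ hN)
    have hlt := hcode i _ hi hc
    refine ⟨by omega, ?_, ?_⟩
    · rw [Nat.add_mul_mod_self_left, Nat.add_mul_div_left _ _ (by omega),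
        Nat.mod_eq_of_lt (by omega), Nat.div_eq_of_lt (by omega), zero_add]
    · rw [hback _ hlt, hmod _ _ (by omega), hdiv _ _ (by omega), hYi]
  · intro j hj
    simp only [Finset.mem_filter, Finset.mem_range] at hj ⊢
    obtain ⟨hj, h1, h2⟩ := hj
    have hi : j % (2 * N) < N := by
      by_contra hi
      have := hY _ (not_lt.mp hi)
      rw [h1] at this
      have := Nat.div_lt_self (show 0 < j by rcases j with _ | j <;> simp at hi ⊢; omega)
        (show 1 < 2 * N by omega)
      omega
    have hj' : j = j % (2 * N) + 2 * N * (j / (2 * N)) := (Nat.mod_add_div _ _).symm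
    have h3 : (n - (n - (j + d) % n) % n) % n % (2 * N) % N < N := Nat.mod_lt _ hN
    have h4 := hX _ h3
    refine ⟨hi, ?_⟩
    have hjd : j + d < n := by
      have hc : j / (2 * N) < σ := by
        rw [← h1]
        refine (hY' _).resolve_right fun h => ?_
        rw [h1] at h
        exact absurd h (not_le.mpr (lt_of_le_of_lt (Nat.div_le_self _ _) hj))
      have := hcode _ _ hi hc
      omega
    rw [hback _ hjd, hj', hmod _ _ (by omega), hdiv _ _ (by omega)] at h2
    rw [h1, ← h2]
  · intro i hi
    simp only [Finset.mem_filter, Finset.mem_range] at hi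
    exact (Nat.add_mul_mod_self_left _ _ _).trans (Nat.mod_eq_of_lt (by omega))
  · intro j hj
    simp only [Finset.mem_filter, Finset.mem_range] at hj
    exact (congrArg (fun y => j % (2 * N) + 2 * N * y) hj.2.1).trans (Nat.mod_add_div _ _)

end

end FixedFFT

/-! ### Rules for loop-free programs and counting loops. -/

namespace WordRAM

/-- Total correctness of a program without loops. -/
def LinSpec (w : ℕ) (c : Cmd) (s : Core) (P : Core → Prop) : Prop := Spec w c s c.size P

namespace LinSpec
variable {w : ℕ} {c d : Cmd} {s : Core} {P Q : Core → Prop}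

theorem mono (h : LinSpec w c s P) (hP : ∀ s', P s' → Q s') : LinSpec w c s Q :=
  Spec.mono h le_rfl hP

theorem skip (h : P s) : LinSpec w .skip s P := Spec.skip h

theorem assign {r : ℕ} {e : Expr} (he : e.Safe w s) (h : P (s.set r (e.eval s))) :
    LinSpec w (.assign r e) s P := Spec.assign he h

theorem store {a v : Expr} (ha : a.Safe w s) (hv : v.Safe w s) (hw : InWord w (a.eval s))
    (h : P (s.write (a.eval s) (v.eval s))) : LinSpec w (.store a v) s P :=
  Spec.store ha hv hw h

theorem seq (h : LinSpec w c s Q) (h' : ∀ s', Q s' → LinSpec w d s' P) :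
    LinSpec w (.seq c d) s P := Spec.seq h h'

theorem seq_assign {r : ℕ} {e : Expr} (he : e.Safe w s)
    (h : LinSpec w d (s.set r (e.eval s)) P) : LinSpec w (.seq (.assign r e) d) s P :=
  Spec.seq_assign he h

theorem seq_store {a v : Expr} (ha : a.Safe w s) (hv : v.Safe w s) (hw : InWord w (a.eval s))
    (h : LinSpec w d (s.write (a.eval s) (v.eval s)) P) : LinSpec w (.seq (.store a v) d) s P :=
  Spec.seq_store ha hv hw h

theorem ite {t : Test} {a b : Expr} (hs : TestSafe w s a b)
    (hc : t.Holds (a.eval s) (b.eval s) → LinSpec w c s P)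
    (hd : ¬ t.Holds (a.eval s) (b.eval s) → LinSpec w d s P) :
    LinSpec w (.ite t a b c d) s P := Spec.ite hs hc hd

end LinSpec

theorem Expr.eval_set_of_bound {e : Expr} {r : ℕ} (h : e.bound ≤ r) (s : Core) (v : ℤ) :
    e.eval (s.set r v) = e.eval s := by
  induction e with
  | lit n => rfl
  | var n => simp only [bound] at h; simp [eval, show n ≠ r by omega]
  | bin op a b iha ihb =>
    simp only [bound, max_le_iff] at h
    simp [eval, iha h.1, ihb h.2]
  | load a iha => simp [eval, iha h]

theorem Expr.safe_set_of_bound {e : Expr} {r : ℕ} (h : e.bound ≤ r) (w : ℕ) (s : Core) (v : ℤ) :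
    e.Safe w (s.set r v) ↔ e.Safe w s := by
  induction e with
  | lit n => rfl
  | var n => rfl
  | bin op a b iha ihb =>
    simp only [bound, max_le_iff] at h
    simp [Safe, iha h.1, ihb h.2, eval_set_of_bound h.1, eval_set_of_bound h.2]
  | load a iha => simp [Safe, iha h, eval_set_of_bound (show a.bound ≤ r from h)]

infixr:60 " ;; " => Cmd.seq

/-- `for i := 0 to b - 1 do c`. -/
def Cmd.for (i : ℕ) (b : Expr) (c : Cmd) : Cmd :=
  .assign i 0 ;; .while .lt (.var i) b (c ;; .assign i (.var i + 1))

/-- The invariant determines the counter, and the body has to restore it before the increment. The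
bound on `M` keeps counter and limit comparable as words, including the final value `M`. -/
theorem Spec.for {w T : ℕ} {s : Core} {i : ℕ} {b : Expr} {c : Cmd} (Inv : ℕ → Core → Prop) (M : ℕ)
    (hM : (M : ℤ) < 2 ^ w) (h0 : Inv 0 (s.set i 0))
    (hb : ∀ j ≤ M, ∀ s, Inv j s → s.reg i = j ∧ b.Safe w s ∧ b.eval s = M)
    (hc : ∀ j < M, ∀ s, Inv j s →
      Spec w c s T fun s' => s'.reg i = j ∧ Inv (j + 1) (s'.set i ((j + 1 : ℕ) : ℤ))) :
    Spec w (.for i b c) s (2 + (M + 1) * (b.size + T + 7)) (Inv M) := by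
  refine seq_assign (by simp) (mono (while_count (T := T + 4) Inv M h0 ?_ ?_ ?_) ?_ fun _ h => h)
  · intro j hj s hs
    obtain ⟨h1, h2, h3⟩ := hb j hj s hs
    refine ⟨by simp, h2, ?_, ?_⟩
    · rw [Expr.eval_var, h1]
      exact ⟨by positivity, lt_of_le_of_lt (by exact_mod_cast hj) hM⟩
    · rw [h3]; exact ⟨by positivity, hM⟩
  · intro j hj s hs
    obtain ⟨h1, h2, h3⟩ := hb j hj s hs
    rw [Test.holds_lt, Expr.eval_var, h1, h3, Nat.cast_lt]
  · intro j hj s hs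
    refine seq (hc j hj s hs) fun s' hs' => mono (assign (by simp) ?_) le_rfl fun _ h => h
    rw [Expr.eval_add, Expr.eval_var, hs'.1, Expr.eval_one]
    exact_mod_cast hs'.2
  · exact Nat.mul_le_mul_left _ (by simp only [Expr.size]; omega)

end WordRAM

/-! ### Machine programs for integer square roots and fixed point transforms. -/

namespace ShiftDistance
open WordRAM FixedFFT

/- The registers of the algorithm. -/
local notation "rN" => (0 : ℕ)
local notation "rn" => (3 : ℕ)
local notation "rm" => (4 : ℕ)
local notation "rS" => (5 : ℕ)
local notation "rQ" => (6 : ℕ)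
local notation "rRe" => (7 : ℕ)
local notation "rIm" => (8 : ℕ)
local notation "rCos" => (9 : ℕ)
local notation "rSin" => (10 : ℕ)
local notation "rCode" => (15 : ℕ)
local notation "rBest" => (16 : ℕ)
local notation "rArg" => (17 : ℕ)
local notation "rSrc" => (20 : ℕ)
local notation "rH" => (21 : ℕ)
local notation "rLevel" => (22 : ℕ)
local notation "rI" => (30 : ℕ)
local notation "V" => Expr.var

/-- One step of the bisection for the integer square root. -/
def sqrtBody : Cmd :=
  .assign 33 (V 33 / 2) ;;
  .ite .lt (V 32) ((V 31 + V 33) * (V 31 + V 33)) .skip (.assign 31 (V 31 + V 33))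

/-- The integer square root of `v` is stored in register `31`. -/
def sqrtCmd (v : Expr) : Cmd :=
  .assign 32 v ;; .assign 31 0 ;; .assign 33 (4 * V rS) ;; .while .lt 1 (V 33) sqrtBody

theorem intSqrt_eq {v x : ℤ} (hx : 0 ≤ x) (h1 : x * x ≤ v) (h2 : v < (x + 1) * (x + 1)) :
    Int.sqrt v = x := by
  obtain ⟨a, rfl⟩ := Int.eq_ofNat_of_zero_le hx
  obtain ⟨b, rfl⟩ := Int.eq_ofNat_of_zero_le (h1.trans' (by positivity))
  rw [Int.sqrt, Int.toNat_natCast, Nat.cast_inj]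
  symm
  rw [Nat.eq_sqrt]
  exact ⟨by exact_mod_cast h1, by exact_mod_cast h2⟩

/-- Bisection keeps `r ^ 2 ≤ v < (r + h) ^ 2`, where `r` is register `31` and the step `h` is halved
in each round. Since `r + h ≤ 2 ^ q`, the square that is compared with `v` is a word. -/
theorem sqrtBody_spec {w q j : ℕ} (hj : j < q) {s : Core} {v : ℤ}
    (hv : InWord w v) (hq : (2 : ℤ) ^ (2 * q + 2) < 2 ^ w)
    (h1 : s.reg 32 = v) (h2 : s.reg 33 = 2 ^ (q - j)) (h3 : 0 ≤ s.reg 31)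
    (h3' : s.reg 31 + 2 ^ (q - j) ≤ 2 ^ q)
    (h4 : s.reg 31 * s.reg 31 ≤ v) (h5 : v < (s.reg 31 + 2 ^ (q - j)) * (s.reg 31 + 2 ^ (q - j))) :
    LinSpec w sqrtBody s fun s' => s'.reg 32 = v ∧ s'.reg 33 = 2 ^ (q - (j + 1)) ∧
      0 ≤ s'.reg 31 ∧ s'.reg 31 + 2 ^ (q - (j + 1)) ≤ 2 ^ q ∧ s'.reg 31 * s'.reg 31 ≤ v ∧
      v < (s'.reg 31 + 2 ^ (q - (j + 1))) * (s'.reg 31 + 2 ^ (q - (j + 1))) ∧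
      s'.mem = s.mem ∧ ∀ r < 31, s'.reg r = s.reg r := by
  have e1 : (2 : ℤ) ^ (q - j) = 2 * 2 ^ (q - (j + 1)) := by
    rw [← pow_succ', show q - (j + 1) + 1 = q - j by omega]
  have e2 : (2 : ℤ) ^ (q - (j + 1)) > 0 := by positivity
  have e4 : (2 : ℤ) ^ (2 * q + 2) = 4 * (2 ^ q * 2 ^ q) := by ring
  have e5 : (1 : ℤ) ≤ 2 ^ q := one_le_pow₀ (by norm_num)
  have e6 : (2 : ℤ) ^ q ≤ 2 ^ q * 2 ^ q := le_mul_of_one_le_left (by positivity) e5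
  have e3 : (2 * 2 ^ (q - (j + 1)) : ℤ) / 2 = 2 ^ (q - (j + 1)) := by omega
  rw [e1] at h2 h3' h5
  set st : ℤ := 2 ^ (q - (j + 1)) with hst
  refine LinSpec.seq_assign ?_ (LinSpec.ite ?_ ?_ ?_)
  · simp only [Expr.safe_div, Expr.safe_var, Expr.safe_two, Expr.eval_var, h2, Expr.eval_two,
      true_and]
    exact ⟨⟨by omega, by omega⟩, ⟨by norm_num, by omega⟩⟩
  · refine ⟨by simp, by simp, ?_, ?_⟩
    · simpa [h1] using hv
    · simp only [Expr.eval_mul, Expr.eval_add, Expr.eval_var, Core.set_reg, Expr.eval_div, h2,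
        Expr.eval_two, e3]
      norm_num
      refine ⟨mul_self_nonneg _, ?_⟩
      have : (s.reg 31 + st) * (s.reg 31 + st) ≤ 2 ^ q * 2 ^ q :=
        mul_le_mul (by omega) (by omega) (by omega) (by positivity)
      omega
  · intro ht
    simp [h1, h2, e3] at ht
    refine LinSpec.skip ?_
    simp [h1, h2, e3]
    refine ⟨h3, by omega, h4, ht, fun r hr h => by omega⟩
  · intro ht
    simp [h1, h2, e3] at ht
    refine LinSpec.assign (by simp) ?_
    simp [h1, h2, e3]
    refine ⟨by omega, by omega, ht, ?_, fun r hr => ?_⟩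
    · rw [add_assoc, ← two_mul]; exact h5
    · rw [if_neg (by omega), if_neg (by omega)]

/-- The initial step `4 * S = 2 ^ (20 * m + 2)` suffices because `v ≤ 4 * S ^ 2 < (4 * S) ^ 2`. So
there are `O(m)` rounds. -/
theorem sqrtCmd_spec {w m : ℕ} {s : Core} {v : Expr} (hv : v.Safe w s)
    (hw : 64 * (((2 : ℤ) ^ m) ^ 20 * (2 ^ m) ^ 20) < 2 ^ w) (hS : s.reg rS = (2 ^ m) ^ 20)
    (h0 : 0 ≤ v.eval s) (h1 : v.eval s ≤ 4 * ((2 ^ m) ^ 20 * (2 ^ m) ^ 20)) :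
    Spec w (sqrtCmd v) s (v.size + 10 + (20 * m + 3) * (sqrtBody.size + 4)) fun s' =>
      s'.reg 31 = Int.sqrt (v.eval s) ∧ s'.mem = s.mem ∧ ∀ r < 31, s'.reg r = s.reg r := by
  set S : ℤ := (2 ^ m) ^ 20 with hSd
  have hq : (2 : ℤ) ^ (20 * m + 2) = 4 * S := by rw [hSd, ← pow_mul]; ring
  have hS1 : 1 ≤ S := one_le_pow₀ (one_le_pow₀ (by norm_num))
  have hSS : S ≤ S * S := by nlinarith
  refine Spec.mono (T := (v.size + 1) + (2 + (4 + (20 * m + 2 + 1) * (1 + 1 + sqrtBody.size + 2))))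
    (Spec.seq_assign hv (Spec.seq_assign (by simp) (Spec.seq_assign (by simp)
      (Spec.while_count (fun j s' => s'.reg 32 = v.eval s ∧ s'.reg 33 = 2 ^ (20 * m + 2 - j) ∧
      0 ≤ s'.reg 31 ∧ s'.reg 31 + 2 ^ (20 * m + 2 - j) ≤ 2 ^ (20 * m + 2) ∧
      s'.reg 31 * s'.reg 31 ≤ v.eval s ∧
      v.eval s < (s'.reg 31 + 2 ^ (20 * m + 2 - j)) * (s'.reg 31 + 2 ^ (20 * m + 2 - j)) ∧
      s'.mem = s.mem ∧ ∀ r < 31, s'.reg r = s.reg r) (20 * m + 2) ?_ ?_ ?_ ?_))))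
      (by ring_nf; omega) ?_
  · simp [hS, hq]
    refine ⟨h0, by nlinarith, fun r hr => ?_⟩
    rw [if_neg (by omega), if_neg (by omega), if_neg (by omega)]
  · rintro j hj s' ⟨-, h33, -⟩
    have : (2 : ℤ) ^ (20 * m + 2 - j) ≤ 2 ^ (20 * m + 2) :=
      pow_le_pow_right₀ (by norm_num) (by omega)
    refine ⟨by simp, by simp, ⟨by simp, ?_⟩, ?_⟩
    · rw [Expr.eval_one]; omega
    · rw [Expr.eval_var, h33]
      exact ⟨by positivity, by omega⟩
  · rintro j hj s' ⟨-, h33, -⟩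
    rw [Test.holds_lt, Expr.eval_one, Expr.eval_var, h33]
    rcases hj.eq_or_lt with rfl | hj
    · simp
    · simp only [hj, iff_true]
      exact one_lt_pow₀ (by norm_num) (by omega)
  · rintro j hj s' ⟨i1, i2, i3, i4, i5, i6, i7, i8⟩
    refine Spec.mono (sqrtBody_spec hj (v := v.eval s) ⟨h0, by omega⟩ ?_ i1 i2 i3 i4 i5 i6)
      le_rfl ?_
    · calc (2 : ℤ) ^ (2 * (20 * m + 2) + 2) = 4 * (2 ^ (20 * m + 2) * 2 ^ (20 * m + 2)) := by ring
        _ = 64 * (S * S) := by rw [hq]; ring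
        _ < _ := hw
    · rintro s'' ⟨j1, j2, j3, j4, j5, j6, j7, j8⟩
      exact ⟨j1, j2, j3, j4, j5, j6, j7.trans i7, fun r hr => (j8 r hr).trans (i8 r hr)⟩
  · rintro s' ⟨-, -, j3, -, j5, j6, j7, j8⟩
    rw [Nat.sub_self, pow_zero] at j6
    exact ⟨(intSqrt_eq j3 j5 j6).symm, j7, j8⟩

/-- The quotient by the scale, rounded down. -/
def fdiv (e : Expr) : Expr := (e + V rS * V rQ) / V rS - V rQ

def mulRe (xr xi yr yi : Expr) : Expr := fdiv (xr * yr - xi * yi)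

def mulIm (xr xi yr yi : Expr) : Expr := fdiv (xr * yi + xi * yr)

/-- Entry `x` of the array of complex numbers. -/
def loadRe (x : Expr) : Expr := .load (V rRe + x)

def loadIm (x : Expr) : Expr := .load (V rIm + x)

/-- Store a complex number in entry `x` of the array. -/
def storeC (x re im : Expr) : Cmd :=
  .assign 42 x ;; .assign 40 re ;; .assign 41 im ;;
  .store (V rRe + V 42) (V 40) ;; .store (V rIm + V 42) (V 41)

/-- Entry `x` of an array of complex numbers of length `D`, whose real parts are stored from `P`
on, and whose imaginary parts are stored from `P + D` on. -/
def view (P D : ℕ) (s : Core) (x : ℕ) : ℤ × ℤ := (s.mem (P + x), s.mem (P + D + x))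

/-- The sizes involved fit into the words. -/
structure Fits (w n P D : ℕ) (S Q B : ℤ) : Prop where
  S_pos : 0 < S
  S_lt : S < 2 ^ w
  SQ_lt : 2 * (S * Q) < 2 ^ w
  B_sq : 2 * (B * B) ≤ S * Q
  PD_le : (P : ℤ) + 2 * D ≤ 2 ^ w
  n_lt : 2 * (n : ℤ) < 2 ^ w

/-- The registers that hold the parameters of the transform. -/
structure Layout (n P D : ℕ) (S Q : ℤ) (s : Core) : Prop where
  n : s.reg rn = n
  S : s.reg rS = S
  Q : s.reg rQ = Q
  re : s.reg rRe = P
  im : s.reg rIm = P + D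

theorem Layout.congr {n P D : ℕ} {S Q : ℤ} {s s' : Core} (h : Layout n P D S Q s)
    (h' : ∀ r < 9, s'.reg r = s.reg r) : Layout n P D S Q s' where
  n := by rw [h' _ (by norm_num), h.n]
  S := by rw [h' _ (by norm_num), h.S]
  Q := by rw [h' _ (by norm_num), h.Q]
  re := by rw [h' _ (by norm_num), h.re]
  im := by rw [h' _ (by norm_num), h.im]

section
variable {w n P D : ℕ} {S Q B : ℤ} {s : Core}

/-- Machine division is unsigned, but real and imaginary parts can be negative. Adding the multiple
`S * Q` of the divisor makes the dividend nonnegative, and subtracting `Q` afterwards restores the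
floor. -/
theorem eval_fdiv (hf : Fits w n P D S Q B) (hl : Layout n P D S Q s) (e : Expr) :
    (fdiv e).eval s = e.eval s / S := by
  simp only [fdiv, Expr.eval_sub, Expr.eval_div, Expr.eval_add, Expr.eval_mul, Expr.eval_var, hl.S,
    hl.Q]
  rw [Int.add_mul_ediv_left _ _ hf.S_pos.ne']
  ring

theorem safe_fdiv (hf : Fits w n P D S Q B) (hl : Layout n P D S Q s) {e : Expr}
    (he : e.Safe w s) (hb : |e.eval s| ≤ S * Q) : (fdiv e).Safe w s := by
  obtain ⟨h1, h2⟩ := abs_le.mp hb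
  have := hf.S_pos
  have := hf.S_lt
  have := hf.SQ_lt
  simp only [fdiv, Expr.safe_sub, Expr.safe_div, Expr.safe_add, Expr.safe_mul, Expr.safe_var,
    Expr.eval_add, Expr.eval_mul, Expr.eval_var, hl.S, hl.Q, and_true, true_and]
  exact ⟨he, ⟨by linarith, by linarith⟩, ⟨by linarith, by linarith⟩⟩

/-- `e` is a safe expression with the value `z`. -/
def Evals (w : ℕ) (s : Core) (e : Expr) (z : ℤ) : Prop := e.Safe w s ∧ e.eval s = z

theorem abs_mul_sub_le {a b c d : ℤ} (ha : |a| ≤ B) (hb : |b| ≤ B) (hc : |c| ≤ B) (hd : |d| ≤ B) :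
    |a * b - c * d| ≤ 2 * (B * B) := by
  have h0 : 0 ≤ B := (abs_nonneg a).trans ha
  refine (abs_sub _ _).trans ?_
  rw [abs_mul, abs_mul, two_mul]
  gcongr

theorem evals_mul (hf : Fits w n P D S Q B) (hl : Layout n P D S Q s) {xr xi yr yi : Expr}
    {x y : ℤ × ℤ} (h1 : Evals w s xr x.1) (h2 : Evals w s xi x.2) (h3 : Evals w s yr y.1)
    (h4 : Evals w s yi y.2) (hx : |x.1| ≤ B ∧ |x.2| ≤ B) (hy : |y.1| ≤ B ∧ |y.2| ≤ B) :
    Evals w s (mulRe xr xi yr yi) (cmul S x y).1 ∧ Evals w s (mulIm xr xi yr yi) (cmul S x y).2 := by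
  have hB := hf.B_sq
  refine ⟨⟨safe_fdiv hf hl ?_ ?_, ?_⟩, ⟨safe_fdiv hf hl ?_ ?_, ?_⟩⟩
  · simp [h1.1, h2.1, h3.1, h4.1]
  · simp only [Expr.eval_sub, Expr.eval_mul, h1.2, h2.2, h3.2, h4.2]
    exact (abs_mul_sub_le hx.1 hy.1 hx.2 hy.2).trans hB
  · rw [mulRe, eval_fdiv hf hl]
    simp only [Expr.eval_sub, Expr.eval_mul, h1.2, h2.2, h3.2, h4.2, cmul]
  · simp [h1.1, h2.1, h3.1, h4.1]
  · simp only [Expr.eval_add, Expr.eval_mul, h1.2, h2.2, h3.2, h4.2]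
    have := abs_mul_sub_le hx.1 hy.2 (show |-x.2| ≤ B by rw [abs_neg]; exact hx.2) hy.1
    rw [neg_mul, sub_neg_eq_add] at this
    exact this.trans hB
  · rw [mulIm, eval_fdiv hf hl]
    simp only [Expr.eval_add, Expr.eval_mul, h1.2, h2.2, h3.2, h4.2, cmul]

theorem evals_load (hf : Fits w n P D S Q B) (hl : Layout n P D S Q s) {e : Expr} {x : ℕ}
    (h : Evals w s e x) (hx : x < D) :
    Evals w s (loadRe e) (view P D s x).1 ∧ Evals w s (loadIm e) (view P D s x).2 := by
  have := hf.PD_le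
  simp only [Evals, loadRe, loadIm, Expr.safe_load, Expr.safe_add, Expr.safe_var, Expr.eval_load,
    Expr.eval_add, Expr.eval_var, h.1, h.2, hl.re, hl.im, InWord, view, true_and, and_true]
  refine ⟨⟨by positivity, ?_⟩, ⟨by positivity, ?_⟩⟩ <;> omega

/-- Index and both values are saved in registers `40` to `42` before anything is written. The bounds
on `re` and `im` ensure that these assignments do not affect the expressions still to be evaluated.
-/
theorem storeC_spec (hf : Fits w n P D S Q B) (hl : Layout n P D S Q s) {x re im : Expr}
    {X : ℕ} {v : ℤ × ℤ} (hx : Evals w s x X) (hX : X < D) (hre : Evals w s re v.1)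
    (him : Evals w s im v.2) (hre' : re.bound ≤ 40) (him' : im.bound ≤ 40) :
    LinSpec w (storeC x re im) s fun s' => (∀ r < 40, s'.reg r = s.reg r) ∧
      view P D s' X = v ∧ (∀ a : ℤ, a < P → s'.mem a = s.mem a) ∧
      ∀ y < D, y ≠ X → view P D s' y = view P D s y := by
  have h1 := hf.PD_le
  have er1 : re.eval (s.set 42 (x.eval s)) = re.eval s := Expr.eval_set_of_bound (by omega) _ _
  have ei1 : im.eval ((s.set 42 (x.eval s)).set 40 (re.eval s)) = im.eval s := by
    rw [Expr.eval_set_of_bound him', Expr.eval_set_of_bound (by omega)]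
  refine LinSpec.seq_assign hx.1 (LinSpec.seq_assign ?_ (LinSpec.seq_assign ?_
    (LinSpec.seq_store (by simp) (by simp) ?_ (LinSpec.store (by simp) (by simp) ?_ ?_))))
  · rw [Expr.safe_set_of_bound (by omega)]; exact hre.1
  · rw [Expr.safe_set_of_bound (by omega), Expr.safe_set_of_bound (by omega)]; exact him.1
  · simp [hl.re, hx.2, InWord]
    exact ⟨by positivity, by omega⟩
  · simp [hl.im, hx.2, InWord]
    exact ⟨by positivity, by omega⟩
  · rw [er1, ei1, hre.2, him.2]
    simp [hl.re, hl.im, hx.2, view, Core.write_mem]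
    refine ⟨fun r hr => ?_, ?_, fun a ha => ?_, fun y hy hyX => ⟨?_, ?_⟩⟩
    · rw [if_neg (by omega), if_neg (by omega), if_neg (by omega)]
    · rw [if_neg (by omega)]
    · rw [if_neg (by omega), if_neg (by omega)]
    · rw [if_neg (by omega), if_neg (by omega)]
    · rw [if_neg (by omega), if_neg (by omega)]

/-- The state `s` arises from `s₀` by filling `j` entries of the array from `X₀` on with the
values of `F`. Registers from `L` on may have changed. -/
structure Filled (L P D : ℕ) (s₀ s : Core) (X₀ j : ℕ) (F : ℕ → ℤ × ℤ) : Prop where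
  reg : ∀ r < L, s.reg r = s₀.reg r
  low : ∀ a : ℤ, a < P → s.mem a = s₀.mem a
  old : ∀ y < X₀, view P D s y = view P D s₀ y
  new : ∀ i < j, view P D s (X₀ + i) = F i

/-- The common rule for all loops that fill a block of the array in order. The body may rely on the
old entries below `X₀` and on the new entries written so far; the latter is needed only for the
recursive table of powers. -/
theorem fill_spec {c : Cmd} {s₀ : Core} {X₀ : ℕ} {F : ℕ → ℤ × ℤ} (hf : Fits w n P D S Q B)
    (hl : Layout n P D S Q s₀) (hX : X₀ + n ≤ D)
    (hc : ∀ j < n, ∀ s, Filled 30 P D s₀ s X₀ j F → s.reg rI = j →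
      LinSpec w c s fun s' => (∀ r < 31, s'.reg r = s.reg r) ∧
        view P D s' (X₀ + j) = F j ∧ (∀ a : ℤ, a < P → s'.mem a = s.mem a) ∧
        ∀ y < D, y ≠ X₀ + j → view P D s' y = view P D s y) :
    Spec w (.for rI (V rn) c) s₀ (2 + (n + 1) * (c.size + 8))
      fun s' => Filled 30 P D s₀ s' X₀ n F := by
  have hn := hf.n_lt
  refine Spec.mono (Spec.for (T := c.size)
    (fun j s => Filled 30 P D s₀ s X₀ j F ∧ s.reg rI = j) n (by omega) ?_ ?_ ?_)
    (by simp only [Expr.size]; ring_nf; omega) fun s hs => hs.1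
  · refine ⟨⟨fun r hr => ?_, fun _ _ => rfl, fun _ _ => rfl, fun i hi => by omega⟩, by simp⟩
    simp [show r ≠ 30 by omega]
  · rintro j hj s ⟨hs, hs'⟩
    exact ⟨hs', by simp, by simp [hs.reg 3, hl.n]⟩
  · rintro j hj s ⟨hs, hs'⟩
    refine (hc j hj s hs hs').mono fun s' ⟨h1, h2, h3, h4⟩ => ⟨by rw [h1 _ (by norm_num), hs'], ?_⟩
    refine ⟨⟨fun r hr => ?_, fun a ha => ?_, fun y hy => ?_, fun i hi => ?_⟩, by simp⟩
    · simp [show r ≠ 30 by omega, h1 r (by omega), hs.reg r hr]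
    · rw [Core.set_mem, h3 a ha, hs.low a ha]
    · exact (h4 y (by omega) (by omega)).trans (hs.old y hy)
    · rcases Nat.lt_succ_iff_lt_or_eq.mp hi with hi | rfl
      · exact (h4 _ (by omega) (by omega)).trans (hs.new i hi)
      · exact h2

/-- Extend the table of the powers of the root of unity. -/
def powBody : Cmd :=
  storeC (V rI + 1) (mulRe (loadRe (V rI)) (loadIm (V rI)) (V rCos) (V rSin))
    (mulIm (loadRe (V rI)) (loadIm (V rI)) (V rCos) (V rSin))

theorem pow_spec {s₀ : Core} {W : ℕ → ℤ × ℤ} {z : ℤ × ℤ} (hf : Fits w n P D S Q B)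
    (hl : Layout n P D S Q s₀) (hD : n + 1 ≤ D) (hz : s₀.reg rCos = z.1 ∧ s₀.reg rSin = z.2)
    (hzB : |z.1| ≤ B ∧ |z.2| ≤ B) (h0 : view P D s₀ 0 = W 0)
    (hW : ∀ j < n, W (j + 1) = cmul S (W j) z) (hB : ∀ j < n, |(W j).1| ≤ B ∧ |(W j).2| ≤ B) :
    Spec w (.for rI (V rn) powBody) s₀ (2 + (n + 1) * (powBody.size + 8))
      fun s' => Filled 30 P D s₀ s' 1 n fun j => W (j + 1) := by
  refine fill_spec hf hl (by omega) fun j hj s hs hsI => ?_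
  have hl' := hl.congr fun r hr => hs.reg r (by omega)
  have hI : Evals w s (V rI) j := ⟨by simp, hsI⟩
  have hv : view P D s j = W j := by
    rcases j with _ | j
    · rw [hs.old 0 one_pos, h0]
    · rw [add_comm, hs.new j (by omega), add_comm 1 j]
  obtain ⟨a1, a2⟩ := evals_load hf hl' hI (by omega)
  rw [hv] at a1 a2
  have a3 : Evals w s (V rCos) z.1 := ⟨by simp, (hs.reg _ (by norm_num)).trans hz.1⟩
  have a4 : Evals w s (V rSin) z.2 := ⟨by simp, (hs.reg _ (by norm_num)).trans hz.2⟩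
  obtain ⟨b1, b2⟩ := evals_mul hf hl' a1 a2 a3 a4 (hB j hj) hzB
  rw [← hW j hj] at b1 b2
  refine (storeC_spec hf hl' (X := 1 + j) ⟨by simp, ?_⟩ (by omega) b1 b2 (by decide)
    (by decide)).mono fun s' hs' => ⟨fun r hr => hs'.1 r (by omega), hs'.2⟩
  simp [hsI, add_comm]

/-- Compute an entry of the next level of the transform. -/
def fftBody : Cmd :=
  .assign 31 (V rI % V rH) ;; .assign 32 (V rI - V 31) ;;
  .assign 33 (V rSrc + (2 * V 32) % V rn + V 31) ;;
  storeC (V rSrc + V rn + V rI)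
    (loadRe (V 33) + mulRe (loadRe (V 32)) (loadIm (V 32)) (loadRe (V 33 + V rH)) (loadIm (V 33 + V rH)))
    (loadIm (V 33) + mulIm (loadRe (V 32)) (loadIm (V 32)) (loadRe (V 33 + V rH)) (loadIm (V 33 + V rH)))

/-- A level is written directly behind the one it is computed from, so every read falls into the
part below `x₀ + n`, which the loop leaves unchanged. -/
theorem fftBody_spec {s₀ : Core} {W A : ℕ → ℤ × ℤ} {K h x₀ : ℕ} (hf : Fits w n P D S Q B)
    (hl : Layout n P D S Q s₀) (hh : 0 < h) (hK : 0 < K) (hn : n = K * (2 * h))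
    (hD : x₀ + 2 * n ≤ D) (hsrc : s₀.reg rSrc = x₀) (hrh : s₀.reg rH = h)
    (hW : ∀ j < n, view P D s₀ j = W j) (hWB : ∀ j < n, |(W j).1| ≤ B ∧ |(W j).2| ≤ B)
    (hA : ∀ j < n, view P D s₀ (x₀ + j) = A j) (hAB : ∀ j < n, |(A j).1| ≤ B ∧ |(A j).2| ≤ B) :
    Spec w (.for rI (V rn) fftBody) s₀ (2 + (n + 1) * (fftBody.size + 8))
      fun s' => Filled 30 P D s₀ s' (x₀ + n) n (fftStep (cmul S) W n h A) := by
  refine fill_spec hf hl (by omega) fun j hj s hs hsI => ?_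
  have hl' := hl.congr fun r hr => hs.reg r (by omega)
  have hnlt := hf.n_lt
  have s21 : s.reg 21 = h := (hs.reg _ (by norm_num)).trans hrh
  have s20 : s.reg 20 = x₀ := (hs.reg _ (by norm_num)).trans hsrc
  have hmod : j % h ≤ j := Nat.mod_le _ _
  obtain ⟨i1, -, -⟩ := step_index (p := j) hh hK
  rw [← hn] at i1
  have hhn : h ≤ n := by rw [hn]; nlinarith
  set q := j - j % h with hq
  set x := 2 * q % n + j % h with hx
  have e1 : (V rI % V rH).eval s = ((j % h : ℕ) : ℤ) := by simp [hsI, s21]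
  have e2 : (j : ℤ) - ((j % h : ℕ) : ℤ) = (q : ℤ) := by rw [hq]; omega
  refine LinSpec.seq_assign ?_ (LinSpec.seq_assign (by simp) (LinSpec.seq_assign ?_ ?_))
  · simp [hsI, s21, InWord]; omega
  · have e3 : (2 : ℤ) * q = ((2 * q : ℕ) : ℤ) := by push_cast; rfl
    simp [hl'.n, hsI, e1, InWord]; omega
  rw [e1]
  have e4 : (V rI - V 31).eval (s.set 31 ((j % h : ℕ) : ℤ)) = (q : ℤ) := by
    simp only [Expr.eval_sub, Expr.eval_var, Core.set_reg]
    norm_num [hsI]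
    rw [← e2]; push_cast; rfl
  rw [e4]
  have e5 : (V rSrc + (2 * V 32) % V rn + V 31).eval
      ((s.set 31 ((j % h : ℕ) : ℤ)).set 32 (q : ℤ)) = ((x₀ + x : ℕ) : ℤ) := by
    simp [s20, hl'.n, hx]; ring
  rw [e5]
  set s3 := ((s.set 31 ((j % h : ℕ) : ℤ)).set 32 (q : ℤ)).set 33 ((x₀ + x : ℕ) : ℤ) with hs3
  have hreg : ∀ r < 31, s3.reg r = s.reg r := by
    intro r hr
    simp [hs3, show r ≠ 31 by omega, show r ≠ 32 by omega, show r ≠ 33 by omega]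
  have hview : ∀ y, view P D s3 y = view P D s y := fun y => rfl
  have hl3 := hl'.congr (s' := s3) fun r hr => hreg r (by omega)
  have a1 : Evals w s3 (V 33) ((x₀ + x : ℕ) : ℤ) := ⟨by simp, by simp [hs3]⟩
  have a2 : Evals w s3 (V 32) (q : ℤ) := ⟨by simp, by simp [hs3]⟩
  have a3 : Evals w s3 (V 33 + V rH) ((x₀ + (x + h) : ℕ) : ℤ) :=
    ⟨by simp, by simp [hs3, s21]; ring⟩
  obtain ⟨b1, b2⟩ := evals_load hf hl3 a1 (by omega)
  obtain ⟨b3, b4⟩ := evals_load hf hl3 a2 (by omega)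
  obtain ⟨b5, b6⟩ := evals_load hf hl3 a3 (by omega)
  have v1 : view P D s3 (x₀ + x) = A x := by
    rw [hview, hs.old _ (by omega), hA _ (by omega)]
  have v2 : view P D s3 q = W q := by
    rw [hview, hs.old _ (by omega), hW _ (by omega)]
  have v3 : view P D s3 (x₀ + (x + h)) = A (x + h) := by
    rw [hview, hs.old _ (by omega), hA _ i1]
  rw [v1] at b1 b2
  rw [v2] at b3 b4
  rw [v3] at b5 b6
  obtain ⟨c1, c2⟩ := evals_mul hf hl3 b3 b4 b5 b6 (hWB _ (by omega)) (hAB _ i1)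
  have d1 : Evals w s3 (V rSrc + V rn + V rI) ((x₀ + n + j : ℕ) : ℤ) := by
    refine ⟨by simp, ?_⟩
    simp [hreg, s20, hl'.n, hsI]
  refine (storeC_spec hf hl3 (v := fftStep (cmul S) W n h A j) d1 (by omega)
    ⟨by simp [b1.1, c1.1], ?_⟩ ⟨by simp [b2.1, c2.1], ?_⟩ (by decide) (by decide)).mono
    fun s' hs' => ⟨fun r hr => (hs'.1 r (by omega)).trans (hreg r hr), hs'.2.1, hs'.2.2.1, hs'.2.2.2⟩
  · rw [Expr.eval_add, b1.2, c1.2]; rfl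
  · rw [Expr.eval_add, b2.2, c2.2]; rfl

/-- Square the entries of a level. -/
def sqBody : Cmd :=
  .assign 33 (V rSrc + V rI) ;;
  storeC (V 33 + V rn)
    (mulRe (loadRe (V 33)) (loadIm (V 33)) (loadRe (V 33)) (loadIm (V 33)))
    (mulIm (loadRe (V 33)) (loadIm (V 33)) (loadRe (V 33)) (loadIm (V 33)))

theorem sqBody_spec {s₀ : Core} {A : ℕ → ℤ × ℤ} {x₀ : ℕ} (hf : Fits w n P D S Q B)
    (hl : Layout n P D S Q s₀) (hD : x₀ + 2 * n ≤ D) (hsrc : s₀.reg rSrc = x₀)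
    (hA : ∀ j < n, view P D s₀ (x₀ + j) = A j) (hAB : ∀ j < n, |(A j).1| ≤ B ∧ |(A j).2| ≤ B) :
    Spec w (.for rI (V rn) sqBody) s₀ (2 + (n + 1) * (sqBody.size + 8))
      fun s' => Filled 30 P D s₀ s' (x₀ + n) n fun p => cmul S (A p) (A p) := by
  refine fill_spec hf hl (by omega) fun j hj s hs hsI => ?_
  have hl' := hl.congr fun r hr => hs.reg r (by omega)
  have s20 : s.reg 20 = x₀ := (hs.reg _ (by norm_num)).trans hsrc
  refine LinSpec.seq_assign (by simp) ?_
  have e1 : (V rSrc + V rI).eval s = ((x₀ + j : ℕ) : ℤ) := by simp [s20, hsI]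
  rw [e1]
  set s3 := s.set 33 ((x₀ + j : ℕ) : ℤ) with hs3
  have hreg : ∀ r < 31, s3.reg r = s.reg r := by
    intro r hr
    simp [hs3, show r ≠ 33 by omega]
  have hl3 := hl'.congr (s' := s3) fun r hr => hreg r (by omega)
  have a1 : Evals w s3 (V 33) ((x₀ + j : ℕ) : ℤ) := ⟨by simp, by simp [hs3]⟩
  obtain ⟨b1, b2⟩ := evals_load hf hl3 a1 (by omega)
  have v1 : view P D s3 (x₀ + j) = A j := by
    rw [← hA _ hj, ← hs.old _ (by omega)]; rfl
  rw [v1] at b1 b2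
  obtain ⟨c1, c2⟩ := evals_mul hf hl3 b1 b2 b1 b2 (hAB _ hj) (hAB _ hj)
  have d1 : Evals w s3 (V 33 + V rn) ((x₀ + n + j : ℕ) : ℤ) := by
    refine ⟨by simp, ?_⟩
    simp [hs3, hl'.n]; ring
  exact (storeC_spec hf hl3 d1 (by omega) c1 c2 (by decide) (by decide)).mono
    fun s' hs' => ⟨fun r hr => (hs'.1 r (by omega)).trans (hreg r hr), hs'.2.1, hs'.2.2.1, hs'.2.2.2⟩

/-- Transform the level that starts at the entry `src`. -/
def fftCmd : Cmd :=
  .assign rH (V rn) ;;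
  .for rLevel (V rm) (.assign rH (V rH / 2) ;; .for rI (V rn) fftBody ;;
    .assign rSrc (V rSrc + V rn))

/-- All levels are kept in consecutive blocks of length `2 ^ m`, with `rSrc` moving from one to the
next. The table of powers and the `m + 1` levels of each of two transforms account for the factor `2
* m + 3` in `arrayLength`. -/
theorem fftCmd_spec {m : ℕ} {s₀ : Core} {W A : ℕ → ℤ × ℤ} {x₀ : ℕ} (hf : Fits w (2 ^ m) P D S Q B)
    (hl : Layout (2 ^ m) P D S Q s₀) (hm : s₀.reg rm = m)
    (hD : x₀ + (m + 1) * 2 ^ m ≤ D) (hsrc : s₀.reg rSrc = x₀)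
    (hW : ∀ j < 2 ^ m, view P D s₀ j = W j)
    (hWB : ∀ j < 2 ^ m, |(W j).1| ≤ B ∧ |(W j).2| ≤ B)
    (hA : ∀ j < 2 ^ m, view P D s₀ (x₀ + j) = A j)
    (hAB : ∀ t ≤ m, ∀ j < 2 ^ m, |(fftLevel (cmul S) W (2 ^ m) A t j).1| ≤ B ∧
      |(fftLevel (cmul S) W (2 ^ m) A t j).2| ≤ B) :
    Spec w fftCmd s₀ (4 + (m + 1) * (18 + (2 ^ m + 1) * (fftBody.size + 8)))
      fun s' => (∀ r < 20, s'.reg r = s₀.reg r) ∧ (∀ a : ℤ, a < P → s'.mem a = s₀.mem a) ∧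
        (∀ y < x₀ + 2 ^ m, view P D s' y = view P D s₀ y) ∧
        s'.reg rSrc = ((x₀ + m * 2 ^ m : ℕ) : ℤ) ∧
        ∀ j < 2 ^ m, view P D s' (x₀ + m * 2 ^ m + j) = fftLevel (cmul S) W (2 ^ m) A m j := by
  have hnlt := hf.n_lt
  push_cast at hnlt
  have hm2 : (m : ℤ) < 2 ^ m := by exact_mod_cast Nat.lt_two_pow_self
  have hpos : (0 : ℤ) < 2 ^ m := by positivity
  refine Spec.mono (Spec.seq_assign (by simp) (Spec.for
    (T := 4 + ((2 + (2 ^ m + 1) * (fftBody.size + 8)) + 4))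
    (fun t s => (∀ r < 20, s.reg r = s₀.reg r) ∧ (∀ a : ℤ, a < P → s.mem a = s₀.mem a) ∧
      (∀ y < x₀ + 2 ^ m, view P D s y = view P D s₀ y) ∧
      s.reg rSrc = ((x₀ + t * 2 ^ m : ℕ) : ℤ) ∧ s.reg rLevel = t ∧
      s.reg rH = ((2 ^ (m - t) : ℕ) : ℤ) ∧
      ∀ j < 2 ^ m, view P D s (x₀ + t * 2 ^ m + j) = fftLevel (cmul S) W (2 ^ m) A t j) m
    (by omega) ?_ ?_ ?_)) ?_ ?_
  · refine ⟨fun r hr => ?_, fun _ _ => rfl, fun _ _ => rfl, ?_, ?_, ?_, fun j hj => ?_⟩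
    · simp [show r ≠ 22 by omega, show r ≠ 21 by omega]
    · simp [hsrc]
    · simp
    · simp [hl.n]
    · rw [zero_mul, add_zero]; exact hA j hj
  · rintro t ht s ⟨h1, -, -, -, h5, -⟩
    exact ⟨h5, by simp, by simp [h1, hm]⟩
  · rintro t ht s ⟨h1, h2, h3, h4, h5, h6, h7⟩
    have hh : (2 : ℕ) ^ (m - t) = 2 * 2 ^ (m - (t + 1)) := by
      rw [← pow_succ', show m - (t + 1) + 1 = m - t by omega]
    have hle : (2 : ℕ) ^ (m - t) ≤ 2 ^ m := Nat.pow_le_pow_right (by norm_num) (by omega)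
    have hn : (2 : ℕ) ^ m = 2 ^ t * (2 * 2 ^ (m - (t + 1))) := by
      rw [← hh, ← pow_add, show t + (m - t) = m by omega]
    have hle2 : (t + 2) * 2 ^ m ≤ (m + 1) * 2 ^ m := Nat.mul_le_mul_right _ (by omega)
    have hsm : (t + 2) * 2 ^ m = t * 2 ^ m + 2 * 2 ^ m := by ring
    have hsm1 : (t + 1) * 2 ^ m = t * 2 ^ m + 2 ^ m := by ring
    have e1 : (V rH / 2).eval s = ((2 ^ (m - (t + 1)) : ℕ) : ℤ) := by
      simp only [Expr.eval_div, Expr.eval_var, Expr.eval_two, h6, hh]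
      push_cast
      exact Int.mul_ediv_cancel_left _ (by norm_num)
    refine Spec.seq_assign ?_ (Spec.seq (Q := fun s' => Filled 30 P D
      (s.set rH ((2 ^ (m - (t + 1)) : ℕ) : ℤ)) s' (x₀ + t * 2 ^ m + 2 ^ m) (2 ^ m)
      (fftLevel (cmul S) W (2 ^ m) A (t + 1))) ?_ ?_)
    · simp only [Expr.safe_div, Expr.safe_var, Expr.safe_two, true_and, Expr.eval_var, h6,
        Expr.eval_two, InWord]
      have : (((2 : ℕ) ^ (m - t) : ℕ) : ℤ) ≤ ((2 ^ m : ℕ) : ℤ) := by exact_mod_cast hle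
      push_cast at this
      refine ⟨⟨by positivity, ?_⟩, by norm_num, ?_⟩
      · push_cast; omega
      · omega
    · rw [e1]
      have hs1 : ∀ r < 21, (s.set rH ((2 ^ (m - (t + 1)) : ℕ) : ℤ)).reg r = s.reg r := by
        intro r hr; simp [show r ≠ 21 by omega]
      refine Spec.mono (fftBody_spec hf (hl.congr (s' := s.set rH ((2 ^ (m - (t + 1)) : ℕ) : ℤ))
        fun r hr => (hs1 r (by omega)).trans (h1 r (by omega))) (K := 2 ^ t)
        (h := 2 ^ (m - (t + 1))) (x₀ := x₀ + t * 2 ^ m) (W := W)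
        (A := fftLevel (cmul S) W (2 ^ m) A t) (by positivity) (by positivity) hn
        (by omega) ?_ ?_ ?_ hWB h7 (hAB t ht.le)) le_rfl ?_
      · rw [hs1 _ (by norm_num), h4]
      · simp
      · intro j hj
        exact (h3 j (by omega)).trans (hW j hj)
      · intro s' hs'
        rw [fftLevel, Nat.pow_div ht (by norm_num)]
        exact hs'
    · intro s' hs'
      have r1 : ∀ r < 30, r ≠ 21 → s'.reg r = s.reg r := by
        intro r hr hr'
        rw [hs'.reg r hr]; simp [hr']
      refine Spec.assign (by simp) ⟨?_, ⟨fun r hr => ?_, fun a ha => ?_, fun y hy => ?_, ?_, ?_, ?_,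
        fun j hj => ?_⟩⟩
      · simp [r1, h5]
      · simp [show r ≠ 22 by omega, show r ≠ 20 by omega, r1 r (by omega) (by omega), h1 r hr]
      · exact (hs'.low a ha).trans (h2 a ha)
      · exact (hs'.old y (by omega)).trans (h3 y hy)
      · simp [r1, h4, h1, hl.n]; ring
      · simp
      · have := hs'.reg 21 (by norm_num)
        simpa using this
      · rw [← hs'.new j hj, hsm1, ← add_assoc]; rfl
  · simp only [Cmd.size, Expr.size]
    have : (m + 1) * (1 + (4 + (2 + (2 ^ m + 1) * (fftBody.size + 8) + 4)) + 7) =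
      (m + 1) * (18 + (2 ^ m + 1) * (fftBody.size + 8)) := by ring
    omega
  · rintro s' ⟨h1, h2, h3, h4, -, -, h7⟩
    exact ⟨h1, h2, h3, h4, h7⟩

end

/-! ### Common characters of shifted strings and the input of the transform. -/

/-- The memory contains the strings `x 0, …, x (k - 1)` of length `N`. -/
def Holds (k N : ℕ) (x : ℕ → ℕ → ℕ) (s : Core) : Prop :=
  ∀ j < k, ∀ i < N, s.mem ((j * N + i : ℕ) : ℤ) = x j i

theorem addr_lt {j k i N : ℕ} (hj : j < k) (hi : i < N) : j * N + i < k * N := by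
  have := Nat.mul_le_mul_right N (show j + 1 ≤ k by omega)
  rw [add_mul, one_mul] at this
  omega

theorem Holds.congr {k N : ℕ} {x : ℕ → ℕ → ℕ} {s s' : Core} (h : Holds k N x s)
    (h' : ∀ a : ℤ, a < ((k * N : ℕ) : ℤ) → s'.mem a = s.mem a) : Holds k N x s' := by
  intro j hj i hi
  rw [h' _ (by exact_mod_cast addr_lt hj hi), h j hj i hi]

/-- The strings `x (q 0), …, x (q (g - 1))`, shifted according to the digits of `f` in base `N`,
have the character `c` at position `i`. -/
def AgreeAt (N : ℕ) (x : ℕ → ℕ → ℕ) (q : ℕ → ℕ) (g f i c : ℕ) : Prop :=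
  ∀ r < g, x (q r) ((i + f / N ^ r % N) % N) = c

instance (N : ℕ) (x : ℕ → ℕ → ℕ) (q : ℕ → ℕ) (g f i c : ℕ) :
    Decidable (AgreeAt N x q g f i c) := by
  unfold AgreeAt; infer_instance

theorem agreeAt_succ {N : ℕ} {x : ℕ → ℕ → ℕ} {q : ℕ → ℕ} {g f i c : ℕ} :
    AgreeAt N x q (g + 1) f i c ↔ x (q 0) ((i + f % N) % N) = c ∧
      AgreeAt N x (fun r => q (r + 1)) g (f / N) i c := by
  constructor
  · intro h
    refine ⟨by simpa using h 0 (by omega), fun r hr => ?_⟩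
    have := h (r + 1) (by omega)
    rwa [pow_succ', ← Nat.div_div_eq_div_mul] at this
  · rintro ⟨h0, h⟩ r hr
    rcases r with _ | r
    · simpa using h0
    · rw [pow_succ', ← Nat.div_div_eq_div_mul]
      exact h r (by omega)

/-- Compare the character of string `j` at the position given by the last digit of register `33`
with register `32`, and remove the digit. -/
def checkBody (j : ℕ) : Cmd :=
  .ite .eq (.load (.lit j * V rN + (V rI + V 33 % V rN) % V rN)) (V 32) .skip (.assign 31 (V rn)) ;;
  .assign 33 (V 33 / V rN)

def checks (q : ℕ → ℕ) : ℕ → Cmd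
  | 0 => .skip
  | g + 1 => checkBody (q 0) ;; checks (fun r => q (r + 1)) g

section
variable {w k N n P : ℕ} {x : ℕ → ℕ → ℕ} {s : Core}

theorem evals_char (hw : 2 * ((k * N : ℕ) : ℤ) < 2 ^ w) (hx : Holds k N x s)
    (hsN : s.reg rN = N) {j : ℕ} (hj : j < k) {e : Expr} {i : ℕ} (he : Evals w s e (i : ℤ))
    (hi : i < N) : Evals w s (.load (.lit j * V rN + e)) (x j i) := by
  have h := addr_lt hj hi
  have h1 : (Expr.lit j * V rN + e).eval s = ((j * N + i : ℕ) : ℤ) := by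
    simp [hsN, he.2]
  refine ⟨⟨by simp [he.1], ?_⟩, ?_⟩
  · rw [h1]; exact ⟨by positivity, by omega⟩
  · rw [Expr.eval_load, h1, hx j hj i hi]

/-- Register `31` holds the candidate result and is overwritten by `n` at any mismatch; later
matches do not restore it. The digits of the code are consumed from the lowest on. -/
theorem checks_spec (hN : 0 < N) (hk : 0 < k) (hw : 2 * ((k * N : ℕ) : ℤ) < 2 ^ w)
    (hxw : ∀ j < k, ∀ i < N, (x j i : ℤ) < 2 ^ w) (q : ℕ → ℕ) (g : ℕ) (hq : ∀ r < g, q r < k)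
    {f i c : ℕ} (hi : i < N) (hc : (c : ℤ) < 2 ^ w) (hf : (f : ℤ) < 2 ^ w)
    (hx : Holds k N x s) (hsN : s.reg rN = N) (hsI : s.reg rI = i) (hs32 : s.reg 32 = c)
    (hs33 : s.reg 33 = f) :
    LinSpec w (checks q g) s fun s' => s'.mem = s.mem ∧ (∀ r < 31, s'.reg r = s.reg r) ∧
      s'.reg 31 = if AgreeAt N x q g f i c then s.reg 31 else s.reg rn := by
  have hNk : N ≤ k * N := Nat.le_mul_of_pos_left _ hk
  induction g generalizing q f s with
  | zero =>
    refine LinSpec.skip ⟨rfl, fun _ _ => rfl, ?_⟩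
    rw [if_pos]
    exact fun r hr => absurd hr (Nat.not_lt_zero r)
  | succ g ih =>
    have e1 : Evals w s ((V rI + V 33 % V rN) % V rN) (((i + f % N) % N : ℕ) : ℤ) := by
      have h1 : f % N < N := Nat.mod_lt _ hN
      refine ⟨?_, by simp [hsN, hsI, hs33]⟩
      have h2 : (f : ℤ) % N = ((f % N : ℕ) : ℤ) := by push_cast; rfl
      simp only [Expr.safe_mod, Expr.safe_add, Expr.safe_var, Expr.eval_var, Expr.eval_add,
        Expr.eval_mod, hsN, hsI, hs33, InWord, true_and, h2]
      omega
    have e2 := evals_char hw hx hsN (hq 0 (by omega)) e1 (Nat.mod_lt _ hN)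
    refine LinSpec.seq (Q := fun s' => s'.mem = s.mem ∧ (∀ r < 31, s'.reg r = s.reg r) ∧
      s'.reg 32 = c ∧ s'.reg 33 = ((f / N : ℕ) : ℤ) ∧
      s'.reg 31 = if x (q 0) ((i + f % N) % N) = c then s.reg 31 else s.reg rn)
      (LinSpec.seq (Q := fun s' => s'.mem = s.mem ∧ (∀ r < 31, s'.reg r = s.reg r) ∧
      s'.reg 32 = c ∧ s'.reg 33 = f ∧
      s'.reg 31 = if x (q 0) ((i + f % N) % N) = c then s.reg 31 else s.reg rn)
      (LinSpec.ite ⟨e2.1, by simp, ?_, ?_⟩ ?_ ?_) ?_) ?_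
    · rw [e2.2]
      exact ⟨by positivity, hxw _ (hq 0 (by omega)) _ (Nat.mod_lt _ hN)⟩
    · rw [Expr.eval_var, hs32]; exact ⟨by positivity, hc⟩
    · intro h
      rw [e2.2, Expr.eval_var, hs32, Test.holds_eq, Nat.cast_inj] at h
      refine LinSpec.skip ⟨rfl, fun _ _ => rfl, hs32, hs33, by rw [if_pos h]⟩
    · intro h
      rw [e2.2, Expr.eval_var, hs32, Test.holds_eq, Nat.cast_inj] at h
      refine LinSpec.assign (by simp) ⟨rfl, fun r hr => ?_, ?_, ?_, ?_⟩
      · simp [hr.ne]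
      · simp [hs32]
      · simp [hs33]
      · rw [if_neg h]; simp
    · rintro s' ⟨h1, h2, h3, h4, h5⟩
      refine LinSpec.assign ?_ ⟨h1, fun r hr => ?_, ?_, ?_, ?_⟩
      · simp [h4, h2, hsN, InWord]; omega
      · simp [show r ≠ 33 by omega, h2 r hr]
      · simp [h3]
      · simp [h4, h2, hsN]
      · simp [h5]
    · rintro s' ⟨h1, h2, h3, h4, h5⟩
      have hfN : f / N ≤ f := Nat.div_le_self _ _
      refine (ih (fun r => q (r + 1)) (fun r hr => hq (r + 1) (by omega)) (f := f / N) (by omega)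
        (hx.congr fun a _ => by rw [h1]) (by rw [h2 _ (by norm_num), hsN])
        (by rw [h2 _ (by norm_num), hsI]) h3 h4).mono ?_
      rintro s'' ⟨j1, j2, j3⟩
      refine ⟨j1.trans h1, fun r hr => (j2 r hr).trans (h2 r hr), ?_⟩
      rw [j3, h5, h2 _ (by norm_num)]
      simp only [agreeAt_succ]
      split_ifs <;> tauto

/-- Store the common character of the strings at a position, or `n` if there is none. -/
def matchBody (k last : ℕ) (q : ℕ → ℕ) (g : ℕ) : Cmd :=
  .assign 31 (V rn) ;;
  .ite .lt (V rI) (V rN)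
    (.assign 32 (.load (.lit last * V rN + V rI)) ;; .assign 31 (V 32) ;; .assign 33 (V rCode) ;;
      checks q g) .skip ;;
  .store (.lit k * V rN + V rI) (V 31)

/-- The common character at position `i`, or `n` if there is none. -/
def common (N n : ℕ) (x : ℕ → ℕ → ℕ) (last : ℕ) (q : ℕ → ℕ) (g f i : ℕ) : ℕ :=
  if i < N ∧ AgreeAt N x q g f i (x last i) then x last i else n

/-- The table has length `2 * N`, the block length of the correlation. Its upper half is filled with
`n`, which is not the index of any block, so nothing matches there. -/
theorem match_spec (hN : 0 < N) (hk : 0 < k) (hw : 2 * (((k + 2) * N : ℕ) : ℤ) < 2 ^ w)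
    (hxw : ∀ j < k, ∀ i < N, (x j i : ℤ) < 2 ^ w) {last : ℕ} (hlast : last < k) (q : ℕ → ℕ)
    (g : ℕ) (hq : ∀ r < g, q r < k) {f : ℕ} (hf : (f : ℤ) < 2 ^ w)
    (hx : Holds k N x s) (hsN : s.reg rN = N) (hsn : s.reg rn = n) (hsf : s.reg rCode = f) :
    Spec w (.for rI (2 * V rN) (matchBody k last q g)) s
      (2 + (2 * N + 1) * ((matchBody k last q g).size + 10)) fun s' =>
        (∀ r < 30, s'.reg r = s.reg r) ∧
        (∀ a : ℤ, (a < ((k * N : ℕ) : ℤ) ∨ (((k + 2) * N : ℕ) : ℤ) ≤ a) → s'.mem a = s.mem a) ∧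
        ∀ i < 2 * N, s'.mem ((k * N + i : ℕ) : ℤ) = common N n x last q g f i := by
  have hNk : N ≤ k * N := Nat.le_mul_of_pos_left _ hk
  have hk2 : (k + 2) * N = k * N + 2 * N := by ring
  rw [hk2] at hw ⊢
  have hkw : 2 * ((k * N : ℕ) : ℤ) < 2 ^ w := by push_cast at hw ⊢; omega
  refine Spec.mono (Spec.for (T := (matchBody k last q g).size)
    (fun j s' => (∀ r < 30, s'.reg r = s.reg r) ∧ s'.reg rI = j ∧
    (∀ a : ℤ, (a < ((k * N : ℕ) : ℤ) ∨ ((k * N + 2 * N : ℕ) : ℤ) ≤ a) → s'.mem a = s.mem a) ∧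
    ∀ i < j, s'.mem ((k * N + i : ℕ) : ℤ) = common N n x last q g f i) (2 * N)
    (by push_cast at hw ⊢; omega) ?_ ?_ ?_)
    (Nat.add_le_add_left (Nat.mul_le_mul_left _ (show 3 + _ + 7 ≤ _ by omega)) _)
    fun s' hs' => ⟨hs'.1, hs'.2.2⟩
  · refine ⟨fun r hr => ?_, by simp, fun _ _ => rfl, fun i hi => absurd hi (Nat.not_lt_zero i)⟩
    simp [show r ≠ 30 by omega]
  · rintro j hj s' ⟨h1, h2, -⟩
    exact ⟨h2, by simp, by simp [h1, hsN]⟩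
  · rintro j hj s' ⟨h1, h2, h3, h4⟩
    have hN' : s'.reg rN = N := by rw [h1 _ (by norm_num), hsN]
    have hx' : Holds k N x s' := hx.congr fun a ha => h3 a (Or.inl ha)
    refine LinSpec.seq_assign (by simp) (LinSpec.seq (Q := fun s'' => s''.mem = s'.mem ∧
      (∀ r < 31, s''.reg r = s'.reg r) ∧ s''.reg 31 = common N n x last q g f j)
      (LinSpec.ite ⟨by simp, by simp, ?_, ?_⟩ ?_ ?_) ?_)
    · simp [h2, InWord]; omega
    · simp [hN', InWord]; omega
    · intro hlt
      simp [h2, hN'] at hlt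
      have e1 : Evals w (s'.set 31 ((V rn).eval s')) (.load (.lit last * V rN + V rI))
          (x last j) :=
        evals_char (s := s'.set 31 ((V rn).eval s')) hkw (hx'.congr fun a _ => rfl) (by simp [hN'])
          hlast ⟨by simp, by simp [h2]⟩ hlt
      refine LinSpec.seq_assign e1.1 (LinSpec.seq_assign (by simp) (LinSpec.seq_assign (by simp) ?_))
      rw [e1.2]
      refine LinSpec.mono (checks_spec (c := x last j) hN hk hkw hxw q g
        hq hlt (hxw _ hlast _ hlt) hf (hx'.congr fun a _ => rfl) (by simp [hN']) (by simp [h2])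
        (by simp) (by simp [h1, hsf])) ?_
      rintro s'' ⟨j1, j2, j3⟩
      refine ⟨j1, fun r hr => ?_, ?_⟩
      · rw [j2 r hr]
        simp [show r ≠ 31 by omega, show r ≠ 32 by omega, show r ≠ 33 by omega]
      · rw [j3, common]
        simp [hlt, h1, hsn]
    · intro hlt
      simp [h2, hN'] at hlt
      refine LinSpec.skip ⟨rfl, fun r hr => ?_, ?_⟩
      · simp [show r ≠ 31 by omega]
      · rw [common, if_neg (by omega)]
        simp [h1, hsn]
    · rintro s'' ⟨j1, j2, j3⟩
      have ha : (Expr.lit k * V rN + V rI).eval s'' = ((k * N + j : ℕ) : ℤ) := by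
        simp [j2, hN', h2]
      refine LinSpec.store (by simp) (by simp) ?_ ⟨?_, fun r hr => ?_, ?_, fun a ha' => ?_,
        fun i hi => ?_⟩
      · rw [ha]; exact ⟨by positivity, by push_cast at hw ⊢; omega⟩
      · simp [j2, h2]
      · simp [show r ≠ 30 by omega, j2 r (by omega), h1 r hr]
      · simp
      · rw [Core.set_mem, Core.write_mem, ha, if_neg (by push_cast at ha' ⊢; omega), j1, h3 a ha']
      · rw [Core.set_mem, Core.write_mem, ha]
        rcases Nat.lt_succ_iff_lt_or_eq.mp hi with hi | rfl
        · rw [if_neg (by push_cast; omega), j1, h4 i hi]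
        · rw [if_pos rfl, Expr.eval_var, j3]

/-- Store an entry of the input of the transform. -/
def inputBody (k j : ℕ) : Cmd :=
  .assign 31 0 ;;
  .ite .eq (.load (.lit k * V rN + V rI % (2 * V rN))) (V rI / (2 * V rN)) (.assign 31 (V rS)) .skip ;;
  .assign 32 ((V rn - V rI) % V rn) ;; .assign 33 0 ;;
  .ite .eq (.load (.lit j * V rN + V 32 % (2 * V rN) % V rN)) (V 32 / (2 * V rN))
    (.assign 33 (V rS)) .skip ;;
  storeC (V rn + V rI) (V 31) (V 33)

/-- The indicator of `Y` is the real part and that of string `j₀` the imaginary part. The latter is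
stored at the reflected index `(n - l) % n`, because two transforms in the same direction reflect
indices. -/
theorem input_spec {D : ℕ} {S Q B : ℤ} {Y : ℕ → ℕ} (hf : Fits w n P D S Q B)
    (hl : Layout n P D S Q s) (hD : 2 * n ≤ D) (hN : 0 < N) (hk : 0 < k)
    (hP : P = (k + 2) * N) (hw : 2 * (((k + 2) * N : ℕ) : ℤ) < 2 ^ w)
    (hxw : ∀ j < k, ∀ i < N, (x j i : ℤ) < 2 ^ w) {j₀ : ℕ} (hj₀ : j₀ < k)
    (hx : Holds k N x s) (hsN : s.reg rN = N) (hYw : ∀ i < 2 * N, (Y i : ℤ) < 2 ^ w)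
    (hY : ∀ i < 2 * N, s.mem ((k * N + i : ℕ) : ℤ) = Y i) :
    Spec w (.for rI (V rn) (inputBody k j₀)) s (2 + (n + 1) * ((inputBody k j₀).size + 8))
      fun s' => Filled 30 P D s s' n n
        (toFix S (fun p => if Y (p % (2 * N)) = p / (2 * N) then 1 else 0)
          fun l => if x j₀ ((n - l) % n % (2 * N) % N) = (n - l) % n / (2 * N) then 1 else 0) := by
  have hNk : N ≤ k * N := Nat.le_mul_of_pos_left _ hk
  have hk2 : (k + 2) * N = k * N + 2 * N := by ring
  rw [hk2] at hw hP
  have hnlt := hf.n_lt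
  push_cast at hw
  have hNk' : (N : ℤ) ≤ k * N := by exact_mod_cast hNk
  refine fill_spec hf hl (by omega) fun p hp s' hs hsI => ?_
  have hl' := hl.congr fun r hr => hs.reg r (by omega)
  have hN' : s'.reg rN = N := by rw [hs.reg _ (by norm_num), hsN]
  have hx' : Holds k N x s' := hx.congr fun a ha => hs.low a (by omega)
  have hY' : ∀ i < 2 * N, s'.mem ((k * N + i : ℕ) : ℤ) = Y i := by
    intro i hi
    rw [hs.low _ (by push_cast; omega), hY i hi]
  have hp1 : p % (2 * N) < 2 * N := Nat.mod_lt _ (by omega)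
  have hp2 : p / (2 * N) ≤ p := Nat.div_le_self _ _
  set z := (n - p) % n with hz
  have hzn : z < n := Nat.mod_lt _ (by omega)
  have hz1 : z % (2 * N) < 2 * N := Nat.mod_lt _ (by omega)
  have hz2 : z / (2 * N) ≤ z := Nat.div_le_self _ _
  have hz3 : z % (2 * N) % N < N := Nat.mod_lt _ hN
  have w2N : InWord w (2 * (N : ℤ)) := ⟨by positivity, by omega⟩
  have wp : InWord w (p : ℤ) := ⟨by positivity, by omega⟩
  have wz : InWord w (z : ℤ) := ⟨by positivity, by omega⟩
  set av : ℤ := if Y (p % (2 * N)) = p / (2 * N) then 1 else 0 with hav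
  set bv : ℤ := if x j₀ (z % (2 * N) % N) = z / (2 * N) then 1 else 0 with hbv
  refine LinSpec.seq_assign (by simp) (LinSpec.seq (Q := fun s'' => s''.mem = s'.mem ∧
    (∀ r < 31, s''.reg r = s'.reg r) ∧ s''.reg 31 = S * av) ?_ ?_)
  · have ea : (Expr.lit k * V rN + V rI % (2 * V rN)).eval (s'.set 31 ((0 : Expr).eval s')) =
        ((k * N + p % (2 * N) : ℕ) : ℤ) := by
      simp [hN', hsI]
    have eb : (V rI / (2 * V rN)).eval (s'.set 31 ((0 : Expr).eval s')) =
        ((p / (2 * N) : ℕ) : ℤ) := by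
      simp [hN', hsI]
    have ec : (Expr.load (Expr.lit k * V rN + V rI % (2 * V rN))).eval
        (s'.set 31 ((0 : Expr).eval s')) = (Y (p % (2 * N)) : ℤ) := by
      rw [Expr.eval_load, ea, Core.set_mem, hY' _ hp1]
    refine LinSpec.ite ⟨⟨?_, ?_⟩, ?_, ?_, ?_⟩ ?_ ?_
    · simp [hN', hsI, w2N, wp]
    · rw [ea]; exact ⟨by positivity, by omega⟩
    · simp [hN', hsI, w2N, wp]
    · rw [ec]; exact ⟨by positivity, hYw _ hp1⟩
    · rw [eb]; exact ⟨by positivity, by omega⟩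
    · intro ht
      rw [ec, eb, Test.holds_eq, Nat.cast_inj] at ht
      refine LinSpec.assign (by simp) ⟨rfl, fun r hr => ?_, ?_⟩
      · simp [show r ≠ 31 by omega]
      · rw [hav, if_pos ht]; simp [hl'.S]
    · intro ht
      rw [ec, eb, Test.holds_eq, Nat.cast_inj] at ht
      refine LinSpec.skip ⟨rfl, fun r hr => ?_, ?_⟩
      · simp [show r ≠ 31 by omega]
      · rw [hav, if_neg ht]; simp
  rintro s1 ⟨m1, r1, a1⟩
  have e1 : ((V rn - V rI) % V rn).eval s1 = (z : ℤ) := by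
    simp only [Expr.eval_mod, Expr.eval_sub, Expr.eval_var, r1 3 (by norm_num), hl'.n,
      r1 30 (by norm_num), hsI]
    rw [hz, Int.natCast_mod, Nat.cast_sub hp.le]
  refine LinSpec.seq_assign ?_ (LinSpec.seq_assign (by simp)
    (LinSpec.seq (Q := fun s'' => s''.mem = s'.mem ∧
    (∀ r < 31, s''.reg r = s'.reg r) ∧ s''.reg 31 = S * av ∧ s''.reg 33 = S * bv) ?_ ?_))
  · simp [r1, hl'.n, hsI, InWord]; omega
  · rw [e1]
    set s2 := (s1.set 32 (z : ℤ)).set 33 ((0 : Expr).eval (s1.set 32 (z : ℤ))) with hs2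
    have r2 : ∀ r < 32, s2.reg r = s1.reg r := by
      intro r hr; simp [hs2, show r ≠ 32 by omega, show r ≠ 33 by omega]
    have r32 : s2.reg 32 = z := by simp [hs2]
    have r33 : s2.reg 33 = 0 := by simp [hs2]
    have rN2 : s2.reg 0 = N := by rw [r2 _ (by norm_num), r1 _ (by norm_num), hN']
    have m2 : s2.mem = s'.mem := m1
    have ea : Evals w s2 (V 32 % (2 * V rN) % V rN) ((z % (2 * N) % N : ℕ) : ℤ) := by
      refine ⟨?_, by simp [r32, rN2]⟩
      have h2 : InWord w ((z : ℤ) % (2 * (N : ℤ))) := by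
        rw [show (z : ℤ) % (2 * (N : ℤ)) = ((z % (2 * N) : ℕ) : ℤ) by push_cast; rfl]
        exact ⟨by positivity, by omega⟩
      have h3 : InWord w (N : ℤ) := ⟨by positivity, by omega⟩
      simp [r32, rN2, w2N, wz, h2, h3]
    have ec := evals_char (by push_cast; omega) (hx'.congr (s' := s2) fun a _ => by rw [m2]) rN2
      hj₀ ea hz3
    have eb : (V 32 / (2 * V rN)).eval s2 = ((z / (2 * N) : ℕ) : ℤ) := by
      simp [r32, rN2]
    refine LinSpec.ite ⟨ec.1, ?_, ?_, ?_⟩ ?_ ?_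
    · simp [r32, rN2, w2N, wz]
    · rw [ec.2]; exact ⟨by positivity, hxw _ hj₀ _ hz3⟩
    · rw [eb]; exact ⟨by positivity, by omega⟩
    · intro ht
      rw [ec.2, eb, Test.holds_eq, Nat.cast_inj] at ht
      refine LinSpec.assign (by simp) ⟨m2, fun r hr => ?_, ?_, ?_⟩
      · simp [show r ≠ 33 by omega, r2 r (by omega), r1 r hr]
      · simp [r2, a1]
      · rw [hbv, if_pos ht]; simp [r2, r1, hl'.S]
    · intro ht
      rw [ec.2, eb, Test.holds_eq, Nat.cast_inj] at ht
      refine LinSpec.skip ⟨m2, fun r hr => ?_, ?_, ?_⟩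
      · rw [r2 r (by omega), r1 r hr]
      · simp [r2, a1]
      · rw [hbv, if_neg ht, r33, mul_zero]
  · rintro s3 ⟨m3, r3, a3, b3⟩
    have hl3 := hl'.congr fun r hr => r3 r (by omega)
    refine (storeC_spec hf hl3 (X := n + p) (v := (S * av, S * bv)) ⟨by simp, ?_⟩ (by omega)
      ⟨by simp, by simp [a3]⟩ ⟨by simp, by simp [b3]⟩ (by decide) (by decide)).mono ?_
    · simp [hl3.n, r3, hsI]
    · rintro s4 ⟨h1, h2, h3, h4⟩
      refine ⟨fun r hr => by rw [h1 r (by omega), r3 r hr], h2, fun a ha => by rw [h3 a ha, m3],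
        fun y hy hyn => ?_⟩
      rw [h4 y hy hyn, view, view, m3]

end

/-- The offset score of the offsets coded by `f`, of the strings `x (q 0), …, x (q (g - 1))` with
respect to the string `x last`. -/
def codeScore (N : ℕ) (x : ℕ → ℕ → ℕ) (last : ℕ) (q : ℕ → ℕ) (g f : ℕ) : ℕ :=
  ((Finset.range N).filter fun i => AgreeAt N x q g f i (x last i)).card

/-- Where the fixed strings have no common character, the stored value is `n ≥ σ`, which differs
from every character. Elsewhere the comparison adds the condition for the lowest digit `d`. -/
theorem card_common_eq {N n σ : ℕ} (hN : 0 < N) {x : ℕ → ℕ → ℕ} (hx : ∀ j i, x j i < σ)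
    (hσ : σ ≤ n) (last : ℕ) (q : ℕ → ℕ) (g e : ℕ) {d : ℕ} (hd : d < N) :
    ((Finset.range N).filter fun i => common N n x last (fun r => q (r + 1)) g e i =
      x (q 0) ((i + d) % N)).card = codeScore N x last q (g + 1) (e * N + d) := by
  rw [codeScore]
  congr 1
  refine Finset.filter_congr fun i hi => ?_
  rw [Finset.mem_range] at hi
  rw [agreeAt_succ, Nat.mul_add_mod', Nat.mod_eq_of_lt hd, show (e * N + d) / N = e by
    rw [mul_comm, Nat.mul_add_div hN, Nat.div_eq_of_lt hd, add_zero], common]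
  have := hx (q 0) ((i + d) % N)
  split_ifs with h
  · simp only [h.2, and_true]; exact eq_comm
  · constructor
    · intro h'; omega
    · rintro ⟨-, h'⟩; exact absurd ⟨hi, h'⟩ h

/-! ### Word size, and the preparations of the transform. -/

/-- Assumptions on the size of the parameters. -/
structure Sizes (w k N σ m : ℕ) : Prop where
  N_pos : 0 < N
  k_pos : 0 < k
  σ_pos : 0 < σ
  four_le : 4 ≤ m
  le_pow : 2 * N * σ ≤ 2 ^ m
  pow_lt : ∀ j, 4 ≤ j → j < m → 2 ^ j < 2 * N * σ
  pow_le : ((2 : ℤ) ^ m) ^ 50 ≤ 2 ^ w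
  mul_pow_le : ((k : ℤ) + 2) * (2 ^ m) ^ 4 ≤ 2 ^ w

section
variable {w k N σ m : ℕ}

/-- The length of the array of complex numbers. -/
def arrayLength (m : ℕ) : ℕ := (2 * m + 3) * 2 ^ m

theorem Sizes.two_mul_N_le (h : Sizes w k N σ m) : 2 * N ≤ 2 ^ m :=
  (Nat.le_mul_of_pos_right _ h.σ_pos).trans h.le_pow

theorem Sizes.σ_le (h : Sizes w k N σ m) : σ ≤ 2 ^ m :=
  (Nat.le_mul_of_pos_left _ (Nat.mul_pos two_pos h.N_pos)).trans h.le_pow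

theorem Sizes.sixteen_le (h : Sizes w k N σ m) : 16 ≤ 2 ^ m := by
  calc 16 = 2 ^ 4 := by norm_num
    _ ≤ 2 ^ m := Nat.pow_le_pow_right (by norm_num) h.four_le

theorem Sizes.mul_pow_lt (h : Sizes w k N σ m) {c e : ℕ} (he : e < 50) (hc : c < 16) :
    (c : ℤ) * (2 ^ m) ^ e < 2 ^ w := by
  have h16 : (16 : ℤ) ≤ 2 ^ m := by exact_mod_cast h.sixteen_le
  calc (c : ℤ) * (2 ^ m) ^ e < 2 ^ m * (2 ^ m) ^ e := by
        gcongr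
        exact lt_of_lt_of_le (by exact_mod_cast hc) h16
    _ = (2 ^ m) ^ (e + 1) := by ring
    _ ≤ (2 ^ m) ^ 50 := pow_le_pow_right₀ (by omega) (by omega)
    _ ≤ _ := h.pow_le

/-- With `n = 2 ^ m`, `S = n ^ 20`, `Q = S * n ^ 9` and `B = S * n ^ 4`: `2 * B ^ 2 = 2 * n ^ 48 ≤ n
^ 49 = S * Q`, and `2 * S * Q < n ^ 50 ≤ 2 ^ w`. -/
theorem Sizes.fits (h : Sizes w k N σ m) :
    Fits w (2 ^ m) ((k + 2) * N) (arrayLength m) ((2 ^ m) ^ 20) ((2 ^ m) ^ 20 * (2 ^ m) ^ 9)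
      ((2 ^ m) ^ 20 * (2 ^ m) ^ 4) := by
  have h16 : (16 : ℤ) ≤ 2 ^ m := by exact_mod_cast h.sixteen_le
  refine ⟨by positivity, ?_, ?_, ?_, ?_, ?_⟩
  · simpa using h.mul_pow_lt (c := 1) (e := 20) (by norm_num) (by norm_num)
  · have := h.mul_pow_lt (c := 2) (e := 49) (by norm_num) (by norm_num)
    refine lt_of_eq_of_lt ?_ this
    push_cast; ring
  · calc (2 : ℤ) * ((2 ^ m) ^ 20 * (2 ^ m) ^ 4 * ((2 ^ m) ^ 20 * (2 ^ m) ^ 4)) =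
        2 * (2 ^ m) ^ 48 := by ring
      _ ≤ 2 ^ m * (2 ^ m) ^ 48 := by gcongr; omega
      _ = _ := by ring
  · refine le_trans ?_ h.mul_pow_le
    have h1 : (m : ℤ) < 2 ^ m := by exact_mod_cast Nat.lt_two_pow_self
    have h2 : 2 * (N : ℤ) ≤ 2 ^ m := by exact_mod_cast h.two_mul_N_le
    have hk := h.k_pos
    rw [arrayLength]
    push_cast
    generalize (2 : ℤ) ^ m = n at *
    have e1 : ((k : ℤ) + 2) * N ≤ (k + 2) * n := by gcongr; omega
    have e2 : 2 * ((2 * (m : ℤ) + 3) * n) ≤ (k + 2) * (3 * n * n) := by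
      have : (2 * (m : ℤ) + 3) * n ≤ 3 * n * n := by gcongr; omega
      have h3 : (2 : ℤ) ≤ k + 2 := by omega
      calc 2 * ((2 * (m : ℤ) + 3) * n) ≤ 2 * (3 * n * n) := by gcongr
        _ ≤ (k + 2) * (3 * n * n) := by gcongr
    have e3 : n + 3 * n * n ≤ n ^ 4 := by
      have : 0 ≤ n := by omega
      have h4 : 16 * n * n ≤ n * n * n := by nlinarith
      nlinarith
    calc ((k : ℤ) + 2) * N + 2 * ((2 * m + 3) * n) ≤ (k + 2) * (n + 3 * n * n) := by linarith
      _ ≤ (k + 2) * n ^ 4 := by gcongr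
  · simpa using h.mul_pow_lt (c := 2) (e := 1) (by norm_num) (by norm_num)

theorem Sizes.two_mul_lt (h : Sizes w k N σ m) : 2 * (((k + 2) * N : ℕ) : ℤ) < 2 ^ w := by
  refine lt_of_lt_of_le ?_ h.mul_pow_le
  have h16 : (16 : ℤ) ≤ 2 ^ m := by exact_mod_cast h.sixteen_le
  have h2 : 2 * (N : ℤ) ≤ 2 ^ m := by exact_mod_cast h.two_mul_N_le
  push_cast
  generalize (2 : ℤ) ^ m = n at *
  have h3 : n < n ^ 4 := by
    have h4 : n * 1 < n * n ^ 3 := by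
      gcongr
      exact one_lt_pow₀ (by omega) (by norm_num)
    calc n = n * 1 := by ring
      _ < n * n ^ 3 := h4
      _ = n ^ 4 := by ring
  calc 2 * (((k : ℤ) + 2) * N) = (k + 2) * (2 * N) := by ring
    _ ≤ (k + 2) * n := by gcongr
    _ < (k + 2) * n ^ 4 := by gcongr

/-- Find the length of the transform. -/
def sizeBody : Cmd := .assign rn (2 * V rn) ;; .assign rm (V rm + 1)

def sizeCmd : Cmd :=
  .assign rn 16 ;; .assign rm 4 ;; .while .lt (V rn) (2 * V rN * V 1) sizeBody

/-- Doubling starts from `16 = 2 ^ 4`. The field `pow_lt` of `Sizes` says that `m` is the least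
admissible exponent, so the loop ends exactly there. -/
theorem sizeCmd_spec {s : Core} (h : Sizes w k N σ m) (hN : s.reg rN = N) (hσ : s.reg 1 = σ) :
    Spec w sizeCmd s (4 + (m + 1) * (sizeBody.size + 10)) fun s' =>
      s'.mem = s.mem ∧ (∀ r < 3, s'.reg r = s.reg r) ∧ s'.reg rn = 2 ^ m ∧ s'.reg rm = m := by
  have hw := h.fits.n_lt
  have hle : 2 * (N : ℤ) * σ ≤ 2 ^ m := by exact_mod_cast h.le_pow
  have hpos : (0 : ℤ) < 2 ^ m := by positivity
  push_cast at hw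
  refine Spec.mono (Spec.seq_assign (by simp) (Spec.seq_assign (by simp)
    (Spec.while_count (T := sizeBody.size) (fun j s' => s'.mem = s.mem ∧
      (∀ r < 3, s'.reg r = s.reg r) ∧
      s'.reg rn = 2 ^ (4 + j) ∧ s'.reg rm = ((4 + j : ℕ) : ℤ)) (m - 4) ?_ ?_ ?_ ?_))) ?_ ?_
  · refine ⟨rfl, fun r hr => ?_, by simp, by simp⟩
    simp [show r ≠ 3 by omega, show r ≠ 4 by omega]
  · rintro j hj s' ⟨-, h2, h3, -⟩
    have : (2 : ℤ) ^ (4 + j) ≤ 2 ^ m :=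
      pow_le_pow_right₀ (by norm_num) (by have := h.four_le; omega)
    refine ⟨by simp, by simp, ?_, ?_⟩
    · rw [Expr.eval_var, h3]; exact ⟨by positivity, by omega⟩
    · simp [h2, hN, hσ]
      exact ⟨by positivity, by omega⟩
  · rintro j hj s' ⟨-, h2, h3, -⟩
    simp [h2, h3, hN, hσ]
    have := h.four_le
    constructor
    · intro hlt
      by_contra hjm
      rw [show 4 + j = m by omega] at hlt
      omega
    · intro hjm
      exact_mod_cast h.pow_lt (4 + j) (by omega) (by omega)
  · rintro j hj s' ⟨h1, h2, h3, h4⟩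
    refine LinSpec.seq_assign (by simp) (LinSpec.assign (by simp) ⟨h1, fun r hr => ?_, ?_, ?_⟩)
    · simp [show r ≠ 3 by omega, show r ≠ 4 by omega, h2 r hr]
    · simp [h3]; ring
    · simp [h4]; ring
  · have := h.four_le
    have e : (m - 4 + 1) * ((V rn).size + (2 * V rN * V 1 : Expr).size + sizeBody.size + 2) ≤
        (m + 1) * (sizeBody.size + 10) := by
      apply Nat.mul_le_mul (by omega)
      change 1 + 5 + _ + 2 ≤ _
      omega
    change 2 + (2 + _) ≤ _
    omega
  · rintro s' ⟨h1, h2, h3, h4⟩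
    have := h.four_le
    rw [show 4 + (m - 4) = m by omega] at h3 h4
    exact ⟨h1, h2, h3, h4⟩

/-- Compute the parameters of the transform. -/
def constCmd (k : ℕ) : Cmd :=
  .assign 31 (V rn * V rn) ;; .assign 31 (V 31 * V 31) ;;
  .assign rS (V 31 * V 31 * V 31 * V 31 * V 31) ;; .assign rQ (V rS * (V 31 * V 31 * V rn)) ;;
  .assign rRe (.lit (k + 2) * V rN) ;; .assign rIm (V rRe + (2 * V rm + .lit 3) * V rn)

theorem constCmd_spec {s : Core} (hN : s.reg rN = N) (hn : s.reg rn = 2 ^ m) (hm : s.reg rm = m) :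
    LinSpec w (constCmd k) s fun s' => s'.mem = s.mem ∧ (∀ r < 3, s'.reg r = s.reg r) ∧
      s'.reg rm = m ∧
      Layout (2 ^ m) ((k + 2) * N) (arrayLength m) ((2 ^ m) ^ 20) ((2 ^ m) ^ 20 * (2 ^ m) ^ 9) s' := by
  refine LinSpec.seq_assign (by simp) (LinSpec.seq_assign (by simp) (LinSpec.seq_assign (by simp)
    (LinSpec.seq_assign (by simp) (LinSpec.seq_assign (by simp) (LinSpec.assign (by simp)
    ⟨rfl, fun r hr => ?_, by simp [hm], ⟨?_, ?_, ?_, ?_, ?_⟩⟩)))))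
  · simp [show r ≠ 8 by omega, show r ≠ 7 by omega, show r ≠ 6 by omega, show r ≠ 5 by omega,
      show r ≠ 31 by omega]
  · simp [hn]
  · simp [hn]; ring
  · simp [hn]; ring
  · simp [hN]
  · simp [hN, hn, hm, arrayLength]

/-- Compute the root of unity. -/
def rootBody : Cmd := sqrtCmd (V rS * (2 * V rS + V rCos)) ;; .assign rCos (V 31)

def rootCmd : Cmd :=
  .assign rCos 0 ;; .for rLevel (V rm - .lit 3) rootBody ;;
  sqrtCmd (V rS * (2 * V rS - V rCos)) ;; .assign rSin (V 31 / 2) ;;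
  sqrtCmd (V rS * (2 * V rS + V rCos)) ;; .assign rCos (V 31 / 2)

theorem intSqrt_le {v b : ℤ} (hb : 0 ≤ b) (h : v ≤ b * b) : Int.sqrt v ≤ b := by
  obtain ⟨c, rfl⟩ := Int.eq_ofNat_of_zero_le hb
  rw [Int.sqrt, Nat.cast_le]
  have : v.toNat ≤ c * c := by
    have : ((c * c : ℕ) : ℤ) = (c : ℤ) * c := by push_cast; rfl
    omega
  exact (Nat.sqrt_le_sqrt this).trans (Nat.sqrt_eq c).le

/-- After the loop `rCos` holds `cosFix S (m - 3)`. The sine needs this value, so it is computed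
before the last half-angle step takes the cosine to index `m - 2`. -/
theorem rootCmd_spec {s : Core} {S : ℤ} (h : Sizes w k N σ m) (hSd : S = (2 ^ m) ^ 20)
    (hS : s.reg rS = S) (hm : s.reg rm = m) :
    Spec w rootCmd s ((m + 1) * (50 + (20 * m + 3) * (3 * (sqrtBody.size + 4)))) fun s' =>
      s'.mem = s.mem ∧ (∀ r < 9, s'.reg r = s.reg r) ∧ s'.reg rCos = (rootFix S m).1 ∧
        s'.reg rSin = (rootFix S m).2 := by
  have hSp : 0 < S := by rw [hSd]; positivity
  have hw : 64 * (((2 : ℤ) ^ m) ^ 20 * (2 ^ m) ^ 20) < 2 ^ w := by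
    have := h.mul_pow_lt (c := 1) (e := 42) (by norm_num) (by norm_num)
    refine lt_of_le_of_lt ?_ this
    have h16 : (16 : ℤ) ≤ 2 ^ m := by exact_mod_cast h.sixteen_le
    calc (64 : ℤ) * ((2 ^ m) ^ 20 * (2 ^ m) ^ 20) = 64 * (2 ^ m) ^ 40 := by ring
      _ ≤ (2 ^ m) ^ 2 * (2 ^ m) ^ 40 := by gcongr; nlinarith
      _ = _ := by push_cast; ring
  have hsq : ∀ j, S * (2 * S + cosFix S j) ≤ 4 * (S * S) := fun j => by
    nlinarith [cosFix_le hSp j]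
  have hsq0 : ∀ j, 0 ≤ S * (2 * S + cosFix S j) := fun j => by
    have := cosFix_nonneg S j; positivity
  have hmw : (m : ℤ) < 2 ^ w := by
    have h1 : (m : ℤ) < 2 ^ m := by exact_mod_cast Nat.lt_two_pow_self
    have := h.fits.n_lt
    push_cast at this; omega
  have h4 := h.four_le
  obtain ⟨X, hX⟩ : ∃ X, X = (20 * m + 3) * (sqrtBody.size + 4) := ⟨_, rfl⟩
  rw [mul_left_comm _ 3, ← hX]
  obtain ⟨T, hT⟩ : ∃ T, T = 10 + X := ⟨_, rfl⟩
  refine Spec.mono (Spec.seq_assign (by simp) (Spec.seq (T' := 7 + T + (4 + (7 + T + 4))) (Spec.for (T := 7 + T + 2)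
    (fun j s' => s'.mem = s.mem ∧ (∀ r < 9, s'.reg r = s.reg r) ∧ s'.reg rLevel = j ∧
      s'.reg rCos = cosFix S j) (m - 3) (by omega) ?_ ?_ ?_) ?_)) ?_ fun _ h => h
  · refine ⟨rfl, fun r hr => ?_, by simp, by simp [cosFix]⟩
    simp [show r ≠ 22 by omega, show r ≠ 9 by omega]
  · rintro j hj s' ⟨-, h2, h3, -⟩
    refine ⟨h3, by simp, ?_⟩
    simp [h2, hm]
    rw [Nat.cast_sub (by omega)]; rfl
  · rintro j hj s' ⟨h1, h2, h3, h5⟩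
    have e1 : (V rS * (2 * V rS + V rCos)).eval s' = S * (2 * S + cosFix S j) := by
      simp [h2, hS, h5]
    refine Spec.seq (Spec.mono (sqrtCmd_spec (m := m) (by simp) hw (by simp [h2, hS, hSd]) (e1 ▸ hsq0 j)
      (e1 ▸ hSd ▸ hsq j)) (by rw [← hX]; change 7 + 10 + _ ≤ _; omega) fun _ h => h) ?_
    rintro s'' ⟨j1, j2, j3⟩
    refine Spec.mono (Spec.assign (by simp) ?_) le_rfl fun _ h => h
    refine ⟨?_, j2.trans h1, fun r hr => ?_, ?_, ?_⟩
    · simp [j3, h3]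
    · simp [show r ≠ 22 by omega, show r ≠ 9 by omega, j3 r (by omega), h2 r hr]
    · simp
    · simp [j1, h5, h2, hS, cosFix]
  · rintro s' ⟨h1, h2, h3, h5⟩
    have hc0 := cosFix_nonneg S (m - 3)
    have hc1 := cosFix_le hSp (m - 3)
    have hSw := h.fits.S_lt
    have h4S : 4 * S < 2 ^ w := by
      rw [hSd]
      simpa using h.mul_pow_lt (c := 4) (e := 20) (by norm_num) (by norm_num)
    have e1 : (V rS * (2 * V rS - V rCos)).eval s' = S * (2 * S - cosFix S (m - 3)) := by
      simp [h2, hS, h5]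
    have e0 : 0 ≤ S * (2 * S - cosFix S (m - 3)) := mul_nonneg hSp.le (by omega)
    have e2 : S * (2 * S - cosFix S (m - 3)) ≤ 4 * (S * S) := by nlinarith
    refine Spec.seq (Spec.mono (sqrtCmd_spec (m := m) (by simp) hw (by simp [h2, hS, hSd]) (e1 ▸ e0)
      (e1 ▸ hSd ▸ e2)) (by rw [← hX]; change 7 + 10 + _ ≤ _; omega) fun _ h => h) ?_
    rintro s1 ⟨j1, j2, j3⟩
    rw [e1] at j1
    refine Spec.seq_assign ?_ ?_
    · simp only [Expr.safe_div, Expr.safe_var, Expr.safe_two, Expr.eval_var, Expr.eval_two,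
        j1, true_and]
      refine ⟨⟨Int.sqrt_nonneg _, ?_⟩, by norm_num, by omega⟩
      have := intSqrt_le (b := 2 * S) (by omega) (e2.trans_eq (by ring))
      omega
    rw [show (V 31 / 2).eval s1 = Int.sqrt (S * (2 * S - cosFix S (m - 3))) / 2 by simp [j1]]
    set s2 := s1.set rSin (Int.sqrt (S * (2 * S - cosFix S (m - 3))) / 2) with hs2
    have r2 : ∀ r < 10, s2.reg r = s'.reg r := by
      intro r hr
      rw [hs2, Core.set_reg, if_neg (by omega), j3 r (by omega)]
    have e3 : (V rS * (2 * V rS + V rCos)).eval s2 = S * (2 * S + cosFix S (m - 3)) := by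
      simp [r2, h2, hS, h5]
    refine Spec.seq (Spec.mono (sqrtCmd_spec (m := m) (by simp) hw (by simp [r2, h2, hS, hSd])
      (e3 ▸ hsq0 _) (e3 ▸ hSd ▸ hsq _)) (by rw [← hX]; change 7 + 10 + _ ≤ _; omega)
      fun _ h => h) ?_
    rintro s3 ⟨l1, l2, l3⟩
    rw [e3] at l1
    have e5 : Int.sqrt (S * (2 * S + cosFix S (m - 3))) = cosFix S (m - 2) := by
      rw [show m - 2 = m - 3 + 1 by omega, cosFix]
    refine Spec.mono (Spec.assign ?_ ⟨?_, fun r hr => ?_, ?_, ?_⟩) le_rfl fun _ h => h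
    · simp only [Expr.safe_div, Expr.safe_var, Expr.safe_two, Expr.eval_var, Expr.eval_two,
        l1, true_and]
      refine ⟨⟨Int.sqrt_nonneg _, ?_⟩, by norm_num, by omega⟩
      have := intSqrt_le (b := 2 * S) (by omega) ((hsq (m - 3)).trans_eq (by ring))
      omega
    · exact l2.trans (j2.trans h1)
    · simp [show r ≠ 9 by omega, l3 r (by omega), r2 r (by omega), h2 r hr]
    · simp [l1, e5, rootFix]
    · simp [l3, hs2, rootFix]
  · change 2 + (2 + (m - 3 + 1) * (3 + (7 + T + 2) + 7) + (7 + T + (4 + (7 + T + 4)))) ≤ _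
    have h5 : (m - 3 + 1) * (3 + (7 + T + 2) + 7) ≤ m * (29 + X) :=
      Nat.mul_le_mul (by omega) (by omega)
    have h6 : (m + 1) * (50 + 3 * X) = m * (29 + X) + m * 21 + m * (2 * X) + 50 + 3 * X := by ring
    omega

/-- Tabulate the powers of the root of unity. -/
def tableCmd : Cmd := .store (V rRe) (V rS) ;; .store (V rIm) 0 ;; .for rI (V rn) powBody

/-- All preparations. -/
def setupCmd (k : ℕ) : Cmd := sizeCmd ;; constCmd k ;; rootCmd ;; tableCmd

/-- The state after the preparations. -/
structure Ready (k N m : ℕ) (s : Core) : Prop where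
  hN : s.reg rN = N
  hm : s.reg rm = m
  layout : Layout (2 ^ m) ((k + 2) * N) (arrayLength m) ((2 ^ m) ^ 20) ((2 ^ m) ^ 20 * (2 ^ m) ^ 9) s
  table : ∀ j < 2 ^ m, view ((k + 2) * N) (arrayLength m) s j = powFix ((2 ^ m) ^ 20) m j

end

section
variable {w k N σ m : ℕ}

theorem abs_rootFix_le (hm : 4 ≤ m) :
    |(rootFix ((2 ^ m) ^ 20) m).1| ≤ (2 ^ m) ^ 20 * (2 ^ m) ^ 4 ∧
      |(rootFix ((2 ^ m) ^ 20) m).2| ≤ (2 ^ m) ^ 20 * (2 ^ m) ^ 4 := by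
  have h := abs_powFix_le hm (k := 1) Nat.one_le_two_pow
  have h1 : powFix ((2 ^ m) ^ 20) m 1 = rootFix ((2 ^ m) ^ 20) m := by
    have hS : ((2 : ℤ) ^ m) ^ 20 ≠ 0 := by positivity
    simp [powFix, cmul, Int.mul_ediv_cancel_left _ hS]
  rwa [h1] at h

theorem tableCmd_spec {s : Core} (h : Sizes w k N σ m)
    (hl : Layout (2 ^ m) ((k + 2) * N) (arrayLength m) ((2 ^ m) ^ 20) ((2 ^ m) ^ 20 * (2 ^ m) ^ 9) s)
    (hc : s.reg rCos = (rootFix ((2 ^ m) ^ 20) m).1) (hs : s.reg rSin = (rootFix ((2 ^ m) ^ 20) m).2) :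
    Spec w tableCmd s (6 + (2 + (2 ^ m + 1) * (powBody.size + 8))) fun s' =>
      (∀ r < 30, s'.reg r = s.reg r) ∧
      (∀ a : ℤ, a < (((k + 2) * N : ℕ) : ℤ) → s'.mem a = s.mem a) ∧
      ∀ j < 2 ^ m, view ((k + 2) * N) (arrayLength m) s' j = powFix ((2 ^ m) ^ 20) m j := by
  have hf := h.fits
  have hPD := hf.PD_le
  have hD : 2 ^ m + 1 ≤ arrayLength m := by
    have := h.sixteen_le
    rw [arrayLength]; nlinarith
  have hD1 : 1 ≤ arrayLength m := (Nat.le_add_left 1 _).trans hD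
  set P := (k + 2) * N
  set D := arrayLength m
  have e1 : (V rRe).eval s = (P : ℤ) := hl.re
  have e2 : (V rIm).eval (s.write (P : ℤ) ((V rS).eval s)) = (P : ℤ) + D := hl.im
  refine Spec.mono (Spec.seq_store (by simp) (by simp) ?_ (Spec.seq_store (by simp) (by simp) ?_
    (Spec.mono (pow_spec hf (s₀ := (s.write ((V rRe).eval s) ((V rS).eval s)).write
      ((V rIm).eval (s.write ((V rRe).eval s) ((V rS).eval s))) 0)
      (W := powFix ((2 ^ m) ^ 20) m) (hl.congr fun r _ => rfl) hD ⟨hc, hs⟩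
      (abs_rootFix_le h.four_le) ?_ (fun _ _ => rfl)
      fun j hj => abs_powFix_le h.four_le hj.le) le_rfl fun _ h => h)))
    (by simp only [Cmd.size, Expr.size]; omega) ?_
  · have hn0 : (0 : ℤ) < 2 ^ m := by positivity
    rw [e1]; exact ⟨by positivity, by omega⟩
  · rw [e1, e2]; exact ⟨by positivity, by omega⟩
  · rw [e1, e2, view, Core.write_mem, Core.write_mem, Core.write_mem, if_neg (by omega),
      if_pos (by simp), if_pos (by simp)]
    rw [Expr.eval_var, hl.S]; rfl
  · intro s' hs'
    refine ⟨hs'.reg, fun a ha => ?_, fun j hj => ?_⟩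
    · rw [hs'.low a ha, e1, e2, Core.write_mem, Core.write_mem, if_neg (by omega), if_neg (by omega)]
    · rcases j with _ | j
      · rw [hs'.old 0 one_pos, e1, e2, view, Core.write_mem, Core.write_mem, Core.write_mem,
          if_neg (by omega), if_pos (by simp), if_pos (by simp), Expr.eval_var, hl.S]
        rfl
      · rw [add_comm, hs'.new j (by omega), add_comm]

theorem le_mul_self {n m : ℕ} (hn : 1 ≤ n) (hm : 1 ≤ m) :
    1 ≤ n * m ∧ n + 1 ≤ 2 * (n * m) ∧ m + 1 ≤ 2 * (n * m) ∧ (m + 1) * (n + 1) ≤ 4 * (n * m) := by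
  have h1 : n ≤ n * m := Nat.le_mul_of_pos_right _ hm
  have h2 : m ≤ n * m := Nat.le_mul_of_pos_left _ hn
  refine ⟨by omega, by omega, by omega, ?_⟩
  calc (m + 1) * (n + 1) ≤ (2 * m) * (2 * n) := Nat.mul_le_mul (by omega) (by omega)
    _ = _ := by ring

/-- A constant for the time of the preparations. -/
def setupConst (k : ℕ) : ℕ :=
  4 + 2 * (sizeBody.size + 10) + (constCmd k).size + 100 + 46 * (3 * (sqrtBody.size + 4)) + 8 +
    2 * (powBody.size + 8)

theorem setupCmd_spec {s : Core} (h : Sizes w k N σ m) (hN : s.reg rN = N) (hσ : s.reg 1 = σ) :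
    Spec w (setupCmd k) s (setupConst k * (2 ^ m * m)) fun s' => Ready k N m s' ∧
      (∀ r < 3, s'.reg r = s.reg r) ∧
      ∀ a : ℤ, a < (((k + 2) * N : ℕ) : ℤ) → s'.mem a = s.mem a := by
  refine Spec.mono (Spec.seq (sizeCmd_spec h hN hσ) fun s1 ⟨a1, a2, a3, a4⟩ =>
    Spec.seq (constCmd_spec (k := k) ((a2 _ (by norm_num)).trans hN) a3 a4)
      fun s2 ⟨b1, b2, b3, b4⟩ =>
    Spec.seq (rootCmd_spec h rfl b4.S b3) fun s3 ⟨c1, c2, c3, c4⟩ =>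
      Spec.mono (tableCmd_spec h (b4.congr (s' := s3) ?_) c3 c4) le_rfl ?_) ?_ fun _ h => h
  · exact c2
  · rintro s4 ⟨d1, d2, d3⟩
    have r4 : ∀ r < 9, s4.reg r = s2.reg r := fun r hr => (d1 r (by omega)).trans (c2 r hr)
    have r0 : ∀ r < 3, s4.reg r = s.reg r := fun r hr =>
      (r4 r (by omega)).trans ((b2 r hr).trans (a2 r hr))
    refine ⟨⟨(r0 _ (by norm_num)).trans hN, (r4 _ (by norm_num)).trans b3, b4.congr r4, d3⟩, r0,
      fun a ha => ?_⟩
    rw [d2 a ha, c1, b1, a1]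
  · obtain ⟨e1, e2, e3, e4⟩ := le_mul_self (n := 2 ^ m) (m := m) Nat.one_le_two_pow
      (by have := h.four_le; omega)
    have hmn : m ≤ 2 ^ m := Nat.lt_two_pow_self.le
    -- About `m` square roots of cost `O(m)` each; `m ≤ 2 ^ m` absorbs them in the cost of one
    -- transform.
    have e5 : (m + 1) * (20 * m + 3) ≤ 46 * (2 ^ m * m) := by
      have := h.four_le
      calc (m + 1) * (20 * m + 3) ≤ (2 * m) * (23 * m) := Nat.mul_le_mul (by omega) (by omega)
        _ = 46 * (m * m) := by ring
        _ ≤ 46 * (2 ^ m * m) := Nat.mul_le_mul_left _ (Nat.mul_le_mul_right _ hmn)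
    have key : ∀ A n x1 x2 x3 x4 : ℕ, 1 ≤ A → n + 1 ≤ 2 * A → m + 1 ≤ 2 * A →
        (m + 1) * (20 * m + 3) ≤ 46 * A →
        4 + (m + 1) * (x1 + 10) + (x2 + ((m + 1) * (50 + (20 * m + 3) * (3 * (x3 + 4))) +
          (6 + (2 + (n + 1) * (x4 + 8))))) ≤
        (4 + 2 * (x1 + 10) + x2 + 100 + 46 * (3 * (x3 + 4)) + 8 + 2 * (x4 + 8)) * A := by
      intro A n x1 x2 x3 x4 h1 h2 h3 h4
      calc _ = 4 * 1 + (m + 1) * (x1 + 10) + (1 * x2 + ((m + 1) * 50 +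
            ((m + 1) * (20 * m + 3)) * (3 * (x3 + 4)) + (8 * 1 + (n + 1) * (x4 + 8)))) := by ring
        _ ≤ 4 * A + (2 * A) * (x1 + 10) + (A * x2 + ((2 * A) * 50 +
            (46 * A) * (3 * (x3 + 4)) + (8 * A + (2 * A) * (x4 + 8)))) := by gcongr
        _ = _ := by ring
    exact key _ _ _ _ _ _ e1 e2 e3 e5

/-! ### Maximal scores, and the exact and the approximate program. -/

/-- Registers `rBest` and `rArg` contain the maximum of `sc` below `F` and an argument where it is
attained. -/
def IsBest (sc : ℕ → ℕ) (F : ℕ) (s : Core) : Prop :=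
  ∃ b a : ℕ, s.reg rBest = b ∧ s.reg rArg = a ∧ (∀ f < F, sc f ≤ b) ∧
    (b = 0 ∧ a = 0 ∨ a < F ∧ sc a = b)

theorem IsBest.congr {sc : ℕ → ℕ} {F : ℕ} {s s' : Core} (h : IsBest sc F s)
    (h1 : s'.reg rBest = s.reg rBest) (h2 : s'.reg rArg = s.reg rArg) : IsBest sc F s' := by
  rw [IsBest, h1, h2]; exact h

/-- Compare a score with the best one. -/
def bestBody : Cmd :=
  .assign 31 ((loadIm (V rSrc + V rI) + V rn * V rS) / (2 * V rn * V rS)) ;;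
  .ite .lt (V rBest) (V 31) (.assign rBest (V 31) ;; .assign rArg (V rCode * V rN + V rI)) .skip

/-- Updates happen only on strict improvement, starting from score and code `0`. So while all scores
are `0`, the stored code need not have been examined, and `IsBest` allows this as a separate case.
-/
theorem best_spec {s : Core} (h : Sizes w k N σ m)
    (hl : Layout (2 ^ m) ((k + 2) * N) (arrayLength m) ((2 ^ m) ^ 20) ((2 ^ m) ^ 20 * (2 ^ m) ^ 9) s)
    (hN : s.reg rN = N) {e : ℕ} (he : s.reg rCode = e) {x₀ : ℕ} (hsrc : s.reg rSrc = x₀)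
    (hx₀ : x₀ + N ≤ arrayLength m) {sc : ℕ → ℕ} (hsc : ∀ f, (sc f : ℤ) < 2 ^ w)
    (hv : ∀ d < N, 0 ≤ (view ((k + 2) * N) (arrayLength m) s (x₀ + d)).2 + 2 ^ m * (2 ^ m) ^ 20 ∧
      (view ((k + 2) * N) (arrayLength m) s (x₀ + d)).2 ≤ (2 ^ m) ^ 20 * (2 ^ m) ^ 4 ∧
      ((view ((k + 2) * N) (arrayLength m) s (x₀ + d)).2 + 2 ^ m * (2 ^ m) ^ 20) /
        (2 * 2 ^ m * (2 ^ m) ^ 20) = sc (e * N + d))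
    (hb : IsBest sc (e * N) s) :
    Spec w (.for rI (V rN) bestBody) s (2 + (N + 1) * (bestBody.size + 8)) fun s' =>
      s'.mem = s.mem ∧ (∀ r < 16, s'.reg r = s.reg r) ∧ IsBest sc ((e + 1) * N) s' := by
  have hNw : (N : ℤ) < 2 ^ w := by
    have h1 := h.fits.n_lt
    have h2 := h.two_mul_N_le
    have h3 : (2 : ℤ) * N ≤ 2 ^ m := by exact_mod_cast h2
    push_cast at h1; omega
  have hf := h.fits
  refine Spec.mono (Spec.for (T := bestBody.size) (fun d s' => s'.mem = s.mem ∧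
    (∀ r < 16, s'.reg r = s.reg r) ∧ s'.reg rSrc = x₀ ∧ s'.reg rI = d ∧
    IsBest sc (e * N + d) s') N hNw ?_ ?_ ?_) ?_ ?_
  · refine ⟨rfl, fun r hr => ?_, by simp [hsrc], by simp, hb.congr (by simp) (by simp)⟩
    simp [show r ≠ 30 by omega]
  · rintro d hd s' ⟨-, h2, -, h4, -⟩
    exact ⟨h4, by simp, by simp [h2, hN]⟩
  · rintro d hd s' ⟨h1, h2, h3, h4, h5⟩
    have hl' := hl.congr (s' := s') fun r hr => h2 r (by omega)
    obtain ⟨v1, v2, v3⟩ := hv d hd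
    have g1 := (evals_load hf hl' (e := V rSrc + V rI) (x := x₀ + d)
      ⟨by simp, by simp [h3, h4]⟩ (by omega)).2
    rw [show view ((k + 2) * N) (arrayLength m) s' (x₀ + d) =
      view ((k + 2) * N) (arrayLength m) s (x₀ + d) by rw [view, view, h1]] at g1
    generalize (view ((k + 2) * N) (arrayLength m) s (x₀ + d)).2 = v at *
    have e1 : ((loadIm (V rSrc + V rI) + V rn * V rS) / (2 * V rn * V rS)).eval s' =
        sc (e * N + d) := by
      simp only [Expr.eval_div, Expr.eval_add, g1.2, Expr.eval_mul, Expr.eval_var, hl'.n, hl'.S,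
        Expr.eval_two]
      push_cast
      exact v3
    refine LinSpec.seq_assign ?_ ?_
    · have b1 := h.mul_pow_lt (c := 2) (e := 24) (by norm_num) (by norm_num)
      have b2 := h.mul_pow_lt (c := 2) (e := 21) (by norm_num) (by norm_num)
      have b3 : (2 : ℤ) ^ m * (2 ^ m) ^ 20 ≤ (2 ^ m) ^ 20 * (2 ^ m) ^ 4 := by
        rw [mul_comm]; gcongr
        exact le_self_pow₀ (one_le_pow₀ (by norm_num)) (by norm_num)
      simp only [Expr.safe_div, Expr.safe_add, Expr.safe_mul, Expr.safe_var, Expr.safe_two, g1.1,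
        Expr.eval_add, g1.2, Expr.eval_mul, Expr.eval_var, Expr.eval_two, hl'.n, hl'.S, true_and,
        and_true]
      push_cast at b1 b2 ⊢
      refine ⟨⟨v1, ?_⟩, ⟨by positivity, ?_⟩⟩
      · calc v + 2 ^ m * (2 ^ m) ^ 20 ≤ 2 * (2 ^ m) ^ 24 := by
              rw [show (2 : ℤ) * (2 ^ m) ^ 24 = (2 ^ m) ^ 20 * (2 ^ m) ^ 4 +
                (2 ^ m) ^ 20 * (2 ^ m) ^ 4 by ring]
              linarith
          _ < _ := b1
      · calc (2 : ℤ) * 2 ^ m * (2 ^ m) ^ 20 = 2 * (2 ^ m) ^ 21 := by ring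
          _ < _ := b2
    rw [e1]
    obtain ⟨b, a, i1, i2, i3, i4⟩ := h5
    have hbw : (b : ℤ) < 2 ^ w := by
      rcases i4 with ⟨rfl, -⟩ | ⟨-, i4⟩
      · simp
      · rw [← i4]; exact hsc a
    refine LinSpec.ite ⟨by simp, by simp, ?_, ?_⟩ ?_ ?_
    · simp [i1]; exact ⟨by positivity, hbw⟩
    · simp; exact ⟨by positivity, hsc _⟩
    · intro ht
      simp [i1] at ht
      refine LinSpec.seq_assign (by simp) (LinSpec.assign (by simp) ⟨by simp [h4], h1,
        fun r hr => ?_, by simp [h3], by simp, sc (e * N + d), e * N + d, by simp, ?_, ?_, ?_⟩)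
      · simp [show r ≠ 30 by omega, show r ≠ 17 by omega, show r ≠ 16 by omega,
          show r ≠ 31 by omega, h2 r hr]
      · simp [h4, h2, he, hN]
      · intro f hf'
        rcases Nat.lt_succ_iff_lt_or_eq.mp (show f < e * N + d + 1 from hf') with hf' | rfl
        · exact (i3 f hf').trans ht.le
        · exact le_rfl
      · exact Or.inr ⟨by omega, rfl⟩
    · intro ht
      simp [i1] at ht
      refine LinSpec.skip ⟨by simp [h4], h1, fun r hr => ?_, by simp [h3], by simp,
        b, a, by simp [i1], by simp [i2], ?_, ?_⟩
      · simp [show r ≠ 30 by omega, show r ≠ 31 by omega, h2 r hr]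
      · intro f hf'
        rcases Nat.lt_succ_iff_lt_or_eq.mp (show f < e * N + d + 1 from hf') with hf' | rfl
        · exact i3 f hf'
        · exact ht
      · rcases i4 with i4 | i4
        · exact Or.inl i4
        · exact Or.inr ⟨by omega, i4.2⟩
  · exact Nat.add_le_add_left (Nat.mul_le_mul_left _ (show 1 + _ + 7 ≤ _ by omega)) _
  · rintro s' ⟨h1, h2, -, -, h5⟩
    exact ⟨h1, h2, by rw [add_mul, one_mul]; exact h5⟩

end

/-- Score all codes with the quotient `rCode`. -/
def scoreCmd (k last : ℕ) (q : ℕ → ℕ) (g : ℕ) : Cmd :=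
  .for rI (2 * V rN) (matchBody k last (fun r => q (r + 1)) g) ;;
  .for rI (V rn) (inputBody k (q 0)) ;; .assign rSrc (V rn) ;; fftCmd ;;
  .for rI (V rn) sqBody ;; .assign rSrc (V rSrc + V rn) ;; fftCmd ;; .for rI (V rN) bestBody

/-- A constant for the time of `scoreCmd`. -/
def scoreConst (k last : ℕ) (q : ℕ → ℕ) (g : ℕ) : ℕ :=
  12 + 2 * ((matchBody k last (fun r => q (r + 1)) g).size + 10) + 2 * ((inputBody k (q 0)).size + 8) +
    2 * (40 + 4 * (fftBody.size + 8)) + 2 * (sqBody.size + 8) + 2 * (bestBody.size + 8) + 6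

section
variable {w k N σ m : ℕ}

theorem Ready.congr {s s' : Core} (h : Ready k N m s) (h1 : ∀ r < 9, s'.reg r = s.reg r)
    (h2 : ∀ y < 2 ^ m, view ((k + 2) * N) (arrayLength m) s' y =
      view ((k + 2) * N) (arrayLength m) s y) : Ready k N m s' where
  hN := by rw [h1 _ (by norm_num), h.hN]
  hm := by rw [h1 _ (by norm_num), h.hm]
  layout := h.layout.congr h1
  table j hj := by rw [h2 j hj, h.table j hj]

theorem codeScore_le (N : ℕ) (x : ℕ → ℕ → ℕ) (last : ℕ) (q : ℕ → ℕ) (g f : ℕ) :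
    codeScore N x last q g f ≤ N :=
  (Finset.card_filter_le _ _).trans (Finset.card_range N).le

theorem Sizes.N_lt (h : Sizes w k N σ m) : (N : ℤ) < 2 ^ w := by
  have h1 := h.fits.n_lt
  have h3 : (2 : ℤ) * N ≤ 2 ^ m := by exact_mod_cast h.two_mul_N_le
  push_cast at h1; omega

theorem Sizes.pow_lt_word (h : Sizes w k N σ m) : (2 : ℤ) ^ m < 2 ^ w := by
  have h1 := h.fits.n_lt
  have : (0 : ℤ) < 2 ^ m := by positivity
  push_cast at h1; omega

/-- One round scores the `N` codes `e * N + d`, `d < N`. The digits of `e` shift the strings from `q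
1` on and enter through the common string; the lowest digit shifts `q 0` and is handled for all `d`
at once by the correlation. -/
theorem scoreCmd_spec {x : ℕ → ℕ → ℕ} {last g e : ℕ} {q : ℕ → ℕ} {s : Core}
    (h : Sizes w k N σ m) (hx : ∀ j i, x j i < σ) (hlast : last < k) (hq : ∀ r < g + 1, q r < k)
    (he : (e : ℤ) < 2 ^ w) (hr : Ready k N m s) (hs : Holds k N x s) (hse : s.reg rCode = e)
    (hb : IsBest (codeScore N x last q (g + 1)) (e * N) s) :
    Spec w (scoreCmd k last q g) s (scoreConst k last q g * (2 ^ m * m)) fun s' =>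
      Ready k N m s' ∧ (∀ r < 16, s'.reg r = s.reg r) ∧
      (∀ a : ℤ, a < ((k * N : ℕ) : ℤ) → s'.mem a = s.mem a) ∧
      IsBest (codeScore N x last q (g + 1)) ((e + 1) * N) s' := by
  have hf := h.fits
  have hNw := h.N_lt
  have hmw := h.pow_lt_word
  have h2N := h.two_mul_N_le
  have hxw : ∀ j i, (x j i : ℤ) < 2 ^ w := fun j i => by
    have h1 := hx j i
    have h2 : (σ : ℤ) ≤ 2 ^ m := by exact_mod_cast h.σ_le
    omega
  set D := arrayLength m with hD
  have hDm : D = 2 ^ m + (m + 1) * 2 ^ m + (m + 1) * 2 ^ m := by rw [hD, arrayLength]; ring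
  have hm1 : (m + 1) * 2 ^ m = m * 2 ^ m + 2 ^ m := by ring
  have hkN : (k * N : ℕ) ≤ (k + 2) * N := Nat.mul_le_mul_right _ (by omega)
  set Y : ℕ → ℕ := common N (2 ^ m) x last (fun r => q (r + 1)) g e with hY
  have hY1 : ∀ i, N ≤ i → 2 ^ m ≤ Y i := fun i hi => by
    rw [hY, common, if_neg (by omega)]
  have hY2 : ∀ i, Y i < σ ∨ 2 ^ m ≤ Y i := fun i => by
    rw [hY, common]; split_ifs
    · exact Or.inl (hx _ _)
    · exact Or.inr le_rfl
  have hYw : ∀ i < 2 * N, (Y i : ℤ) < 2 ^ w := fun i _ => by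
    rw [hY, common]; split_ifs
    · exact hxw _ _
    · exact_mod_cast hmw
  set a : ℕ → ℤ := fun p => if Y (p % (2 * N)) = p / (2 * N) then 1 else 0 with ha
  set b : ℕ → ℤ := fun l => if x (q 0) ((2 ^ m - l) % 2 ^ m % (2 * N) % N) =
    (2 ^ m - l) % 2 ^ m / (2 * N) then 1 else 0 with hb'
  have ha1 : ∀ p, a p = 0 ∨ a p = 1 := fun p => by simp only [ha]; split_ifs <;> simp
  have hb1 : ∀ p, b p = 0 ∨ b p = 1 := fun p => by simp only [hb']; split_ifs <;> simp
  set P := (k + 2) * N with hP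
  have hWB : ∀ j < 2 ^ m, _ := fun j (hj : j < 2 ^ m) => abs_powFix_le h.four_le hj.le
  let T' (n : ℕ) := 2 + (n + 1) * ((inputBody k (q 0)).size + 8) + (2 +
    (4 + (m + 1) * (18 + (n + 1) * (fftBody.size + 8)) + (2 + (n + 1) * (sqBody.size + 8) + (4 +
    (4 + (m + 1) * (18 + (n + 1) * (fftBody.size + 8)) + (2 + (N + 1) * (bestBody.size + 8)))))))
  refine Spec.mono (Spec.seq (T' := T' (2 ^ m)) (match_spec h.N_pos h.k_pos h.two_mul_lt (fun j _ i _ => hxw j i) hlast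
    (fun r => q (r + 1)) g (fun r hr => hq _ (by omega)) he hs hr.hN hr.layout.n hse)
    fun s1 ⟨a1, a2, a3⟩ => ?_) ?_ fun _ h => h
  · have v1 : ∀ y, view P D s1 y = view P D s y := fun y => by
      rw [view, view, a2 _ (Or.inr (by omega)), a2 _ (Or.inr (by omega))]
    have r1 := hr.congr (fun r hr => a1 r (by omega)) fun y _ => v1 y
    have o1 : Holds k N x s1 := hs.congr fun a ha => a2 a (Or.inl ha)
    refine Spec.seq (input_spec hf r1.layout (by omega) h.N_pos h.k_pos rfl h.two_mul_lt
      (fun j _ i _ => hxw j i) (hq 0 (by omega)) o1 r1.hN hYw a3) fun s2 f2 => ?_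
    have r2 := r1.congr (fun r hr => f2.reg r (by omega)) fun y hy => f2.old y hy
    refine Spec.seq_assign (by simp) ?_
    rw [Expr.eval_var, r2.layout.n]
    set s3 := s2.set rSrc ((2 ^ m : ℕ) : ℤ) with hs3
    have q3 : ∀ r < 20, s3.reg r = s2.reg r := fun r hr => by simp [hs3, hr.ne]
    have r3 : Ready k N m s3 := r2.congr (fun r hr => q3 r (by omega)) fun y hy => rfl
    refine Spec.seq (fftCmd_spec hf r3.layout r3.hm (by omega) (by simp [hs3]) r3.table hWB
      f2.new fun t ht j hj => abs_level₁_le h.four_le ha1 hb1 ht hj) ?_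
    rintro s4 ⟨b1, b2, b3, b4, b5⟩
    have r4 : Ready k N m s4 := r3.congr (fun r hr => b1 r (by omega)) fun y hy => b3 y (by omega)
    refine Spec.seq (sqBody_spec hf r4.layout (by omega) b4 b5
      fun j hj => abs_level₁_le h.four_le ha1 hb1 le_rfl hj) fun s5 f5 => ?_
    have r5 : Ready k N m s5 := r4.congr (fun r hr => f5.reg r (by omega))
      fun y hy => f5.old y (by omega)
    refine Spec.seq_assign (by simp) ?_
    rw [show (V rSrc + V rn).eval s5 = ((2 ^ m + m * 2 ^ m + 2 ^ m : ℕ) : ℤ) by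
      rw [Expr.eval_add, Expr.eval_var, Expr.eval_var, f5.reg _ (by norm_num), b4, r5.layout.n]
      push_cast; ring]
    set s6 := s5.set rSrc ((2 ^ m + m * 2 ^ m + 2 ^ m : ℕ) : ℤ) with hs6
    have q6 : ∀ r < 20, s6.reg r = s5.reg r := fun r hr => by simp [hs6, hr.ne]
    have r6 : Ready k N m s6 := r5.congr (fun r hr => q6 r (by omega)) fun y hy => rfl
    refine Spec.seq (fftCmd_spec hf r6.layout r6.hm (by omega) (by simp [hs6]) r6.table hWB
      f5.new fun t ht j hj => abs_level₂_le h.four_le ha1 hb1 ht hj) ?_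
    rintro s7 ⟨c1, c2, c3, c4, c5⟩
    have r7 : Ready k N m s7 := r6.congr (fun r hr => c1 r (by omega)) fun y hy => c3 y (by omega)
    have q7 : ∀ r < 20, s7.reg r = s.reg r := fun r hr => by
      rw [c1 r hr, q6 r hr, f5.reg r (by omega), b1 r hr, q3 r hr, f2.reg r (by omega),
        a1 r (by omega)]
    refine Spec.mono (best_spec h r7.layout r7.hN (e := e) ((q7 _ (by norm_num)).trans hse) c4
      (by omega) (sc := codeScore N x last q (g + 1)) (fun f => ?_) (fun d hd => ?_)
      (hb.congr (q7 _ (by norm_num)) (q7 _ (by norm_num)))) le_rfl ?_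
    · have := codeScore_le N x last q (g + 1) f
      omega
    · have e1 := c5 d (by omega)
      change _ = level₂ m a b m d at e1
      rw [e1]
      obtain ⟨g1, g2⟩ := level₂_last h.four_le ha1 hb1 (show d < 2 ^ m by omega)
      refine ⟨g1, (le_abs_self _).trans (abs_level₂_le h.four_le ha1 hb1 le_rfl (by omega)).2, ?_⟩
      rw [g2, ← card_common_eq (n := 2 ^ m) h.N_pos hx h.σ_le last q g e hd]
      exact sum_indicator_eq_card h.N_pos h.le_pow hd Y (x (q 0)) (fun i _ => hx _ i) hY1 hY2
    · rintro s8 ⟨d1, d2, d3⟩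
      refine ⟨r7.congr (fun r hr => d2 r (by omega)) fun y _ => by rw [view, view, d1],
        fun r hr => (d2 r hr).trans (q7 r (by omega)), fun a ha => ?_, d3⟩
      have haP : a < (P : ℤ) := by omega
      rw [d1, c2 a haP, hs6, Core.set_mem, f5.low a haP, b2 a haP, hs3, Core.set_mem, f2.low a haP,
        a2 a (Or.inl ha)]
  · obtain ⟨e1, e2, e3, e4⟩ := le_mul_self (n := 2 ^ m) (m := m) Nat.one_le_two_pow
      (by have := h.four_le; omega)
    have key : ∀ A n x1 x2 x3 x4 x5 : ℕ, 1 ≤ A → n + 1 ≤ 2 * A → m + 1 ≤ 2 * A → 2 * N ≤ n →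
        (m + 1) * (n + 1) ≤ 4 * A →
        2 + (2 * N + 1) * (x1 + 10) + (2 + (n + 1) * (x2 + 8) + (2 +
          (4 + (m + 1) * (18 + (n + 1) * (x3 + 8)) + (2 + (n + 1) * (x4 + 8) + (4 +
          (4 + (m + 1) * (18 + (n + 1) * (x3 + 8)) + (2 + (N + 1) * (x5 + 8)))))))) ≤
        (12 + 2 * (x1 + 10) + 2 * (x2 + 8) + 2 * (40 + 4 * (x3 + 8)) + 2 * (x4 + 8) +
          2 * (x5 + 8) + 6) * A := by
      intro A n x1 x2 x3 x4 x5 h1 h2 h3 h4 h5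
      have h6 : 2 * N + 1 ≤ 2 * A := by omega
      have h7 : N + 1 ≤ 2 * A := by omega
      calc _ = 22 * 1 + (2 * N + 1) * (x1 + 10) + (n + 1) * (x2 + 8) + 2 * ((m + 1) * 18 +
            ((m + 1) * (n + 1)) * (x3 + 8)) + (n + 1) * (x4 + 8) + (N + 1) * (x5 + 8) := by ring
        _ ≤ 22 * A + (2 * A) * (x1 + 10) + (2 * A) * (x2 + 8) + 2 * ((2 * A) * 18 +
            (4 * A) * (x3 + 8)) + (2 * A) * (x4 + 8) + (2 * A) * (x5 + 8) := by gcongr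
        _ = (22 + 2 * (x1 + 10) + 2 * (x2 + 8) + 2 * (36 + 4 * (x3 + 8)) + 2 * (x4 + 8) +
          2 * (x5 + 8)) * A := by ring
        _ ≤ _ := Nat.mul_le_mul_right _ (by omega)
    exact key _ _ _ _ _ _ _ e1 e2 e3 h2N e4

end

/-- The expression `N ^ g`. -/
def powExpr : ℕ → Expr
  | 0 => 1
  | g + 1 => powExpr g * V rN

/-- The maximum of the scores of all codes. -/
def bestScore (N : ℕ) (x : ℕ → ℕ → ℕ) (last : ℕ) (q : ℕ → ℕ) (g : ℕ) : ℕ :=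
  (Finset.range (N ^ g)).sup (codeScore N x last q g)

/-- Compute the maximal score and a code that attains it. -/
def solveCmd (k last : ℕ) (q : ℕ → ℕ) (g : ℕ) : Cmd :=
  setupCmd k ;; .assign 11 (powExpr g) ;; .assign rBest 0 ;; .assign rArg 0 ;;
  .for rCode (V 11) (scoreCmd k last q g)

/-- A constant for the time of `solveCmd`. -/
def solveConst (k last : ℕ) (q : ℕ → ℕ) (g : ℕ) : ℕ :=
  setupConst k + (Cmd.assign 11 (powExpr g)).size + 6 + 2 * (scoreConst k last q g + 8)

/-- Write the first digits in base `N` of the number in register `B`. -/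
def digitsCmd (B : ℕ) : ℕ → Cmd
  | 0 => .skip
  | j + 1 => digitsCmd B j ;; .assign (j + 1) (V B % V (B + 1)) ;; .assign B (V B / V (B + 1))

/-- The algorithm for the shift distance. -/
def exactCmd (k : ℕ) : Cmd :=
  solveCmd k (k - 1) id (k - 2) ;; .assign (k + 50) (V rArg) ;; .assign (k + 51) (V rN) ;;
  .assign 0 (V rBest) ;; digitsCmd (k + 50) (k - 1)

/-- The strings of the `a`-th group. -/
def group (k g a r : ℕ) : ℕ := min (a * g + r) (k - 2)

/-- Add up the numbers of mismatches of the first groups. -/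
def groupsCmd (k g : ℕ) : ℕ → Cmd
  | 0 => .skip
  | a + 1 => groupsCmd k g a ;; solveCmd k (k - 1) (group k (g + 1) a) g ;;
      .assign 2 (V 2 + V rN - V rBest)

def groupsConst (k g : ℕ) : ℕ → ℕ
  | 0 => 0
  | a + 1 => groupsConst k g a + solveConst k (k - 1) (group k (g + 1) a) g + 6

/-- The approximation algorithm. -/
def approxCmd (k g ℓ : ℕ) : Cmd := groupsCmd k g ℓ ;; .assign 0 (.lit k * V 2)

section
variable {w k N σ m : ℕ}

theorem eval_powExpr {s : Core} (hN : s.reg rN = N) (g : ℕ) :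
    (powExpr g).eval s = ((N ^ g : ℕ) : ℤ) := by
  induction g with
  | zero => simp [powExpr]
  | succ g ih => simp [powExpr, ih, hN, pow_succ]

theorem safe_powExpr (s : Core) (g : ℕ) : (powExpr g).Safe w s := by
  induction g with
  | zero => simp [powExpr]
  | succ g ih => simp [powExpr, ih]

/-- Only `N ^ g` rounds are needed for `N ^ (g + 1)` codes, since each round covers all values of
the lowest digit. -/
theorem solveCmd_spec {x : ℕ → ℕ → ℕ} {last g : ℕ} {q : ℕ → ℕ} {s : Core} (h : Sizes w k N σ m)
    (hx : ∀ j i, x j i < σ) (hlast : last < k) (hq : ∀ r < g + 1, q r < k)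
    (hg : (N : ℤ) ^ g < 2 ^ w) (hN : s.reg rN = N) (hσ : s.reg 1 = σ) (hs : Holds k N x s) :
    Spec w (solveCmd k last q g) s (solveConst k last q g * (N ^ g * (2 ^ m * m))) fun s' =>
      (∀ r < 3, s'.reg r = s.reg r) ∧ Holds k N x s' ∧
      s'.reg rBest = bestScore N x last q (g + 1) ∧
      ∃ f < N ^ (g + 1), s'.reg rArg = f ∧ codeScore N x last q (g + 1) f =
        bestScore N x last q (g + 1) := by
  refine Spec.mono (Spec.seq (setupCmd_spec h hN hσ) fun s1 ⟨a1, a2, a3⟩ =>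
    Spec.seq_assign (safe_powExpr _ _) (Spec.seq_assign (by simp) (Spec.seq_assign (by simp)
    (Spec.for (T := scoreConst k last q g * (2 ^ m * m)) (fun e s' => Ready k N m s' ∧
      (∀ r < 3, s'.reg r = s.reg r) ∧ Holds k N x s' ∧ s'.reg 11 = ((N ^ g : ℕ) : ℤ) ∧
      s'.reg rCode = e ∧ IsBest (codeScore N x last q (g + 1)) (e * N) s') (N ^ g)
      (by exact_mod_cast hg) ?_ ?_ ?_)))) ?_ ?_
  · rw [eval_powExpr a1.hN]
    refine ⟨a1.congr (fun r hr => ?_) fun y _ => rfl, fun r hr => ?_, hs.congr fun a ha => ?_,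
      by simp, by simp, 0, 0, by simp, by simp, fun f hf => by omega, Or.inl ⟨rfl, rfl⟩⟩
    · simp [show r ≠ 15 by omega, show r ≠ 17 by omega, show r ≠ 16 by omega, show r ≠ 11 by omega]
    · simp [show r ≠ 15 by omega, show r ≠ 17 by omega, show r ≠ 16 by omega, show r ≠ 11 by omega,
        a2 r hr]
    · simp only [Core.set_mem]
      exact a3 a (ha.trans_le (by exact_mod_cast Nat.mul_le_mul_right _ (by omega)))
  · rintro e he s' ⟨-, -, -, h1, h2, -⟩
    exact ⟨h2, by simp, by simp [h1]⟩
  · rintro e he s' ⟨h1, h2, h3, h4, h5, h6⟩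
    have hew : (e : ℤ) < 2 ^ w := lt_trans (by exact_mod_cast he) hg
    refine Spec.mono (scoreCmd_spec h hx hlast hq hew h1 h3 h5 h6) le_rfl ?_
    rintro s'' ⟨j1, j2, j3, j4⟩
    refine ⟨(j2 _ (by norm_num)).trans h5, j1.congr (fun r hr => ?_) fun _ _ => rfl, fun r hr => ?_,
      h3.congr fun a ha => ?_, ?_, by simp, j4.congr (by simp) (by simp)⟩
    · simp [show r ≠ 15 by omega]
    · simp [show r ≠ 15 by omega, j2 r (by omega), h2 r hr]
    · simp [j3 a ha]
    · simp [j2, h4]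
  · have hA : 1 ≤ 2 ^ m * m := Nat.mul_pos (by positivity) (by have := h.four_le; omega)
    have hG : 1 ≤ N ^ g := Nat.pow_pos h.N_pos
    have key : ∀ A G x1 x2 x3 : ℕ, 1 ≤ A → 1 ≤ G →
        x1 * A + (x2 + (2 + (2 + (2 + (G + 1) * (1 + x3 * A + 7))))) ≤
          (x1 + x2 + 6 + 2 * (x3 + 8)) * (G * A) := by
      intro A G x1 x2 x3 hA hG
      have hGA : 1 ≤ G * A := Nat.mul_pos hG hA
      have hGA' : A ≤ G * A := Nat.le_mul_of_pos_left _ hG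
      calc _ = x1 * A + (x2 + 6) * 1 + (G + 1) * (x3 * A + 8 * 1) := by ring
        _ ≤ x1 * (G * A) + (x2 + 6) * (G * A) + (2 * G) * (x3 * A + 8 * A) := by gcongr; omega
        _ = _ := by ring
    exact key _ _ _ _ _ hA hG
  · rintro s' ⟨h1, h2, h3, h4, h5, b, a, i1, i2, i3, i4⟩
    rw [← pow_succ] at i3 i4
    have hF : 0 < N ^ (g + 1) := Nat.pow_pos h.N_pos
    -- If no score ever exceeded `0`, then code `0` itself has score `0` and attains the maximum.
    have i5 : a < N ^ (g + 1) ∧ codeScore N x last q (g + 1) a = b := by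
      rcases i4 with ⟨rfl, rfl⟩ | i4
      · exact ⟨hF, Nat.le_zero.mp (i3 0 hF)⟩
      · exact i4
    have i6 : b = bestScore N x last q (g + 1) := by
      refine le_antisymm ?_ (Finset.sup_le fun f hf => i3 f (Finset.mem_range.mp hf))
      rw [← i5.2]
      exact Finset.le_sup (f := codeScore N x last q (g + 1)) (Finset.mem_range.mpr i5.1)
    exact ⟨h2, h3, by rw [i1, i6], a, i5.1, i2, i5.2.trans i6⟩

theorem digitsCmd_spec {B f : ℕ} (hN : 0 < N) (hNw : (N : ℤ) < 2 ^ w) (hf : (f : ℤ) < 2 ^ w)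
    {s : Core} (hB : s.reg B = f) (hB' : s.reg (B + 1) = N) {J : ℕ} (hJ : J < B) :
    LinSpec w (digitsCmd B J) s fun s' => s'.reg B = ((f / N ^ J : ℕ) : ℤ) ∧
      s'.reg (B + 1) = N ∧ s'.reg 0 = s.reg 0 ∧ ∀ j < J, s'.reg (j + 1) = ((f / N ^ j % N : ℕ) : ℤ) := by
  induction J with
  | zero => exact LinSpec.skip ⟨by simp [hB], hB', rfl, fun j hj => absurd hj (Nat.not_lt_zero j)⟩
  | succ J ih =>
    refine LinSpec.seq (ih (by omega)) ?_
    rintro s' ⟨h1, h2, h3, h4⟩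
    have hle : ((f / N ^ J : ℕ) : ℤ) ≤ f := by exact_mod_cast Nat.div_le_self _ _
    have e1 : (V B % V (B + 1)).eval s' = ((f / N ^ J % N : ℕ) : ℤ) := by
      simp [h1, h2]
    refine LinSpec.seq_assign ?_ (LinSpec.assign ?_ ⟨?_, ?_, ?_, fun j hj => ?_⟩)
    · simp only [Expr.safe_mod, Expr.safe_var, Expr.eval_var, h1, h2, true_and]
      refine ⟨⟨by positivity, by omega⟩, by omega, by omega⟩
    · rw [e1]
      simp only [Expr.safe_div, Expr.safe_var, Expr.eval_var, Core.set_reg,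
        if_neg (show B ≠ J + 1 by omega), if_neg (show B + 1 ≠ J + 1 by omega), h1, h2, true_and]
      refine ⟨⟨by positivity, by omega⟩, by omega, by omega⟩
    · simp [show B ≠ J + 1 by omega, show B ≠ J by omega, h1, h2, ← Int.natCast_ediv,
        Nat.div_div_eq_div_mul, pow_succ]
    · simp [show B ≠ J by omega, h2]
    · simp [show 0 ≠ B by omega, h3]
    · rw [e1]
      rcases Nat.lt_succ_iff_lt_or_eq.mp hj with hj | rfl
      · simp [show j + 1 ≠ B by omega, show j ≠ J by omega, h4 j hj]
      · simp [show j + 1 ≠ B by omega]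

/-- The output registers `0, …, k - 1` overlap `rN`, and for large `k` further working registers.
The best code and `N` are therefore moved to registers `k + 50` and `k + 51` before the digits are
written. -/
theorem exactCmd_spec {x : ℕ → ℕ → ℕ} {s : Core} (h : Sizes w k N σ m) (hk : 2 ≤ k)
    (hx : ∀ j i, x j i < σ) (hg : (N : ℤ) ^ (k - 1) < 2 ^ w) (hN : s.reg rN = N)
    (hσ : s.reg 1 = σ) (hs : Holds k N x s) :
    Spec w (exactCmd k) s ((solveConst k (k - 1) id (k - 2) + 6 + (digitsCmd (k + 50) (k - 1)).size) *
      (N ^ (k - 2) * (2 ^ m * m))) fun s' =>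
      s'.reg 0 = bestScore N x (k - 1) id (k - 1) ∧
      ∃ f < N ^ (k - 1), (∀ j < k - 1, s'.reg (j + 1) = ((f / N ^ j % N : ℕ) : ℤ)) ∧
        codeScore N x (k - 1) id (k - 1) f = bestScore N x (k - 1) id (k - 1) := by
  have hNw := h.N_lt
  have hk1 : k - 2 + 1 = k - 1 := by omega
  have hle : (N : ℤ) ^ (k - 2) ≤ N ^ (k - 1) :=
    pow_le_pow_right₀ (by exact_mod_cast h.N_pos) (by omega)
  refine Spec.mono (Spec.seq (solveCmd_spec h hx (by omega) (fun r hr => by simp only [id]; omega)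
    (hle.trans_lt hg) hN hσ hs) (T' := 6 + (digitsCmd (k + 50) (k - 1)).size) ?_) ?_ fun _ h => h
  · rw [hk1]
    rintro s1 ⟨a1, a2, a3, f, hf, a4, a5⟩
    have hfw : (f : ℤ) < 2 ^ w := lt_trans (by exact_mod_cast hf) hg
    refine Spec.mono (Spec.seq_assign (by simp) (Spec.seq_assign (by simp) (Spec.seq_assign (by simp)
      (digitsCmd_spec (f := f) h.N_pos hNw hfw ?_ ?_ (J := k - 1) (by omega))))) ?_ ?_
    · simp [a4]
    · simp [a1, hN]
    · change 2 + (2 + (2 + _)) ≤ _; omega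
    · rintro s' ⟨-, -, h3, h4⟩
      refine ⟨?_, f, hf, h4, a5⟩
      rw [h3]
      simp [a3]
  · have hA : 1 ≤ N ^ (k - 2) * (2 ^ m * m) :=
      Nat.mul_pos (Nat.pow_pos h.N_pos)
        (Nat.mul_pos (by positivity) (by have := h.four_le; omega))
    rw [add_assoc, add_mul]
    exact Nat.add_le_add_left (Nat.le_mul_of_pos_right _ hA) _

/-- Register `2` is the accumulator. It is `0` at the start, and solving a group preserves registers
`0` to `2` and the strings, so the groups can be treated in turn. -/
theorem groupsCmd_spec {x : ℕ → ℕ → ℕ} {g : ℕ} {s : Core} (h : Sizes w k N σ m) (hk : 2 ≤ k)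
    (hx : ∀ j i, x j i < σ) (hg : (N : ℤ) ^ g < 2 ^ w) (hN : s.reg rN = N)
    (hσ : s.reg 1 = σ) (h2 : s.reg 2 = 0) (hs : Holds k N x s) (J : ℕ) :
    Spec w (groupsCmd k g J) s (groupsConst k g J * (N ^ g * (2 ^ m * m))) fun s' =>
      s'.reg rN = N ∧ s'.reg 1 = σ ∧ Holds k N x s' ∧ s'.reg 2 =
        ((∑ a ∈ Finset.range J, (N - bestScore N x (k - 1) (group k (g + 1) a) (g + 1)) : ℕ) : ℤ) := by
  induction J with
  | zero => exact Spec.mono (Spec.skip ⟨hN, hσ, hs, by simp [h2]⟩) (Nat.zero_le _) fun _ h => h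
  | succ J ih =>
    refine Spec.mono (Spec.seq ih (T' := solveConst k (k - 1) (group k (g + 1) J) g *
      (N ^ g * (2 ^ m * m)) + 6) ?_) ?_ fun _ h => h
    · rintro s1 ⟨a1, a2, a3, a4⟩
      refine Spec.seq (solveCmd_spec h hx (by omega) (fun r hr => by rw [group]; omega)
        hg a1 a2 a3) ?_
      rintro s2 ⟨b1, b2, b3, -⟩
      refine Spec.mono (Spec.assign (by simp) ⟨?_, ?_, b2.congr fun _ _ => rfl, ?_⟩) le_rfl fun _ h => h
      · simp [b1, a1]
      · simp [b1, a2]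
      · have : bestScore N x (k - 1) (group k (g + 1) J) (g + 1) ≤ N :=
          Finset.sup_le fun f _ => codeScore_le _ _ _ _ _ _
        rw [Finset.sum_range_succ, Nat.cast_add, Nat.cast_sub this, ← a4]
        simp [b1, b3, a1]; ring
    · have hA : 1 ≤ N ^ g * (2 ^ m * m) :=
        Nat.mul_pos (Nat.pow_pos h.N_pos)
          (Nat.mul_pos (by positivity) (by have := h.four_le; omega))
      rw [groupsConst, add_mul, add_mul]
      omega

theorem approxCmd_spec {x : ℕ → ℕ → ℕ} {g : ℕ} {s : Core} (h : Sizes w k N σ m) (hk : 2 ≤ k)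
    (hx : ∀ j i, x j i < σ) (hg : (N : ℤ) ^ g < 2 ^ w) (hN : s.reg rN = N)
    (hσ : s.reg 1 = σ) (h2 : s.reg 2 = 0) (hs : Holds k N x s) (ℓ : ℕ) :
    Spec w (approxCmd k g ℓ) s ((groupsConst k g ℓ + 4) * (N ^ g * (2 ^ m * m))) fun s' =>
      s'.reg 0 = ((k * ∑ a ∈ Finset.range ℓ,
        (N - bestScore N x (k - 1) (group k (g + 1) a) (g + 1)) : ℕ) : ℤ) := by
  have hA : 1 ≤ N ^ g * (2 ^ m * m) :=
    Nat.mul_pos (Nat.pow_pos h.N_pos)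
      (Nat.mul_pos (by positivity) (by have := h.four_le; omega))
  refine Spec.mono (Spec.seq (groupsCmd_spec h hk hx hg hN hσ h2 hs ℓ) (T' := 4) ?_) ?_ fun _ h => h
  · rintro s1 ⟨-, -, -, a4⟩
    refine Spec.mono (Spec.assign (by simp) ?_) le_rfl fun _ h => h
    simp [a4]
  · rw [add_mul]; omega

end

/-! ### Codes versus offsets, and the approximation guarantee. -/

/-- Every family of offsets has a code. -/
theorem exists_code {N : ℕ} (g : ℕ) {δ : ℕ → ℕ} (hδ : ∀ r, δ r < N) :
    ∃ f < N ^ g, ∀ r < g, f / N ^ r % N = δ r := by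
  induction g generalizing δ with
  | zero => exact ⟨0, by simp, fun r hr => absurd hr (Nat.not_lt_zero r)⟩
  | succ g ih =>
    obtain ⟨f, hf, h⟩ := ih fun r => hδ (r + 1)
    have h0 := hδ 0
    have hN : 0 < N := by omega
    refine ⟨f * N + δ 0, ?_, fun r hr => ?_⟩
    · calc f * N + δ 0 < (f + 1) * N := by rw [add_mul]; omega
        _ ≤ N ^ g * N := Nat.mul_le_mul_right _ hf
        _ = _ := (pow_succ _ _).symm
    · rcases r with _ | r
      · simp [Nat.mod_eq_of_lt h0]
      · rw [pow_succ', ← Nat.div_div_eq_div_mul, mul_comm f, Nat.mul_add_div hN,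
          Nat.div_eq_of_lt h0, add_zero, h r (by omega)]

section
variable {k N σ : ℕ} {X : Fin k → Fin N → Fin σ} {x : ℕ → ℕ → ℕ}

/-- The numbers `x j i` are the characters of the strings. -/
def Represents (X : Fin k → Fin N → Fin σ) (x : ℕ → ℕ → ℕ) : Prop :=
  ∀ (j : Fin k) (i : Fin N), x j i = X j i

/-- The positions where all the shifted strings agree, in terms of the characters as numbers. -/
theorem offsetScore_eq (hk : 0 < k) (hX : Represents X x) (Δ : Fin (k - 1) → Fin N) :
    offsetScore X Δ = ((Finset.range N).filter fun i => ∀ j : Fin (k - 1),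
      x j ((i + Δ j) % N) = x (k - 1) i).card := by
  rw [offsetScore]
  refine Finset.card_bij (fun i _ => i.val) ?_ (fun i _ i' _ h => Fin.ext h) ?_
  · intro i hi
    simp only [Finset.mem_filter, Finset.mem_univ, true_and] at hi
    refine Finset.mem_filter.mpr ⟨Finset.mem_range.mpr i.2, fun j => ?_⟩
    have h1 := hi ⟨j, by omega⟩ ⟨k - 1, by omega⟩
    rw [shifted, shifted, shiftOf, shiftOf, dif_pos j.2, dif_neg (lt_irrefl _), Fin.ext_iff,
      ← hX, ← hX] at h1
    simpa [Nat.mod_eq_of_lt i.2] using h1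
  · intro i hi
    obtain ⟨hi1, hi2⟩ := Finset.mem_filter.mp hi
    rw [Finset.mem_range] at hi1
    refine ⟨⟨i, hi1⟩, Finset.mem_filter.mpr ⟨Finset.mem_univ _, ?_⟩, rfl⟩
    have key : ∀ a : Fin k, ((shifted (X a) (shiftOf Δ a) ⟨i, hi1⟩ : Fin σ) : ℕ) = x (k - 1) i := by
      intro a
      rw [shifted, ← hX, shiftOf]
      split_ifs with h
      · exact hi2 ⟨a, h⟩
      · have : a.val = k - 1 := by omega
        simp [this, Nat.mod_eq_of_lt hi1]
    intro a b
    rw [Fin.ext_iff, key, key]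

theorem offsetScore_le_kSD (X : Fin k → Fin N → Fin σ) (Δ : Fin (k - 1) → Fin N) :
    offsetScore X Δ ≤ kSD X :=
  Finset.le_sup (f := offsetScore X) (Finset.mem_univ Δ)

theorem exists_offsetScore_eq (hN : 0 < N) (X : Fin k → Fin N → Fin σ) :
    ∃ Δ, offsetScore X Δ = kSD X := by
  have : Nonempty (Fin (k - 1) → Fin N) := ⟨fun _ => ⟨0, hN⟩⟩
  obtain ⟨Δ, -, h⟩ := Finset.exists_mem_eq_sup Finset.univ Finset.univ_nonempty (offsetScore X)
  exact ⟨Δ, h.symm⟩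

theorem codeScore_le_bestScore {last : ℕ} {q : ℕ → ℕ} {g f : ℕ} (hf : f < N ^ g) :
    codeScore N x last q g f ≤ bestScore N x last q g :=
  Finset.le_sup (f := codeScore N x last q g) (Finset.mem_range.mpr hf)

theorem exists_codeScore_eq (hN : 0 < N) (x : ℕ → ℕ → ℕ) (last : ℕ) (q : ℕ → ℕ) (g : ℕ) :
    ∃ f < N ^ g, codeScore N x last q g f = bestScore N x last q g := by
  obtain ⟨f, hf, h⟩ := Finset.exists_mem_eq_sup (Finset.range (N ^ g))
    (Finset.nonempty_range_iff.mpr (Nat.pow_pos hN).ne') (codeScore N x last q g)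
  exact ⟨f, Finset.mem_range.mp hf, h.symm⟩

/-- Some of the strings match at least as well as all of them. -/
theorem kSD_le_bestScore (hk : 0 < k) (hN : 0 < N) (hX : Represents X x) {q : ℕ → ℕ} {g : ℕ}
    (hq : ∀ r < g, q r < k - 1) : kSD X ≤ bestScore N x (k - 1) q g := by
  obtain ⟨Δ, hΔ⟩ := exists_offsetScore_eq hN X
  -- Each string keeps its offset from an optimal alignment of the whole family. Repetitions in `q`,
  -- which occur when a group is padded, are harmless: the same string gets the same offset again.
  obtain ⟨f, hf, hfδ⟩ := exists_code g
    (δ := fun r => if h : q r < k - 1 then (Δ ⟨q r, h⟩).val else 0) (N := N) fun r => by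
      split_ifs
      · exact Fin.is_lt _
      · exact hN
  refine le_trans ?_ (codeScore_le_bestScore hf)
  rw [← hΔ, offsetScore_eq hk hX, codeScore]
  refine Finset.card_le_card fun i hi => ?_
  rw [Finset.mem_filter] at hi ⊢
  refine ⟨hi.1, fun r hr => ?_⟩
  rw [hfδ r hr]
  simp only [hq r hr, dite_true]
  exact hi.2 ⟨q r, hq r hr⟩

theorem codeScore_id_eq (hk : 0 < k) (hX : Represents X x) {f : ℕ} {Δ : Fin (k - 1) → Fin N}
    (hΔ : ∀ j : Fin (k - 1), (Δ j : ℕ) = f / N ^ j.val % N) :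
    codeScore N x (k - 1) id (k - 1) f = offsetScore X Δ := by
  rw [offsetScore_eq hk hX, codeScore]
  congr 1
  refine Finset.filter_congr fun i _ => ?_
  constructor
  · intro h j
    rw [hΔ]; exact h j j.2
  · intro h r hr
    have := h ⟨r, hr⟩
    rwa [hΔ] at this

theorem bestScore_id_eq (hk : 0 < k) (hN : 0 < N) (hX : Represents X x) :
    bestScore N x (k - 1) id (k - 1) = kSD X := by
  refine le_antisymm (Finset.sup_le fun f _ => ?_) (kSD_le_bestScore hk hN hX fun r hr => hr)
  rw [codeScore_id_eq hk hX (Δ := fun j => ⟨f / N ^ j.val % N, Nat.mod_lt _ hN⟩) fun j => rfl]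
  exact offsetScore_le_kSD _ _

theorem kSD_le (X : Fin k → Fin N → Fin σ) : kSD X ≤ N :=
  Finset.sup_le fun _ _ => (Finset.card_filter_le _ _).trans (Finset.card_fin N).le

/-- The mismatches of all the strings are mismatches of some group. -/
theorem sub_kSD_le_sum (hk : 2 ≤ k) (hN : 0 < N) (hX : Represents X x) {g ℓ : ℕ} (hg : 0 < g)
    (hℓ : k - 1 ≤ ℓ * g) :
    N - kSD X ≤ ∑ a ∈ Finset.range ℓ, (N - bestScore N x (k - 1) (group k g a) g) := by
  choose f _ hf using fun a => exists_codeScore_eq hN x (k - 1) (group k g a) g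
  -- String `j` is the `j % g`-th member of group `j / g` and takes the offset found there. Offsets
  -- of different groups are compatible because all are relative to the unshifted last string.
  set Δ : Fin (k - 1) → Fin N := fun j =>
    ⟨f (j.val / g) / N ^ (j.val % g) % N, Nat.mod_lt _ hN⟩ with hΔ
  have h1 := offsetScore_le_kSD X Δ
  have compl : ∀ (p : ℕ → Prop) [DecidablePred p], N - ((Finset.range N).filter p).card =
      ((Finset.range N).filter fun i => ¬ p i).card := fun p _ => by
    have := Finset.card_filter_add_card_filter_not (s := Finset.range N) p
    rw [Finset.card_range] at this
    omega
  refine (Nat.sub_le_sub_left h1 N).trans ?_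
  simp only [← hf, codeScore]
  rw [offsetScore_eq (by omega) hX, compl, Finset.sum_congr rfl fun a _ => compl _]
  -- Union bound: a position where some string `j` differs from the last one is a mismatch of the
  -- group of `j`.
  refine le_trans (Finset.card_le_card ?_) Finset.card_biUnion_le
  intro i hi
  rw [Finset.mem_filter] at hi
  obtain ⟨hi1, hi2⟩ := hi
  push Not at hi2
  obtain ⟨j, hj⟩ := hi2
  rw [Finset.mem_biUnion]
  refine ⟨j / g, Finset.mem_range.mpr ?_, Finset.mem_filter.mpr ⟨hi1, fun h => hj ?_⟩⟩
  · rw [Nat.div_lt_iff_lt_mul hg]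
    have := j.2
    omega
  · have h2 := h (j % g) (Nat.mod_lt _ hg)
    -- The truncation at `k - 2` in `group` only affects padding, not the index of an actual string.
    have h3 : group k g (j / g) (j % g) = j := by
      have h4 := Nat.div_add_mod' j.val g
      have := j.2
      rw [group, h4]; omega
    rwa [h3] at h2

/-- The sum over the groups approximates the distance. -/
theorem kSDDistance_approx (hk : 2 ≤ k) (hN : 0 < N) (hX : Represents X x) {g ℓ : ℕ} (hg : 0 < g)
    (hℓ : k - 1 ≤ ℓ * g) :
    kSDDistance X ≤ k * ∑ a ∈ Finset.range ℓ, (N - bestScore N x (k - 1) (group k g a) g) ∧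
      k * ∑ a ∈ Finset.range ℓ, (N - bestScore N x (k - 1) (group k g a) g) ≤
        ℓ * kSDDistance X := by
  refine ⟨Nat.mul_le_mul_left _ (sub_kSD_le_sum hk hN hX hg hℓ), ?_⟩
  rw [kSDDistance, mul_left_comm]
  refine Nat.mul_le_mul_left _ ?_
  calc _ ≤ ∑ _a ∈ Finset.range ℓ, (N - kSD X) := Finset.sum_le_sum fun a _ =>
        Nat.sub_le_sub_left (kSD_le_bestScore (by omega) hN hX fun r _ => by rw [group]; omega) _
    _ = _ := by simp

end

/-! ### From specified programs to running times on the machine. -/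

/-- The integers in the initial state of the machine. -/
def initCore (k N σ : ℕ) (x : ℕ → ℕ → ℕ) : Core where
  reg r := if r = 0 then N else if r = 1 then σ else 0
  mem z := if z.toNat / N < k ∧ 0 < N then x (z.toNat / N) (z.toNat % N) else 0

section
variable {w k N σ m : ℕ}

theorem rep_initCore {X : Fin k → Fin N → Fin σ} {x : ℕ → ℕ → ℕ} (hX : Represents X x) (R : ℕ) :
    Rep R w (initCore k N σ x) (input w X) where
  reg r _ := by
    simp only [input, initCore]
    split_ifs <;> simp
  mem a ha := by
    simp only [input, initCore, ha.toNat_ofInt]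
    split_ifs with h
    · rw [← hX, BitVec.ofInt_natCast]
    · simp

theorem holds_initCore (hN : 0 < N) (x : ℕ → ℕ → ℕ) : Holds k N x (initCore k N σ x) := by
  intro j hj i hi
  have h1 : (j * N + i) / N = j := by
    rw [mul_comm, Nat.mul_add_div hN, Nat.div_eq_of_lt hi, add_zero]
  have h2 : (j * N + i) % N = i := by
    rw [Nat.mul_add_mod', Nat.mod_eq_of_lt hi]
  simp only [initCore, Int.toNat_natCast, h1, h2, hj, hN, and_self, if_true]

/-- If the words are long enough, then there is a suitable size of the transform. -/
theorem exists_sizes {Q : ℕ} (hk : 0 < k) (hN : 1 ≤ N) (hσ : 1 ≤ σ)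
    (hw : ((300 + k + Q : ℕ) : ℝ) * lg σ N ≤ w) :
    ∃ m, Sizes w k N σ m ∧ (Q : ℤ) * N ^ k < 2 ^ w ∧
      ((2 ^ m * m : ℕ) : ℝ) ≤ 64 * (σ * N * lg σ N) := by
  set L : ℕ := max 2 (σ * N) with hL
  have hL2 : 2 ≤ L := le_max_left _ _
  have hL1 : 1 ≤ L := by omega
  have hLσ : σ * N ≤ L := le_max_right _ _
  have hσN : 1 ≤ σ * N := Nat.mul_pos hσ hN
  have hNL : N ≤ L := (Nat.le_mul_of_pos_left _ hσ).trans hLσ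
  have hlg : lg σ N = Real.logb 2 L := by rw [lg, hL]; push_cast; rfl
  have hL0 : (0 : ℝ) < L := by exact_mod_cast hL1
  -- All size conditions become comparisons of powers of `L`, using `2 ^ m ≤ L ^ 4` and `2 ≤ L`. The
  -- most demanding constant is `(2 ^ m) ^ 50 ≤ L ^ 200`; `k` and `Q` in the exponent pay for the
  -- factors `N ^ k` and `Q`.
  have hw' : L ^ (300 + k + Q) ≤ 2 ^ w := by
    rw [hlg, ← Real.logb_pow, Real.logb_le_iff_le_rpow (by norm_num) (by positivity),
      Real.rpow_natCast] at hw
    exact_mod_cast hw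
  set m := max 4 (Nat.clog 2 (2 * N * σ)) with hm
  have hm1 : 2 * N * σ ≤ 2 ^ m := (Nat.le_pow_clog (by norm_num) _).trans
    (Nat.pow_le_pow_right (by norm_num) (le_max_right _ _))
  have hm2 : ∀ j, 4 ≤ j → j < m → 2 ^ j < 2 * N * σ := by
    intro j h4 hj
    have : j < Nat.clog 2 (2 * N * σ) := by
      rcases lt_max_iff.mp hj with h | h <;> omega
    by_contra hle
    exact absurd (Nat.clog_le_of_le_pow (not_lt.mp hle)) (by omega)
  have hm4 : 4 ≤ m := le_max_left _ _
  have hmσ : 2 ^ m ≤ 16 * (σ * N) := by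
    rcases hm4.eq_or_lt with h | h
    · rw [← h]; omega
    · have h1 := hm2 (m - 1) (by omega) (by omega)
      have h2 : 2 ^ m = 2 * 2 ^ (m - 1) := by
        rw [← pow_succ', Nat.sub_add_cancel (by omega)]
      have h3 : 2 * N * σ = 2 * (σ * N) := by ring
      omega
  have hmL : 2 ^ m ≤ L ^ 4 := by
    rcases hm4.eq_or_lt with h | h
    · rw [← h]; exact Nat.pow_le_pow_left hL2 4
    · have h1 := hm2 (m - 1) (by omega) (by omega)
      have h2 : 2 ^ m = 2 * 2 ^ (m - 1) := by
        rw [← pow_succ', Nat.sub_add_cancel (by omega)]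
      have h3 : 2 * N * σ = 2 * (σ * N) := by ring
      calc 2 ^ m ≤ 2 ^ 3 * L := by omega
        _ ≤ L ^ 3 * L := Nat.mul_le_mul_right _ (Nat.pow_le_pow_left hL2 3)
        _ = _ := by ring
  refine ⟨m, ⟨hN, hk, hσ, hm4, hm1, hm2, ?_, ?_⟩, ?_, ?_⟩
  · have : (2 ^ m) ^ 50 ≤ 2 ^ w := by
      calc (2 ^ m) ^ 50 ≤ (L ^ 4) ^ 50 := Nat.pow_le_pow_left hmL _
        _ = L ^ 200 := by rw [← pow_mul]
        _ ≤ L ^ (300 + k + Q) := Nat.pow_le_pow_right hL1 (by omega)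
        _ ≤ _ := hw'
    exact_mod_cast this
  · have : (k + 2) * (2 ^ m) ^ 4 ≤ 2 ^ w := by
      calc (k + 2) * (2 ^ m) ^ 4 ≤ L ^ (k + 2) * (L ^ 4) ^ 4 := by
            gcongr
            exact Nat.lt_two_pow_self.le.trans (Nat.pow_le_pow_left hL2 _)
        _ = L ^ (k + 2 + 16) := by rw [← pow_mul, ← pow_add]
        _ ≤ L ^ (300 + k + Q) := Nat.pow_le_pow_right hL1 (by omega)
        _ ≤ _ := hw'
    exact_mod_cast this
  · have : Q * N ^ k < 2 ^ w := by
      calc Q * N ^ k < L ^ Q * L ^ k := by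
            refine Nat.mul_lt_mul_of_lt_of_le
              (Nat.lt_two_pow_self.trans_le (Nat.pow_le_pow_left hL2 _))
              (Nat.pow_le_pow_left hNL _) (Nat.pow_pos hL1)
        _ = L ^ (Q + k) := (pow_add _ _ _).symm
        _ ≤ L ^ (300 + k + Q) := Nat.pow_le_pow_right hL1 (by omega)
        _ ≤ _ := hw'
    exact_mod_cast this
  · have h1 : (m : ℝ) ≤ 4 * lg σ N := by
      have h2 : ((2 : ℝ)) ^ m ≤ (L : ℝ) ^ 4 := by exact_mod_cast hmL
      have h3 := Real.logb_le_logb_of_le (b := 2) (by norm_num) (by positivity) h2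
      rw [Real.logb_pow, Real.logb_pow, Real.logb_self_eq_one (by norm_num)] at h3
      rw [hlg]
      push_cast at h3
      linarith
    have h2 : ((2 ^ m : ℕ) : ℝ) ≤ 16 * (σ * N) := by exact_mod_cast hmσ
    calc ((2 ^ m * m : ℕ) : ℝ) = ((2 ^ m : ℕ) : ℝ) * m := by push_cast; ring
      _ ≤ 16 * (σ * N) * (4 * lg σ N) := by gcongr
      _ = _ := by ring

/-- A specified command gives an algorithm. -/
theorem solvableInTime_of_spec {Q g K J : ℕ} (hk : 0 < k)
    {Good : (N σ : ℕ) → (Fin k → Fin N → Fin σ) → (ℕ → ℕ) → Prop} (c : Cmd)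
    (hc : ∀ (N σ w m : ℕ) (X : Fin k → Fin N → Fin σ) (x : ℕ → ℕ → ℕ) (s : Core), Sizes w k N σ m → (Q : ℤ) * N ^ k < 2 ^ w →
      Represents X x → (∀ j i, x j i < σ) → s.reg 0 = N → s.reg 1 = σ → s.reg 2 = 0 →
      Holds k N x s → Spec w c s (K * (N ^ g * (2 ^ m * m))) fun s' =>
        ∃ o : ℕ → ℕ, (∀ r < J, s'.reg r = o r ∧ (o r : ℤ) < 2 ^ w) ∧
          ∀ out : ℕ → ℕ, (∀ r < J, out r = o r) → Good N σ X out) :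
    SolvableInTime k Good fun N σ => (σ : ℝ) * (N : ℝ) ^ (g + 1) * lg σ N := by
  -- The representation only covers registers below `R`, so `R` has to exceed the output registers
  -- as well as the variables of the program.
  set R := max c.bound J
  refine ⟨c.code R 0, ((64 * K : ℕ) : ℝ), ((300 + k + Q : ℕ) : ℝ), fun N σ w hN hw X => ?_⟩
  -- The alphabet is nonempty because a string of positive length has a character.
  have hσ : 1 ≤ σ := (Nat.zero_le _).trans_lt (X ⟨0, hk⟩ ⟨0, hN⟩).2
  obtain ⟨m, h, hQ, hm⟩ := exists_sizes hk hN hσ hw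
  -- The default value `0` outside the index range is below `σ`, so the bound on characters holds
  -- for all indices.
  set x : ℕ → ℕ → ℕ := fun j i => if h : j < k ∧ i < N then X ⟨j, h.1⟩ ⟨i, h.2⟩ else 0 with hx
  have hX : Represents X x := fun j i => by simp [hx]
  have hxσ : ∀ j i, x j i < σ := fun j i => by
    simp only [hx]; split_ifs
    · exact Fin.is_lt _
    · exact hσ
  obtain ⟨s', t, he, ht, o, ho, hG⟩ := hc N σ w m X x (initCore k N σ x) h hQ hX hxσ
    (by simp [initCore]) (by simp [initCore]) (by simp [initCore]) (holds_initCore hN x)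
  obtain ⟨hr, hpc⟩ := he.run_code (p := c.code R 0) (R := R) (le_max_left _ _) (off := 0)
    (st := input w X) rfl (rep_initCore hX R) fun i _ => by rw [zero_add]
  refine ⟨t, ?_, ?_, hG _ fun r hrk => ?_⟩
  · have ht' : (t : ℝ) ≤ K * (N ^ g * ((2 ^ m * m : ℕ) : ℝ)) := by exact_mod_cast ht
    calc (t : ℝ) ≤ K * (N ^ g * (64 * (σ * N * lg σ N))) := ht'.trans (by gcongr)
      _ = _ := by push_cast; ring
  · rw [Halted, hpc, Cmd.length_code, zero_add]
  · obtain ⟨h1, h2⟩ := ho r hrk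
    rw [hr.reg r (hrk.trans_le (le_max_right _ _)), h1,
      InWord.toNat_ofInt ⟨by positivity, h2⟩, Int.toNat_natCast]

end

theorem solvable_exact {k : ℕ} (hk : 2 ≤ k) :
    SolvableInTime k (IsSolution k) fun N σ => (σ : ℝ) * (N : ℝ) ^ (k - 1) * lg σ N := by
  rw [show k - 1 = k - 2 + 1 by omega]
  refine solvableInTime_of_spec (Q := 1) (J := k)
    (K := solveConst k (k - 1) id (k - 2) + 6 + (digitsCmd (k + 50) (k - 1)).size) (by omega) (exactCmd k)
    fun N σ w m X x s h hQ hX hx h0 h1 h2 hs => ?_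
  have hN1 : (1 : ℤ) ≤ N := by exact_mod_cast h.N_pos
  rw [Nat.cast_one, one_mul] at hQ
  have hg : (N : ℤ) ^ (k - 1) < 2 ^ w := (pow_le_pow_right₀ hN1 (by omega)).trans_lt hQ
  refine Spec.mono (exactCmd_spec h hk hx hg h0 h1 hs) le_rfl ?_
  rintro s' ⟨a1, f, hf, a2, a3⟩
  rw [bestScore_id_eq (by omega) h.N_pos hX] at a1 a3
  refine ⟨fun r => if r = 0 then kSD X else f / N ^ (r - 1) % N, fun r hr => ?_, fun out hout => ?_⟩
  · have hNw := h.N_lt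
    rcases r with _ | r
    · have := kSD_le X
      refine ⟨a1, ?_⟩
      change (kSD X : ℤ) < 2 ^ w
      omega
    · refine ⟨a2 r (by omega), ?_⟩
      change ((f / N ^ r % N : ℕ) : ℤ) < 2 ^ w
      have := Nat.mod_lt (f / N ^ r) h.N_pos
      omega
  · refine ⟨by simpa using hout 0 (by omega),
      fun j => ⟨f / N ^ j.val % N, Nat.mod_lt _ h.N_pos⟩, ?_, fun j => ?_⟩
    · rw [← a3]
      exact (codeScore_id_eq (by omega) hX fun j => rfl).symm
    · simpa using hout (j.val + 1) (by omega)

theorem solvable_approx {k ℓ : ℕ} (hk : 2 ≤ k) (hℓ : 2 ≤ ℓ) :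
    SolvableInTime k (IsApproximation ℓ k) fun N σ =>
      (σ : ℝ) * (N : ℝ) ^ ⌈((k : ℝ) - 1) / (ℓ : ℝ)⌉₊ * lg σ N := by
  have hk1 : ((k - 1 : ℕ) : ℝ) = (k : ℝ) - 1 := by rw [Nat.cast_sub (by omega), Nat.cast_one]
  rw [← hk1]
  have hℓ0 : (0 : ℝ) < ℓ := by exact_mod_cast (show 0 < ℓ by omega)
  -- The ceiling is positive since `k ≥ 2`. One of the `g + 1` offsets of a group is handled by the
  -- convolution, the other `g` by enumeration.
  obtain ⟨g, hg⟩ : ∃ g, ⌈((k - 1 : ℕ) : ℝ) / (ℓ : ℝ)⌉₊ = g + 1 := by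
    refine Nat.exists_eq_add_one.mpr (Nat.ceil_pos.mpr (div_pos ?_ hℓ0))
    exact_mod_cast (show 0 < k - 1 by omega)
  rw [hg]
  have hkℓ : k - 1 ≤ ℓ * (g + 1) := by
    have := Nat.le_ceil (((k - 1 : ℕ) : ℝ) / (ℓ : ℝ))
    rw [hg, div_le_iff₀ hℓ0, mul_comm] at this
    exact_mod_cast this
  have hgk : g ≤ k := by
    have h1 : ⌈((k - 1 : ℕ) : ℝ) / (ℓ : ℝ)⌉₊ ≤ k - 1 := Nat.ceil_le.mpr
      (div_le_self (by positivity) (by exact_mod_cast (show 1 ≤ ℓ by omega)))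
    omega
  -- The output is at most `k * ℓ * N`; this choice of `Q` makes it fit into a word.
  refine solvableInTime_of_spec (Q := 1 + k * ℓ) (J := 1) (K := groupsConst k g ℓ + 4) (by omega) (approxCmd k g ℓ)
    fun N σ w m X x s h hQ hX hx h0 h1 h2 hs => ?_
  have hQ' : (1 + k * ℓ) * N ^ k < 2 ^ w := by exact_mod_cast hQ
  have hNk : N ≤ N ^ k := Nat.le_self_pow (by omega) N
  have hgw : (N : ℤ) ^ g < 2 ^ w := by
    have : N ^ g < 2 ^ w := by
      refine ((Nat.pow_le_pow_right h.N_pos hgk).trans ?_).trans_lt hQ'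
      exact Nat.le_mul_of_pos_left _ (by omega)
    exact_mod_cast this
  refine Spec.mono (approxCmd_spec h hk hx hgw h0 h1 h2 hs ℓ) le_rfl fun s' a1 => ?_
  set D' := k * ∑ a ∈ Finset.range ℓ,
    (N - bestScore N x (k - 1) (group k (g + 1) a) (g + 1)) with hD'
  have hlt : D' < 2 ^ w := by
    refine lt_of_le_of_lt ?_ hQ'
    calc D' ≤ k * ∑ _a ∈ Finset.range ℓ, N :=
          Nat.mul_le_mul_left _ (Finset.sum_le_sum fun _ _ => Nat.sub_le _ _)
      _ = k * ℓ * N := by simp [mul_assoc]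
      _ ≤ (1 + k * ℓ) * N ^ k := Nat.mul_le_mul (Nat.le_add_left _ _) hNk
  refine ⟨fun _ => D', fun r hr => ?_, fun out hout => ?_⟩
  · obtain rfl : r = 0 := by omega
    exact ⟨a1, by exact_mod_cast hlt⟩
  · rw [IsApproximation, hout 0 one_pos]
    exact kSDDistance_approx hk h.N_pos hX (Nat.succ_pos g) hkℓ

end ShiftDistance

theorem mainTheorem11 (k : ℕ) (hk : 2 ≤ k) :
    ShiftDistance.SolvableInTime k (ShiftDistance.IsSolution k)
      (fun N σ => (σ : ℝ) * (N : ℝ) ^ (k - 1) * ShiftDistance.lg σ N) ∧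
    ∀ ℓ : ℕ, 2 ≤ ℓ →
      ShiftDistance.SolvableInTime k (ShiftDistance.IsApproximation ℓ k)
        (fun N σ => (σ : ℝ) * (N : ℝ) ^ ⌈((k : ℝ) - 1) / (ℓ : ℝ)⌉₊ * ShiftDistance.lg σ N) :=
  ⟨ShiftDistance.solvable_exact hk, fun _ hℓ => ShiftDistance.solvable_approx hk hℓ⟩
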